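/- For $u\in H^1(\mathbb R^2)=H^1(\mathbb R^2;\mathbb C)$ put $$\mathcal M(u)=\|u\|_2,\qquad \mathcal H(u)=\tfrac12\|\nabla u\|_2^2-\tfrac14\|u\|_4^4-\tfrac16\|u\|_6^6,\qquad \mathcal K(u)=\|\nabla u\|_2^2-\tfrac12\|u\|_4^4-\tfrac23\|u\|_6^6,$$ and for $c>0$ let $$m_c=\inf\{\mathcal H(u): u\in H^1(\mathbb R^2),\ \mathcal M(u)=c,\ \mathcal K(u)=0\}.$$ Let $Q\in H^1(\mathbb R^2)$ be the positive and radially symmetric ground state of $-\Delta Q+Q-Q^3=0$, that is, the positive radial solution which has least action $\frac12\|\nabla v\|_2^2+\frac12\|v\|_2^2-\frac14\|v\|_4^4$ among all nonzero solutions $v\in H^1(\mathbb R^2)$ of $-\Delta v+v-|v|^2v=0$. Set $$\mathcal A=\{u\in H^1(\mathbb R^2):\ \mathcal M(u)<\mathcal M(Q),\ \mathcal H(u)<m_{\mathcal M(u)},\ \mathcal K(u)>0\}.$$ Lemma. Let $I\subset\mathbb R$ be an interval with $0\in I$ (for instance the maximal lifespan), and let $u\in C(I;H^1(\mathbb R^2))$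 be a solution, in the sense of distributions, of $$i\partial_t u+\Delta u+|u|^2u+|u|^4u=0\quad\text{in } I\times\mathbb R^2$$ with $u(0)\in\mathcal A$. Then $u(t)\in\mathcal A$ for all $t\in I$. If moreover $\mathcal M(u(0))=(1-\delta)^{1/2}\mathcal M(Q)$ with $\delta\in(0,1)$, then for all $t\in I$ $$\mathcal K(u(t))\ \ge\ \min\Big\{\delta\,\mathcal H(u(0)),\ \Big(\big(\tfrac2\delta\big)^{1/2}-1\Big)^{-1}\big(m_{\mathcal M(u(0))}-\mathcal H(u(0))\big)\Big\}.$$ -/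

import Mathlib

open MeasureTheory Set
open scoped SchwartzMap

noncomputable section

namespace CQNLS

/-- The plane `ℝ²` with its Euclidean norm. -/
abbrev Plane : Type := EuclideanSpace ℝ (Fin 2)

/-- Complex-valued `L²` functions on the plane. -/
abbrev L2 : Type := Lp ℂ 2 (volume : Measure Plane)

/-- `L²` fields on the plane with values in `ℂ²`; their norm is the `L²` norm of the pointwise
Euclidean length. -/
abbrev L2Field : Type := Lp (EuclideanSpace ℂ (Fin 2)) 2 (volume : Measure Plane)

/-- The partial derivative `∂ⱼ φ` of a Schwartz function. -/
def partialDeriv (j : Fin 2) (φ : 𝓢(Plane, ℂ)) (x : Plane) : ℂ :=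
  fderiv ℝ φ x (EuclideanSpace.single j 1)

/-- `g` is the distributional gradient of `f`: `∫ f ∂ⱼφ = -∫ gⱼ φ` for all Schwartz functions `φ`
and both `j`. -/
def IsWeakGradient (f : L2) (g : L2Field) : Prop :=
  ∀ (φ : 𝓢(Plane, ℂ)) (j : Fin 2),
    ∫ x, f x * partialDeriv j φ x = -∫ x, (g x) j * φ x

theorem partialDeriv_eq (j : Fin 2) (φ : 𝓢(Plane, ℂ)) :
    partialDeriv j φ =
      ⇑(LineDeriv.lineDerivOp (EuclideanSpace.single j (1 : ℝ) : Plane) φ : 𝓢(Plane, ℂ)) := by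
  funext x
  rw [SchwartzMap.lineDerivOp_apply_eq_fderiv]
  rfl

theorem integrable_mul_schwartz (f : L2) (φ : 𝓢(Plane, ℂ)) :
    Integrable (fun x => f x * φ x) :=
  (Lp.memLp f).integrable_mul (φ.memLp 2 volume)

theorem integrable_mul_partialDeriv (f : L2) (j : Fin 2) (φ : 𝓢(Plane, ℂ)) :
    Integrable (fun x => f x * partialDeriv j φ x) := by
  rw [partialDeriv_eq]
  exact integrable_mul_schwartz f _

theorem integrable_coord_mul (g : L2Field) (j : Fin 2) (φ : 𝓢(Plane, ℂ)) :
    Integrable (fun x => (g x) j * φ x) := by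
  have h : MemLp (fun x => (g x) j) 2 (volume : Measure Plane) :=
    (EuclideanSpace.proj j : EuclideanSpace ℂ (Fin 2) →L[ℂ] ℂ).comp_memLp' (Lp.memLp g)
  exact h.integrable_mul (φ.memLp 2 volume)

theorem IsWeakGradient.add {f₁ f₂ : L2} {g₁ g₂ : L2Field} (h₁ : IsWeakGradient f₁ g₁)
    (h₂ : IsWeakGradient f₂ g₂) : IsWeakGradient (f₁ + f₂) (g₁ + g₂) := by
  intro φ j
  have e₁ : ∫ x, (f₁ + f₂ : L2) x * partialDeriv j φ x =
      ∫ x, (f₁ x * partialDeriv j φ x + f₂ x * partialDeriv j φ x) := by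
    apply integral_congr_ae
    filter_upwards [Lp.coeFn_add f₁ f₂] with x hx
    rw [hx, Pi.add_apply, add_mul]
  have e₂ : ∫ x, ((g₁ + g₂ : L2Field) x) j * φ x =
      ∫ x, ((g₁ x) j * φ x + (g₂ x) j * φ x) := by
    apply integral_congr_ae
    filter_upwards [Lp.coeFn_add g₁ g₂] with x hx
    rw [hx, Pi.add_apply, PiLp.add_apply, add_mul]
  rw [e₁, e₂, integral_add (integrable_mul_partialDeriv f₁ j φ)
    (integrable_mul_partialDeriv f₂ j φ), integral_add (integrable_coord_mul g₁ j φ)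
    (integrable_coord_mul g₂ j φ), h₁ φ j, h₂ φ j, neg_add]

theorem IsWeakGradient.smul (c : ℂ) {f : L2} {g : L2Field} (h : IsWeakGradient f g) :
    IsWeakGradient (c • f) (c • g) := by
  intro φ j
  have e₁ : ∫ x, (c • f : L2) x * partialDeriv j φ x = ∫ x, c * (f x * partialDeriv j φ x) := by
    apply integral_congr_ae
    filter_upwards [Lp.coeFn_smul c f] with x hx
    rw [hx, Pi.smul_apply, smul_eq_mul, mul_assoc]
  have e₂ : ∫ x, ((c • g : L2Field) x) j * φ x = ∫ x, c * ((g x) j * φ x) := by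
    apply integral_congr_ae
    filter_upwards [Lp.coeFn_smul c g] with x hx
    rw [hx, Pi.smul_apply, PiLp.smul_apply, smul_eq_mul, mul_assoc]
  rw [e₁, e₂, integral_const_mul, integral_const_mul, h φ j, mul_neg]

theorem isWeakGradient_zero : IsWeakGradient 0 0 := by
  have h : ∀ (f : L2) (g : L2Field), f = 0 → g = 0 → IsWeakGradient f g := by
    intro f g hf hg φ j
    have e₁ : ∫ x, f x * partialDeriv j φ x = ∫ _x : Plane, (0 : ℂ) := by
      apply integral_congr_ae
      subst hf
      filter_upwards [Lp.coeFn_zero ℂ 2 (volume : Measure Plane)] with x hx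
      rw [hx, Pi.zero_apply, zero_mul]
    have e₂ : ∫ x, (g x) j * φ x = ∫ _x : Plane, (0 : ℂ) := by
      apply integral_congr_ae
      subst hg
      filter_upwards [Lp.coeFn_zero (EuclideanSpace ℂ (Fin 2)) 2 (volume : Measure Plane)]
        with x hx
      rw [hx, Pi.zero_apply, PiLp.zero_apply, zero_mul]
    rw [e₁, e₂, integral_zero, neg_zero]
  exact h 0 0 rfl rfl

/-- The Sobolev space `H¹(ℝ²)` of complex-valued functions, realised as the space of pairs
`(f, ∇f)` with `f` and its distributional gradient in `L²`. It carries the norm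
`(‖f‖₂² + ‖∇f‖₂²)^{1/2}` inherited from the `ℓ²` product; the second component is determined by
the first. -/
def sobolevH1 : Submodule ℂ (WithLp 2 (L2 × L2Field)) where
  carrier := {p | IsWeakGradient p.fst p.snd}
  add_mem' h₁ h₂ := h₁.add h₂
  zero_mem' := isWeakGradient_zero
  smul_mem' c _ h := h.smul c

/-- `H¹(ℝ²)` as a type, with its normed space structure. -/
abbrev H1 : Type := sobolevH1

/-- The underlying `L²` function of an element of `H¹(ℝ²)`. -/
def H1.fn (v : H1) : L2 := v.1.fst

/-- The gradient of an element of `H¹(ℝ²)`. -/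
def H1.grad (v : H1) : L2Field := v.1.snd

/-- The mass `𝓜(v) = ‖v‖₂` (the norm, not its square). -/
def mass (v : H1) : ℝ := ‖v.fn‖

/-- The energy `𝓗(v) = ½‖∇v‖₂² - ¼‖v‖₄⁴ - ⅙‖v‖₆⁶`. -/
def energy (v : H1) : ℝ :=
  1 / 2 * ‖v.grad‖ ^ 2 - 1 / 4 * (∫ x, ‖v.fn x‖ ^ 4) - 1 / 6 * (∫ x, ‖v.fn x‖ ^ 6)

/-- The virial `𝓚(v) = ‖∇v‖₂² - ½‖v‖₄⁴ - ⅔‖v‖₆⁶`. -/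
def virial (v : H1) : ℝ :=
  ‖v.grad‖ ^ 2 - 1 / 2 * (∫ x, ‖v.fn x‖ ^ 4) - 2 / 3 * (∫ x, ‖v.fn x‖ ^ 6)

/-- `m_c`, the infimum of the energy over all `v ∈ H¹(ℝ²)` with `𝓜(v) = c` and `𝓚(v) = 0`. On this
set `𝓗(v) = ⅙‖v‖₆⁶ ≥ 0`, and for `0 < c < 𝓜(Q)` the set is nonempty. -/
def minEnergy (c : ℝ) : ℝ :=
  sInf (energy '' {v : H1 | mass v = c ∧ virial v = 0})

/-- `v ∈ H¹(ℝ²)` solves `-Δv + v - |v|²v = 0` in the sense of distributions. -/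
def IsStationarySolution (v : H1) : Prop :=
  ∀ φ : 𝓢(Plane, ℂ),
    (∑ j : Fin 2, ∫ x, (v.grad x) j * partialDeriv j φ x) + (∫ x, v.fn x * φ x)
      - ∫ x, ((‖v.fn x‖ ^ 2 : ℝ) : ℂ) * v.fn x * φ x = 0

/-- The action functional of `-Δv + v - |v|²v = 0`. -/
def action (v : H1) : ℝ :=
  1 / 2 * ‖v.grad‖ ^ 2 + 1 / 2 * ‖v.fn‖ ^ 2 - 1 / 4 * (∫ x, ‖v.fn x‖ ^ 4)

/-- `Q` is a positive and radially symmetric ground state of `-ΔQ + Q - Q³ = 0`: a nonzero `H¹`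
solution of least action among all nonzero `H¹` solutions. -/
structure IsPositiveRadialGroundState (Q : H1) : Prop where
  solves : IsStationarySolution Q
  least_action : ∀ v : H1, v ≠ 0 → IsStationarySolution v → action Q ≤ action v
  pos : ∀ᵐ x : Plane, (Q.fn x).im = 0 ∧ 0 < (Q.fn x).re
  radial : ∀ R : Plane ≃ₗᵢ[ℝ] Plane, ∀ᵐ x : Plane, Q.fn (R x) = Q.fn x

/-- The set `𝓐 = {v ∈ H¹(ℝ²) : 𝓜(v) < 𝓜(Q), 𝓗(v) < m_{𝓜(v)}, 𝓚(v) > 0}`. -/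
def setA (Q : H1) : Set H1 :=
  {v | mass v < mass Q ∧ energy v < minEnergy (mass v) ∧ 0 < virial v}

/-- `u` is a solution of `i ∂ₜu + Δu + |u|²u + |u|⁴u = 0` on the time interval `I`: it belongs to
`C(I; H¹(ℝ²))` and, tested against any Schwartz function of the space variable, satisfies
`∂ₜu = i (Δu + |u|²u + |u|⁴u)` at every time in `I` (one-sided derivatives at endpoints of `I`). -/
structure IsSolution (I : Set ℝ) (u : ℝ → H1) : Prop where
  continuousOn : ContinuousOn u I
  equation : ∀ φ : 𝓢(Plane, ℂ), ∀ t ∈ I,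
    HasDerivWithinAt (fun s => ∫ x, (u s).fn x * φ x)
      (Complex.I * (-(∑ j : Fin 2, ∫ x, ((u t).grad x) j * partialDeriv j φ x)
        + ∫ x, ((‖(u t).fn x‖ ^ 2 + ‖(u t).fn x‖ ^ 4 : ℝ) : ℂ) * (u t).fn x * φ x)) I t

end CQNLS

end

/-!
# Invariance of the set `𝓐` and a lower bound for the virial

The lemma reduces to conservation of mass and energy for solutions that are merely in `C(I; H¹)`
(`IsSolution.conservation`). Given conservation, the conditions `𝓜(u) < 𝓜(Q)` and
`𝓗(u) < m_{𝓜(u)}` persist. Were the virial `𝓚(u(t))` to become nonpositive, it would vanish at some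
time by continuity, and there `𝓗(u) ≥ m_{𝓜(u)}` by the definition of `m`, a contradiction.

For the lower bound, put `a = ‖∇v‖₂² - ½‖v‖₄⁴` and `x = ⅔‖v‖₆⁶`, so that `𝓚(v) = a - x` and
`𝓗(v) = a/2 - x/4`. The mass-preserving rescaling `l · v(l ·)` has virial `l²a - l⁴x`
(`exists_rescale`). Choosing `l² = a/x` gives `m_{𝓜(v)} ≤ a²/(4x)`, that is,
`m_{𝓜(v)} - 𝓗(v) ≤ 𝓚(v)²/(4x)` (`minEnergy_sub_energy_le`). Either `𝓚(v) ≥ δ𝓗(v)`, or `𝓚(v)` is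
small compared with `x` and this quadratic bound yields the second member of the minimum
(`min_le_virial`).

Conservation of mass follows by testing the integrated equation against `u(t) + u(s)`
(`IsWeakSolution.mass_eq`). Energy is the substantial part: the pairing of `∂ₜu ∈ H⁻¹` with
`Δu ∈ H⁻¹` is not defined, and the usual argument regularises the data and appeals to
well-posedness. Here the energy is compared at two times through averages over windows `[r, r + h]`.
The window average of `u` has a differentiable kinetic energy, and by the equation its derivative is
`h⁻¹` times the average over the window of `Re ⟨u(r + h) - u(r), f(u)⟩`, with `f` the nonlinearity
(`IsWeakSolution.average_energy_identity`). The averaged potential energy has as derivative `h⁻¹`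
times its increment from `r` to `r + h`. Apart from the factor `h⁻¹`, the two agree
up to a second-order remainder, bounded by `(1 + ‖u‖_∞⁴) ‖u(r + h) - u(r)‖₂²`
(`abs_potE_sub_le`). The increment satisfies `‖u(r + h) - u(r)‖₂² = o(h)`
(`IsWeakSolution.exists_norm_sub_sq_le`), which is exactly what is needed for the remainders to
vanish as `h → 0`, provided that `‖u(t)‖_∞⁴` is integrable in time.

That `u ∈ L⁴_t L^∞_x` locally in time (`IsWeakSolution.exists_sup_bound`) is a dispersive fact,
since `H¹(ℝ²)` does not embed in `L^∞`. The operator `(1 - Δ)⁻¹ exp(iτΔ)` is the average `∫₀^∞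
exp(-σ) exp((σ + iτ)Δ) dσ` of operators with explicit Gaussian kernels, and is therefore bounded
from `L¹` to `L^∞` by a multiple of `|τ|^(-1/4)`, and by a multiple of `|τ|^(-3/4)` after one
derivative (`norm_resolventS_propS_le`, `norm_dS_resolventS_propS_le`). A `TT*` argument in `H¹`
turns the first bound into an `L⁴` bound for the maximal function of the free evolution
(`lintegral_iSup_inner_pow_four_lt_top`). The Duhamel term of `IsWeakSolution.inner_eq_duhamel` is
even bounded, because the nonlinearity maps `H¹` to `W^{1,1}` and `|τ|^(-3/4)` is integrable near
zero (`IsWeakSolution.exists_duhamel_bound`).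
-/


noncomputable section

namespace CQNLS

open scoped FourierTransform LineDeriv Laplacian Real InnerProductSpace ENNReal NNReal
open Filter Topology

/-! ### Schwartz functions inside `H¹` -/

/-- The partial derivative `∂ⱼ φ` as a Schwartz function. -/
def dS (j : Fin 2) (φ : 𝓢(Plane, ℂ)) : 𝓢(Plane, ℂ) :=
  LineDeriv.lineDerivOp (EuclideanSpace.single j (1 : ℝ) : Plane) φ

theorem coe_dS (j : Fin 2) (φ : 𝓢(Plane, ℂ)) : ⇑(dS j φ) = partialDeriv j φ :=
  (partialDeriv_eq j φ).symm

/-- The complex conjugate of a Schwartz function. -/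
def conjS (φ : 𝓢(Plane, ℂ)) : 𝓢(Plane, ℂ) :=
  SchwartzMap.postcompCLM (𝕜 := ℝ) (Complex.conjCLE : ℂ →L[ℝ] ℂ) φ

@[simp] theorem conjS_apply (φ : 𝓢(Plane, ℂ)) (x : Plane) :
    conjS φ x = (starRingEnd ℂ) (φ x) := by
  simp [conjS]

@[simp] theorem conjS_conjS (φ : 𝓢(Plane, ℂ)) : conjS (conjS φ) = φ := by
  ext x; simp

theorem dS_conjS (j : Fin 2) (φ : 𝓢(Plane, ℂ)) : dS j (conjS φ) = conjS (dS j φ) := by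
  ext x
  rw [conjS_apply, coe_dS, coe_dS, partialDeriv, partialDeriv]
  have h : (⇑(conjS φ) : Plane → ℂ) = fun x => (Complex.conjCLE : ℂ →L[ℝ] ℂ) (φ x) := by
    funext x; simp
  have h2 := ((Complex.conjCLE : ℂ →L[ℝ] ℂ).hasFDerivAt.comp x (φ.hasFDerivAt x)).fderiv
  rw [h]
  change fderiv ℝ (⇑(Complex.conjCLE : ℂ →L[ℝ] ℂ) ∘ ⇑φ) x _ = _
  rw [h2]
  simp

/-- The inclusion of the `j`-th coordinate axis of `ℂ²`. -/
def coordEmb (j : Fin 2) : ℂ →L[ℂ] EuclideanSpace ℂ (Fin 2) :=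
  ContinuousLinearMap.toSpanSingleton ℂ (EuclideanSpace.single j (1 : ℂ))

theorem coordEmb_apply (j : Fin 2) (z : ℂ) : coordEmb j z = EuclideanSpace.single j z := by
  ext i
  by_cases h : i = j <;> simp [coordEmb, ContinuousLinearMap.toSpanSingleton_apply, h]

/-- The Schwartz field with `j`-th component `φ` and other component `0`. -/
def vecS (j : Fin 2) (φ : 𝓢(Plane, ℂ)) : 𝓢(Plane, EuclideanSpace ℂ (Fin 2)) :=
  SchwartzMap.postcompCLM (𝕜 := ℂ) (coordEmb j) φ

theorem vecS_apply (j : Fin 2) (φ : 𝓢(Plane, ℂ)) (x : Plane) :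
    vecS j φ x = EuclideanSpace.single j (φ x) := by
  rw [vecS, SchwartzMap.postcompCLM_apply, coordEmb_apply]

/-- The gradient of a Schwartz function. -/
def gradS (φ : 𝓢(Plane, ℂ)) : 𝓢(Plane, EuclideanSpace ℂ (Fin 2)) :=
  ∑ j, vecS j (dS j φ)

theorem gradS_apply (φ : 𝓢(Plane, ℂ)) (x : Plane) (j : Fin 2) :
    gradS φ x j = dS j φ x := by
  fin_cases j <;> simp [gradS, Fin.sum_univ_two, vecS_apply]

theorem integral_mul_schwartz_eq_inner (f : L2) (φ : 𝓢(Plane, ℂ)) :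
    ∫ x, f x * φ x = ⟪(conjS φ).toLp 2, f⟫_ℂ := by
  rw [L2.inner_def]
  apply integral_congr_ae
  filter_upwards [(conjS φ).coeFn_toLp 2 volume] with x hx
  rw [hx]
  simp

theorem integral_coord_mul_eq_inner (g : L2Field) (j : Fin 2) (φ : 𝓢(Plane, ℂ)) :
    ∫ x, (g x) j * φ x = ⟪(vecS j (conjS φ)).toLp 2, g⟫_ℂ := by
  rw [L2.inner_def]
  apply integral_congr_ae
  filter_upwards [(vecS j (conjS φ)).coeFn_toLp 2 volume] with x hx
  rw [hx, vecS_apply, EuclideanSpace.inner_single_left]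
  simp [mul_comm]

theorem inner_toLp_eq_integral (φ : 𝓢(Plane, ℂ)) (f : L2) :
    ⟪φ.toLp 2, f⟫_ℂ = ∫ x, f x * conjS φ x := by
  rw [integral_mul_schwartz_eq_inner, conjS_conjS]

theorem inner_gradS_eq_integral (φ : 𝓢(Plane, ℂ)) (g : L2Field) :
    ⟪(gradS φ).toLp 2, g⟫_ℂ = ∑ j, ∫ x, (g x) j * dS j (conjS φ) x := by
  have h : (gradS φ).toLp 2 = ∑ j, (vecS j (dS j φ)).toLp 2 (volume : Measure Plane) := by
    have := map_sum (SchwartzMap.toLpCLM ℂ (EuclideanSpace ℂ (Fin 2)) 2 (volume : Measure Plane))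
      (fun j => vecS j (dS j φ)) Finset.univ
    simpa [gradS] using this
  rw [h, sum_inner]
  refine Finset.sum_congr rfl fun j _ => ?_
  rw [integral_coord_mul_eq_inner, dS_conjS, conjS_conjS]

theorem isWeakGradient_iff (f : L2) (g : L2Field) :
    IsWeakGradient f g ↔ ∀ (φ : 𝓢(Plane, ℂ)) (j : Fin 2),
      ⟪(conjS (dS j φ)).toLp 2, f⟫_ℂ = -⟪(vecS j (conjS φ)).toLp 2, g⟫_ℂ := by
  unfold IsWeakGradient
  refine forall₂_congr fun φ j => ?_
  rw [← integral_mul_schwartz_eq_inner, ← integral_coord_mul_eq_inner, coe_dS]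

theorem isWeakGradient_toLp (φ : 𝓢(Plane, ℂ)) :
    IsWeakGradient (φ.toLp 2) ((gradS φ).toLp 2) := by
  intro ψ j
  have e₁ : ∫ x, (φ.toLp 2 (volume : Measure Plane)) x * partialDeriv j ψ x
      = ∫ x, φ x * dS j ψ x := by
    apply integral_congr_ae
    filter_upwards [φ.coeFn_toLp 2 volume] with x hx
    rw [hx, coe_dS]
  have e₂ : ∫ x, ((gradS φ).toLp 2 (volume : Measure Plane)) x j * ψ x
      = ∫ x, dS j φ x * ψ x := by
    apply integral_congr_ae
    filter_upwards [(gradS φ).coeFn_toLp 2 volume] with x hx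
    rw [hx, gradS_apply]
  rw [e₁, e₂]
  exact SchwartzMap.integral_mul_lineDerivOp_right_eq_neg_left φ ψ _

/-- The inclusion of the Schwartz functions in `H¹`. -/
def ofSchwartz : 𝓢(Plane, ℂ) →ₗ[ℂ] H1 where
  toFun φ := ⟨WithLp.toLp 2
    (φ.toLp 2 (volume : Measure Plane), (gradS φ).toLp 2 (volume : Measure Plane)),
    isWeakGradient_toLp φ⟩
  map_add' φ ψ := by
    have h : gradS (φ + ψ) = gradS φ + gradS ψ := by
      ext x j
      simp [gradS_apply, dS, LineDeriv.lineDerivOp_add]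
    exact Subtype.ext (congrArg (fun G : 𝓢(Plane, EuclideanSpace ℂ (Fin 2)) =>
      WithLp.toLp 2 ((φ + ψ).toLp 2 (volume : Measure Plane), G.toLp 2 (volume : Measure Plane))) h)
  map_smul' c φ := by
    have h : gradS (c • φ) = c • gradS φ := by
      ext x j
      simp [gradS_apply, dS, LineDeriv.lineDerivOp_smul]
    exact Subtype.ext (congrArg (fun G : 𝓢(Plane, EuclideanSpace ℂ (Fin 2)) =>
      WithLp.toLp 2 ((c • φ).toLp 2 (volume : Measure Plane), G.toLp 2 (volume : Measure Plane))) h)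

@[simp] theorem fn_ofSchwartz (φ : 𝓢(Plane, ℂ)) : (ofSchwartz φ).fn = φ.toLp 2 := rfl
@[simp] theorem grad_ofSchwartz (φ : 𝓢(Plane, ℂ)) : (ofSchwartz φ).grad = (gradS φ).toLp 2 := rfl

/-- The underlying function, as a bounded linear map `H¹ → L²`. -/
def fnL : H1 →L[ℂ] L2 := (WithLp.fstL 2 ℂ L2 L2Field).comp sobolevH1.subtypeL

/-- The gradient, as a bounded linear map. -/
def gradL : H1 →L[ℂ] L2Field := (WithLp.sndL 2 ℂ L2 L2Field).comp sobolevH1.subtypeL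

theorem inner_H1 (v w : H1) : ⟪v, w⟫_ℂ = ⟪v.fn, w.fn⟫_ℂ + ⟪v.grad, w.grad⟫_ℂ := by
  rw [Submodule.coe_inner, WithLp.prod_inner_apply]
  rfl

theorem norm_sq_H1 (v : H1) : ‖v‖ ^ 2 = ‖v.fn‖ ^ 2 + ‖v.grad‖ ^ 2 := by
  have h := inner_H1 v v
  have h' := inner_self_eq_norm_sq_to_K (𝕜 := ℂ) v
  rw [h, inner_self_eq_norm_sq_to_K, inner_self_eq_norm_sq_to_K] at h'
  exact_mod_cast h'.symm

theorem norm_fn_le (v : H1) : ‖v.fn‖ ≤ ‖v‖ := by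
  have := norm_sq_H1 v
  exact le_of_sq_le_sq (by nlinarith [sq_nonneg ‖v.grad‖]) (norm_nonneg _)

theorem norm_grad_le (v : H1) : ‖v.grad‖ ≤ ‖v‖ := by
  have := norm_sq_H1 v
  exact le_of_sq_le_sq (by nlinarith [sq_nonneg ‖v.fn‖]) (norm_nonneg _)

theorem isClosed_sobolevH1 : IsClosed (sobolevH1 : Set (WithLp 2 (L2 × L2Field))) := by
  have h : (sobolevH1 : Set (WithLp 2 (L2 × L2Field))) =
      ⋂ (φ : 𝓢(Plane, ℂ)) (j : Fin 2), {p | ⟪(conjS (dS j φ)).toLp 2, p.fst⟫_ℂ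
        = -⟪(vecS j (conjS φ)).toLp 2, p.snd⟫_ℂ} := by
    ext p
    simp only [mem_iInter, mem_ofPred_eq]
    exact isWeakGradient_iff _ _
  rw [h]
  refine isClosed_iInter fun φ => isClosed_iInter fun j => isClosed_eq ?_ ?_
  · exact continuous_const.inner (WithLp.prod_continuous_ofLp 2 L2 L2Field).fst
  · exact (continuous_const.inner (WithLp.prod_continuous_ofLp 2 L2 L2Field).snd).neg

instance : CompleteSpace H1 := isClosed_sobolevH1.completeSpace_coe

theorem laplacian_eq_sum_dS (φ : 𝓢(Plane, ℂ)) : Δ φ = ∑ j, dS j (dS j φ) := by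
  rw [SchwartzMap.laplacian_eq_sum (EuclideanSpace.basisFun (Fin 2) ℝ)]
  simp [dS]

theorem conjS_laplacian (φ : 𝓢(Plane, ℂ)) : conjS (Δ φ) = Δ (conjS φ) := by
  rw [laplacian_eq_sum_dS, laplacian_eq_sum_dS]
  simp only [dS_conjS]
  ext x
  simp

theorem grad_pairing (v : H1) (j : Fin 2) (φ : 𝓢(Plane, ℂ)) :
    ∫ x, (v.grad x) j * φ x = -∫ x, v.fn x * dS j φ x := by
  have h : IsWeakGradient v.fn v.grad := v.2
  rw [coe_dS, h φ j, neg_neg]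

theorem sum_grad_pairing (v : H1) (φ : 𝓢(Plane, ℂ)) :
    ∑ j, ∫ x, (v.grad x) j * dS j φ x = -∫ x, v.fn x * (Δ φ) x := by
  simp only [grad_pairing, laplacian_eq_sum_dS, Fin.sum_univ_two, add_apply, mul_add]
  rw [integral_add (integrable_mul_schwartz _ _) (integrable_mul_schwartz _ _)]
  ring

theorem inner_gradS_grad (φ : 𝓢(Plane, ℂ)) (v : H1) :
    ⟪(gradS φ).toLp 2, v.grad⟫_ℂ
      = -⟪(Δ φ : 𝓢(Plane, ℂ)).toLp 2 (volume : Measure Plane), v.fn⟫_ℂ := by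
  rw [inner_gradS_eq_integral, sum_grad_pairing, inner_toLp_eq_integral, conjS_laplacian]

theorem toLp_sub (φ ψ : 𝓢(Plane, ℂ)) :
    (φ - ψ).toLp 2 (volume : Measure Plane) = φ.toLp 2 volume - ψ.toLp 2 volume :=
  map_sub (SchwartzMap.toLpCLM ℂ ℂ 2 (volume : Measure Plane)) φ ψ

/-- The `H¹` inner product against a Schwartz function is the `L²` inner product against its
image under `1 - Δ`. -/
theorem inner_ofSchwartz (φ : 𝓢(Plane, ℂ)) (v : H1) :
    ⟪ofSchwartz φ, v⟫_ℂ = ⟪(φ - Δ φ : 𝓢(Plane, ℂ)).toLp 2 (volume : Measure Plane), v.fn⟫_ℂ := by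
  rw [inner_H1, fn_ofSchwartz, grad_ofSchwartz, inner_gradS_grad, toLp_sub, inner_sub_left]
  ring

/-- The symbol `4π²|ξ|²` of `-Δ`. -/
def lapSym (ξ : Plane) : ℝ := (2 * π) ^ 2 * ‖ξ‖ ^ 2

theorem lapSym_nonneg (ξ : Plane) : 0 ≤ lapSym ξ := by unfold lapSym; positivity

@[fun_prop]
theorem hasTemperateGrowth_lapSym : lapSym.HasTemperateGrowth := by
  unfold lapSym
  fun_prop

/-- The symbol of the resolvent `(1 - Δ)⁻¹`. -/
def resSym (ξ : Plane) : ℂ := ((1 + lapSym ξ)⁻¹ : ℝ)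

@[fun_prop]
theorem hasTemperateGrowth_resSym : resSym.HasTemperateGrowth := by
  have h := (Function.hasTemperateGrowth_one_add_norm_sq_rpow Plane (-1)).comp
    (((2 * π) • ContinuousLinearMap.id ℝ Plane).hasTemperateGrowth)
  have h2 : resSym = fun ξ => (((((fun x : Plane => (1 + ‖x‖ ^ 2) ^ (-1 : ℝ)) ∘
    ((2 * π) • ContinuousLinearMap.id ℝ Plane)) ξ : ℝ)) : ℂ) := by
    funext ξ
    simp [resSym, lapSym, Function.comp, Real.rpow_neg_one, norm_smul, mul_pow]
  rw [h2]
  exact Function.Complex.hasTemperateGrowth_ofReal.comp h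

/-- Fourier multiplication of a Schwartz function by a symbol. -/
abbrev mulF (g : Plane → ℂ) (φ : 𝓢(Plane, ℂ)) : 𝓢(Plane, ℂ) :=
  SchwartzMap.fourierMultiplierCLM ℂ g φ

theorem fourier_mulF {g : Plane → ℂ} (hg : g.HasTemperateGrowth) (φ : 𝓢(Plane, ℂ)) (ξ : Plane) :
    𝓕 (mulF g φ) ξ = g ξ * 𝓕 φ ξ := by
  rw [mulF, SchwartzMap.fourierMultiplierCLM_apply, FourierTransform.fourier_fourierInv_eq,
    SchwartzMap.smulLeftCLM_apply_apply hg]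
  rfl

theorem fourier_injective {φ ψ : 𝓢(Plane, ℂ)} (h : ∀ ξ, 𝓕 φ ξ = 𝓕 ψ ξ) : φ = ψ := by
  have : 𝓕 φ = 𝓕 ψ := SchwartzMap.ext h
  rw [← FourierTransform.fourierInv_fourier_eq (F := 𝓢(Plane, ℂ)) φ, this,
    FourierTransform.fourierInv_fourier_eq]

theorem fourier_laplacian (φ : 𝓢(Plane, ℂ)) (ξ : Plane) :
    𝓕 (Δ φ) ξ = -(lapSym ξ : ℂ) * 𝓕 φ ξ := by
  rw [SchwartzMap.laplacian_eq_fourierMultiplierCLM,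
    ← SchwartzMap.fourierMultiplierCLM_ofReal ℂ (by fun_prop), FourierTransform.fourier_smul,
    smul_apply, fourier_mulF (by fun_prop)]
  simp [lapSym]
  ring

/-- The resolvent `(1 - Δ)⁻¹` on Schwartz functions. -/
def resolventS (φ : 𝓢(Plane, ℂ)) : 𝓢(Plane, ℂ) := mulF resSym φ

theorem fourier_resolventS (φ : 𝓢(Plane, ℂ)) (ξ : Plane) :
    𝓕 (resolventS φ) ξ = resSym ξ * 𝓕 φ ξ := fourier_mulF (by fun_prop) φ ξ

theorem resolventS_sub_laplacian (φ : 𝓢(Plane, ℂ)) :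
    resolventS φ - Δ (resolventS φ) = φ := by
  apply fourier_injective
  intro ξ
  have hs : 𝓕 (resolventS φ - Δ (resolventS φ)) = 𝓕 (resolventS φ) - 𝓕 (Δ (resolventS φ)) :=
    map_sub (FourierTransform.fourierCLM ℂ 𝓢(Plane, ℂ)) _ _
  rw [hs, sub_apply, fourier_laplacian, fourier_resolventS,
    resSym]
  have h : (1 + lapSym ξ : ℂ) ≠ 0 := by
    exact_mod_cast (by linarith [lapSym_nonneg ξ] : (0:ℝ) < 1 + lapSym ξ).ne'
  push_cast
  field_simp
  ring

/-- Schwartz functions are dense in `H¹`: an element orthogonal to all of them is orthogonal in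
`L²` to the range of `1 - Δ` on Schwartz functions, which is everything. -/
theorem denseRange_ofSchwartz : DenseRange ofSchwartz := by
  have h : (LinearMap.range ofSchwartz).topologicalClosure = ⊤ := by
    rw [Submodule.topologicalClosure_eq_top_iff, Submodule.eq_bot_iff]
    intro v hv
    have hv' : ∀ φ : 𝓢(Plane, ℂ), ⟪φ.toLp 2, v.fn⟫_ℂ = 0 := by
      intro φ
      have := (Submodule.mem_orthogonal _ v).1 hv (ofSchwartz (resolventS φ)) ⟨_, rfl⟩
      rwa [inner_ofSchwartz, resolventS_sub_laplacian] at this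
    have h0 : v.fn = 0 := by
      have hd := SchwartzMap.denseRange_toLpCLM (F := ℂ) (E := Plane) (p := 2)
        (μ := (volume : Measure Plane)) (by simp)
      refine hd.induction_on (p := fun f => ⟪f, v.fn⟫_ℂ = 0) v.fn ?_ ?_ |> inner_self_eq_zero.1
      · exact isClosed_eq (continuous_id.inner continuous_const) continuous_const
      · exact hv'
    have hg : v.grad = 0 := by
      have hd := SchwartzMap.denseRange_toLpCLM (F := EuclideanSpace ℂ (Fin 2)) (E := Plane)
        (p := 2)
        (μ := (volume : Measure Plane)) (by simp)
      refine hd.induction_on (p := fun f => ⟪f, v.grad⟫_ℂ = 0) v.grad ?_ ?_ |> inner_self_eq_zero.1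
      · exact isClosed_eq (continuous_id.inner continuous_const) continuous_const
      · intro F
        have hF : F = ∑ j, vecS j (SchwartzMap.postcompCLM (𝕜 := ℂ)
            (EuclideanSpace.proj j : EuclideanSpace ℂ (Fin 2) →L[ℂ] ℂ) F) := by
          ext x j
          fin_cases j <;> simp [Fin.sum_univ_two, vecS_apply]
        rw [hF, map_sum, sum_inner]
        refine Finset.sum_eq_zero fun j _ => ?_
        rw [SchwartzMap.toLpCLM_apply]
        have h1 := (isWeakGradient_iff v.fn v.grad).1 v.2 (conjS (SchwartzMap.postcompCLM (𝕜 := ℂ)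
            (EuclideanSpace.proj j : EuclideanSpace ℂ (Fin 2) →L[ℂ] ℂ) F)) j
        rw [conjS_conjS, h0, inner_zero_right] at h1
        simpa using h1.symm
    have hn := norm_sq_H1 v
    rw [h0, hg] at hn
    simpa using hn
  have h2 : closure (range ofSchwartz) = univ := by
    have := congrArg (fun S : Submodule ℂ H1 => (S : Set H1)) h
    rw [Submodule.topologicalClosure_coe] at this
    exact this
  exact dense_iff_closure_eq.2 h2

/-! ### Sobolev embedding of `H¹(ℝ²)` in `Lᵖ` for even `p` -/

theorem finrank_plane : Module.finrank ℝ Plane = 2 := by simp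

/-- The constant in the inequality `‖g‖₂² ≤ C ‖∇g‖₁²` on the plane. -/
def gnsConst : ℝ≥0 := lintegralPowLePowLIntegralFDerivConst (volume : Measure Plane) 2

/-- The endpoint Gagliardo-Nirenberg-Sobolev inequality on the plane for integrable functions
that need not have compact support; these are cut off at a large radius. -/
theorem lintegral_sq_le_lintegral_fderiv_sq {g : Plane → ℂ} (hg : ContDiff ℝ 1 g)
    (hi : ∫⁻ x, ‖g x‖ₑ ≠ ∞) :
    ∫⁻ x, ‖g x‖ₑ ^ 2 ≤ gnsConst * (∫⁻ x, ‖fderiv ℝ g x‖ₑ) ^ 2 := by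
  let χ : ContDiffBump (0 : Plane) := ⟨1, 2, one_pos, one_lt_two⟩
  have hχ : ContDiff ℝ 1 (χ : Plane → ℝ) := χ.contDiff
  obtain ⟨M, hM⟩ : ∃ M : ℝ, ∀ x, ‖fderiv ℝ (χ : Plane → ℝ) x‖ ≤ M :=
    (hχ.continuous_fderiv one_ne_zero).bounded_above_of_compact_support
      (χ.hasCompactSupport.fderiv ℝ)
  have hM0 : 0 ≤ M := (norm_nonneg _).trans (hM 0)
  let r : ℕ → ℝ := fun n => ((n : ℝ) + 1)⁻¹
  have hr0 : ∀ n, 0 < r n := fun n => by positivity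
  have hr : Tendsto r atTop (𝓝 0) := by
    simpa [r, one_div] using tendsto_one_div_add_atTop_nhds_zero_nat (𝕜 := ℝ)
  let χn : ℕ → Plane → ℝ := fun n x => χ (r n • x)
  have hχn : ∀ n, ContDiff ℝ 1 (χn n) := fun n => hχ.comp (contDiff_const_smul _)
  have hcs : ∀ n, HasCompactSupport (χn n) := fun n =>
    χ.hasCompactSupport.comp_smul (hr0 n).ne'
  have hle1 : ∀ n x, ‖χn n x‖ ≤ 1 := fun n x => by
    rw [Real.norm_of_nonneg χ.nonneg]; exact χ.le_one
  have hder : ∀ n x, ‖fderiv ℝ (χn n) x‖ ≤ r n * M := fun n x => by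
    have h1 : HasFDerivAt (χn n) ((fderiv ℝ (χ : Plane → ℝ) (r n • x)).comp
        (r n • ContinuousLinearMap.id ℝ Plane)) x :=
      (hχ.differentiable one_ne_zero _).hasFDerivAt.comp x ((hasFDerivAt_id x).const_smul (r n))
    rw [h1.fderiv, ContinuousLinearMap.comp_smul, ContinuousLinearMap.comp_id, norm_smul,
      Real.norm_of_nonneg (hr0 n).le]
    exact mul_le_mul_of_nonneg_left (hM _) (hr0 n).le
  have key : ∀ n, ∫⁻ x, ‖χn n x • g x‖ₑ ^ 2 ≤
      gnsConst * ((∫⁻ x, ‖fderiv ℝ g x‖ₑ) + ENNReal.ofReal (r n * M) * ∫⁻ x, ‖g x‖ₑ) ^ 2 := by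
    intro n
    have h1 := lintegral_pow_le_pow_lintegral_fderiv (volume : Measure Plane)
      (u := fun x => χn n x • g x) ((hχn n).smul hg) ((hcs n).smul_right) (p := 2)
      (by rw [finrank_plane]; exact_mod_cast Real.HolderConjugate.two_two)
    simp only [ENNReal.rpow_two] at h1
    refine h1.trans ?_
    rw [gnsConst, ← lintegral_const_mul _ hg.continuous.enorm.measurable,
      ← lintegral_add_left (by fun_prop)]
    gcongr with x
    have hf : fderiv ℝ (fun x => χn n x • g x) x =
        χn n x • fderiv ℝ g x + (fderiv ℝ (χn n) x).smulRight (g x) :=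
      fderiv_fun_smul ((hχn n).differentiable one_ne_zero x) (hg.differentiable one_ne_zero x)
    rw [hf]
    refine (enorm_add_le (E := Plane →L[ℝ] ℂ) _ _).trans (add_le_add ?_ ?_)
    · rw [enorm_smul]
      calc _ ≤ 1 * ‖fderiv ℝ g x‖ₑ := by
            gcongr
            rw [← ofReal_norm]
            simpa using hle1 n x
        _ = _ := one_mul _
    · rw [← ofReal_norm, ← ofReal_norm, ← ENNReal.ofReal_mul (by positivity [hr0 n])]
      apply ENNReal.ofReal_le_ofReal
      rw [ContinuousLinearMap.norm_smulRight_apply]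
      exact mul_le_mul_of_nonneg_right (hder n x) (norm_nonneg _)
  -- at every point the cutoffs are eventually equal to one
  have hlim : ∀ x, liminf (fun n => ‖χn n x • g x‖ₑ ^ 2) atTop = ‖g x‖ₑ ^ 2 := by
    intro x
    refine Tendsto.liminf_eq (tendsto_const_nhds.congr' ?_)
    have h2 : Tendsto (fun n => r n • x) atTop (𝓝 0) := by simpa using hr.smul_const x
    filter_upwards [h2 (Metric.closedBall_mem_nhds 0 one_pos)] with n hn
    have : χn n x = 1 := χ.one_of_mem_closedBall hn
    rw [this, one_smul]
  have hR : Tendsto (fun n => gnsConst * ((∫⁻ x, ‖fderiv ℝ g x‖ₑ) +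
      ENNReal.ofReal (r n * M) * ∫⁻ x, ‖g x‖ₑ) ^ 2) atTop
      (𝓝 (gnsConst * ((∫⁻ x, ‖fderiv ℝ g x‖ₑ) + 0 * ∫⁻ x, ‖g x‖ₑ) ^ 2)) := by
    refine ENNReal.Tendsto.const_mul ?_ (Or.inr ENNReal.coe_ne_top)
    refine ENNReal.Tendsto.pow (tendsto_const_nhds.add ?_)
    refine ENNReal.Tendsto.mul_const ?_ (Or.inr hi)
    have := ENNReal.tendsto_ofReal (hr.mul_const M)
    simpa using this
  rw [zero_mul, add_zero] at hR
  calc ∫⁻ x, ‖g x‖ₑ ^ 2 = ∫⁻ x, liminf (fun n => ‖χn n x • g x‖ₑ ^ 2) atTop := by simp_rw [hlim]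
    _ ≤ liminf (fun n => ∫⁻ x, ‖χn n x • g x‖ₑ ^ 2) atTop := by
        refine lintegral_liminf_le fun n => ?_
        exact ((hχn n).continuous.smul hg.continuous).enorm.measurable.pow_const 2
    _ ≤ liminf (fun n => gnsConst * ((∫⁻ x, ‖fderiv ℝ g x‖ₑ) +
      ENNReal.ofReal (r n * M) * ∫⁻ x, ‖g x‖ₑ) ^ 2) atTop := liminf_le_liminf (.of_forall key)
    _ = _ := hR.liminf_eq

theorem lintegral_mul_sq_le {f g : Plane → ℝ≥0∞} (hf : AEMeasurable f) (hg : AEMeasurable g) :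
    (∫⁻ x, f x * g x) ^ 2 ≤ (∫⁻ x, f x ^ 2) * ∫⁻ x, g x ^ 2 := by
  have h := ENNReal.lintegral_mul_le_Lp_mul_Lq (volume : Measure Plane)
    Real.HolderConjugate.two_two hf hg
  simp only [Pi.mul_apply, ENNReal.rpow_two] at h
  calc (∫⁻ x, f x * g x) ^ 2 ≤ _ := pow_le_pow_left' h 2
    _ = _ := by
      rw [mul_pow, ← ENNReal.rpow_natCast, ← ENNReal.rpow_natCast, ← ENNReal.rpow_mul,
        ← ENNReal.rpow_mul]
      norm_num

theorem norm_fderiv_le_gradS (φ : 𝓢(Plane, ℂ)) (x : Plane) :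
    ‖fderiv ℝ φ x‖ ≤ ‖gradS φ x‖ := by
  refine ContinuousLinearMap.opNorm_le_bound _ (norm_nonneg _) fun v => ?_
  have hv : v = ∑ j, v j • EuclideanSpace.single j (1 : ℝ) := by
    ext i
    fin_cases i <;> simp [Fin.sum_univ_two]
  have hd : fderiv ℝ φ x v = ∑ j, v j • gradS φ x j := by
    conv_lhs => rw [hv]
    simp only [map_sum, map_smul, gradS_apply, coe_dS, partialDeriv]
  rw [hd, EuclideanSpace.norm_eq, EuclideanSpace.norm_eq, ← Real.sqrt_mul (by positivity)]
  refine Real.le_sqrt_of_sq_le ?_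
  have h1 : ‖∑ j, v j • gradS φ x j‖ ≤ ‖gradS φ x 0‖ * ‖v 0‖ + ‖gradS φ x 1‖ * ‖v 1‖ := by
    rw [Fin.sum_univ_two]
    refine (norm_add_le _ _).trans (le_of_eq ?_)
    rw [norm_smul, norm_smul]; ring
  rw [Fin.sum_univ_two] at h1
  simp only [Fin.sum_univ_two]
  calc _ ≤ (‖gradS φ x 0‖ * ‖v 0‖ + ‖gradS φ x 1‖ * ‖v 1‖) ^ 2 := by gcongr
    _ ≤ _ := by nlinarith [sq_nonneg (‖gradS φ x 0‖ * ‖v 1‖ - ‖gradS φ x 1‖ * ‖v 0‖)]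

theorem lintegral_enorm_pow_ne_top (φ : 𝓢(Plane, ℂ)) {k : ℕ} (hk : k ≠ 0) :
    ∫⁻ x, ‖φ x‖ₑ ^ k ≠ ∞ := by
  have h := (φ.memLp k volume).2
  rw [eLpNorm_lt_top_iff_lintegral_rpow_enorm_lt_top (by exact_mod_cast hk) (by simp)] at h
  simpa using h.ne

/-- The Sobolev induction step, from the endpoint inequality for the power `φ ^ (k + 1)`. -/
theorem lintegral_pow_succ_le (φ : 𝓢(Plane, ℂ)) (k : ℕ) :
    ∫⁻ x, ‖φ x‖ₑ ^ (2 * (k + 1)) ≤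
      gnsConst * (k + 1) ^ 2 * ((∫⁻ x, ‖φ x‖ₑ ^ (2 * k)) * ∫⁻ x, ‖gradS φ x‖ₑ ^ 2) := by
  have h1 := lintegral_sq_le_lintegral_fderiv_sq (g := fun x => φ x ^ (k + 1))
    ((φ.smooth 1).pow _) (by
      simpa [enorm_pow] using lintegral_enorm_pow_ne_top φ (Nat.succ_ne_zero k))
  have h2 : ∀ x, ‖fderiv ℝ (fun x => φ x ^ (k + 1)) x‖ₑ ≤
      (k + 1) * (‖φ x‖ₑ ^ k * ‖gradS φ x‖ₑ) := by
    intro x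
    have hd := ((φ.hasFDerivAt x).pow (k + 1)).fderiv
    have he : fderiv ℝ (fun x => φ x ^ (k + 1)) x = ((k + 1 : ℕ) * φ x ^ k) • fderiv ℝ φ x := by
      refine hd.trans ?_
      ext v; simp
    rw [he, enorm_smul, enorm_mul, enorm_pow, mul_assoc]
    gcongr
    · rw [← ofReal_norm, Complex.norm_natCast, ENNReal.ofReal_natCast]
      push_cast
      rfl
    · exact enorm_le_iff_norm_le.2 (norm_fderiv_le_gradS φ x)
  calc ∫⁻ x, ‖φ x‖ₑ ^ (2 * (k + 1)) = ∫⁻ x, ‖φ x ^ (k + 1)‖ₑ ^ 2 := by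
        simp_rw [enorm_pow, ← pow_mul]; congr! 3; ring
    _ ≤ _ := h1
    _ ≤ gnsConst * (∫⁻ x, (k + 1) * (‖φ x‖ₑ ^ k * ‖gradS φ x‖ₑ)) ^ 2 := by
        gcongr with x; exact h2 x
    _ = gnsConst * (k + 1) ^ 2 * (∫⁻ x, (‖φ x‖ₑ ^ k * ‖gradS φ x‖ₑ)) ^ 2 := by
        rw [lintegral_const_mul _ (by
          exact (φ.continuous.enorm.measurable.pow_const k).mul
            (gradS φ).continuous.enorm.measurable),
          mul_pow, mul_assoc]
    _ ≤ _ := by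
        gcongr
        refine (lintegral_mul_sq_le (φ.continuous.enorm.measurable.pow_const k).aemeasurable
          (gradS φ).continuous.enorm.aemeasurable).trans (le_of_eq ?_)
        simp_rw [← pow_mul, mul_comm k 2]

theorem lintegral_enorm_sq_eq {F : Type*} [NormedAddCommGroup F] {μ : Measure Plane}
    (f : Lp F 2 μ) : ∫⁻ x, ‖f x‖ₑ ^ 2 ∂μ = ‖f‖ₑ ^ 2 := by
  rw [Lp.enorm_def, eLpNorm_eq_lintegral_rpow_enorm_toReal (by simp) (by simp)]
  rw [← ENNReal.rpow_natCast, ← ENNReal.rpow_mul]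
  simp

theorem lintegral_schwartz_sq {F : Type*} [NormedAddCommGroup F] [NormedSpace ℝ F]
    (φ : 𝓢(Plane, F)) : ∫⁻ x, ‖φ x‖ₑ ^ 2 = ‖φ.toLp 2 (volume : Measure Plane)‖ₑ ^ 2 := by
  rw [← lintegral_enorm_sq_eq]
  apply lintegral_congr_ae
  filter_upwards [φ.coeFn_toLp 2 volume] with x hx
  rw [hx]

/-- The constant in `‖v‖_{2(k+1)}^{2(k+1)} ≤ C ‖v‖_{H¹}^{2(k+1)}`. -/
def sobConst : ℕ → ℝ≥0
  | 0 => 1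
  | k + 1 => gnsConst * (k + 2) ^ 2 * sobConst k

theorem lintegral_schwartz_pow_le (φ : 𝓢(Plane, ℂ)) (k : ℕ) :
    ∫⁻ x, ‖φ x‖ₑ ^ (2 * (k + 1)) ≤ sobConst k * ‖ofSchwartz φ‖ₑ ^ (2 * (k + 1)) := by
  induction k with
  | zero =>
    simp only [sobConst, zero_add, mul_one, ENNReal.coe_one, one_mul]
    rw [lintegral_schwartz_sq]
    gcongr
    exact enorm_le_iff_norm_le.2 (norm_fn_le (ofSchwartz φ))
  | succ k ih =>
    refine (lintegral_pow_succ_le φ (k + 1)).trans ?_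
    have hg : ∫⁻ x, ‖gradS φ x‖ₑ ^ 2 ≤ ‖ofSchwartz φ‖ₑ ^ 2 := by
      rw [lintegral_schwartz_sq]
      gcongr
      exact enorm_le_iff_norm_le.2 (norm_grad_le (ofSchwartz φ))
    calc _ ≤ gnsConst * ((k + 1 : ℕ) + 1) ^ 2 * ((sobConst k * ‖ofSchwartz φ‖ₑ ^ (2 * (k + 1))) *
          ‖ofSchwartz φ‖ₑ ^ 2) := by gcongr
      _ = _ := by
        simp only [sobConst]
        push_cast
        ring

/-- The Sobolev inequality on `H¹`, extended from Schwartz functions by density and Fatou. -/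
theorem lintegral_fn_pow_le (v : H1) (k : ℕ) :
    ∫⁻ x, ‖v.fn x‖ₑ ^ (2 * (k + 1)) ≤ sobConst k * ‖v‖ₑ ^ (2 * (k + 1)) := by
  obtain ⟨w, hw, hlim⟩ := mem_closure_iff_seq_limit.1 (denseRange_ofSchwartz v)
  choose φ hφ using hw
  obtain rfl : (fun n => ofSchwartz (φ n)) = w := funext hφ
  have h1 : Tendsto (fun n => (φ n).toLp 2 (volume : Measure Plane)) atTop (𝓝 v.fn) :=
    (fnL.continuous.tendsto v).comp hlim
  obtain ⟨ns, hns, hae⟩ := (tendstoInMeasure_of_tendsto_Lp h1).exists_seq_tendsto_ae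
  have hae' : ∀ᵐ x, Tendsto (fun i => φ (ns i) x) atTop (𝓝 (v.fn x)) := by
    have := ae_all_iff.2 fun i => (φ (ns i)).coeFn_toLp 2 (volume : Measure Plane)
    filter_upwards [hae, this] with x hx hx2
    exact hx.congr fun i => hx2 i
  calc ∫⁻ x, ‖v.fn x‖ₑ ^ (2 * (k + 1))
      = ∫⁻ x, liminf (fun i => ‖φ (ns i) x‖ₑ ^ (2 * (k + 1))) atTop := by
        apply lintegral_congr_ae
        filter_upwards [hae'] with x hx
        exact ((ENNReal.Tendsto.pow hx.enorm).liminf_eq).symm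
    _ ≤ liminf (fun i => ∫⁻ x, ‖φ (ns i) x‖ₑ ^ (2 * (k + 1))) atTop :=
        lintegral_liminf_le fun i => (φ (ns i)).continuous.enorm.measurable.pow_const _
    _ ≤ liminf (fun i => sobConst k * ‖ofSchwartz (φ (ns i))‖ₑ ^ (2 * (k + 1))) atTop :=
        liminf_le_liminf (.of_forall fun i => lintegral_schwartz_pow_le _ k)
    _ = _ := by
        refine Tendsto.liminf_eq (ENNReal.Tendsto.const_mul ?_ (Or.inr ENNReal.coe_ne_top))
        exact ENNReal.Tendsto.pow (hlim.comp hns.tendsto_atTop).enorm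

theorem eLpNorm_fn_le (v : H1) (k : ℕ) :
    eLpNorm v.fn ((2 * (k + 1) : ℕ) : ℝ≥0∞) volume ≤
      ((1 + sobConst k : ℝ≥0) : ℝ≥0∞) * ‖v‖ₑ := by
  have h0 : ((2 * (k + 1) : ℕ) : ℝ≥0∞) ≠ 0 := by simp
  rw [eLpNorm_eq_lintegral_rpow_enorm_toReal h0 (ENNReal.natCast_ne_top _),
    ENNReal.toReal_natCast, one_div,
    ENNReal.rpow_inv_le_iff (by positivity)]
  simp only [ENNReal.rpow_natCast]
  refine (lintegral_fn_pow_le v k).trans ?_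
  rw [mul_pow]
  gcongr
  rw [← ENNReal.coe_pow]
  refine ENNReal.coe_le_coe.2 ?_
  calc sobConst k ≤ 1 + sobConst k := by simp
    _ ≤ _ := le_self_pow₀ (by simp) (by simp)

theorem memLp_fn (v : H1) (k : ℕ) : MemLp v.fn ((2 * (k + 1) : ℕ) : ℝ≥0∞) volume :=
  ⟨(Lp.memLp v.fn).1, (eLpNorm_fn_le v k).trans_lt
    (ENNReal.mul_lt_top ENNReal.coe_lt_top enorm_lt_top)⟩

instance factOneLeEven (k : ℕ) : Fact ((1 : ℝ≥0∞) ≤ ((2 * (k + 1) : ℕ) : ℝ≥0∞)) :=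
  ⟨by exact_mod_cast (by omega : 1 ≤ 2 * (k + 1))⟩

/-- The Sobolev embedding `H¹ → L^{2(k+1)}`. -/
def embL (k : ℕ) : H1 →L[ℂ] Lp ℂ ((2 * (k + 1) : ℕ) : ℝ≥0∞) (volume : Measure Plane) :=
  LinearMap.mkContinuous
    { toFun := fun v => (memLp_fn v k).toLp v.fn
      map_add' := fun v w => by
        rw [← MemLp.toLp_add]
        exact MemLp.toLp_congr _ _ (Lp.coeFn_add v.fn w.fn)
      map_smul' := fun c v => by
        rw [RingHom.id_apply, ← MemLp.toLp_const_smul]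
        exact MemLp.toLp_congr _ _ (Lp.coeFn_smul c v.fn) }
    (1 + sobConst k : ℝ≥0) fun v => by
      change ‖(memLp_fn v k).toLp v.fn‖ ≤ _
      rw [Lp.norm_toLp]
      refine ENNReal.toReal_le_of_le_ofReal (by positivity)
        ((eLpNorm_fn_le v k).trans (le_of_eq ?_))
      rw [ENNReal.ofReal_mul (by positivity), ofReal_norm, ENNReal.ofReal_coe_nnreal]

theorem coeFn_embL (k : ℕ) (v : H1) : embL k v =ᵐ[volume] v.fn :=
  MemLp.coeFn_toLp (memLp_fn v k)

theorem integrable_norm_pow (v : H1) (k : ℕ) : Integrable fun x => ‖v.fn x‖ ^ (2 * (k + 1)) := by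
  exact (memLp_fn v k).integrable_norm_pow (by omega)

theorem integral_norm_pow_eq (v : H1) (k : ℕ) :
    ∫ x, ‖v.fn x‖ ^ (2 * (k + 1)) = ‖embL k v‖ ^ (2 * (k + 1)) := by
  have h0 : ((2 * (k + 1) : ℕ) : ℝ≥0∞) ≠ 0 := by simp
  have h1 : ‖embL k v‖ = (eLpNorm v.fn ((2 * (k + 1) : ℕ) : ℝ≥0∞) volume).toReal :=
    Lp.norm_toLp v.fn (memLp_fn v k)
  rw [h1, eLpNorm_eq_lintegral_rpow_enorm_toReal h0 (ENNReal.natCast_ne_top _),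
    ENNReal.toReal_natCast, one_div,
    ← ENNReal.toReal_pow, ← ENNReal.rpow_natCast, ← ENNReal.rpow_mul,
    inv_mul_cancel₀ (by positivity),
    ENNReal.rpow_one, integral_eq_lintegral_of_nonneg_ae (.of_forall fun x => by positivity)
      (integrable_norm_pow v k).1]
  congr 1
  apply lintegral_congr
  intro x
  rw [ENNReal.ofReal_pow (norm_nonneg _), ofReal_norm, ENNReal.rpow_natCast]

theorem continuous_integral_norm_pow (k : ℕ) :
    Continuous fun v : H1 => ∫ x, ‖v.fn x‖ ^ (2 * (k + 1)) := by
  simp_rw [integral_norm_pow_eq]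
  fun_prop

theorem continuous_virial : Continuous virial := by
  unfold virial
  have h1 := continuous_integral_norm_pow 1
  have h2 := continuous_integral_norm_pow 2
  exact ((gradL.continuous.norm.pow 2).sub (h1.const_mul _)).sub (h2.const_mul _)

theorem continuous_energy : Continuous energy := by
  unfold energy
  have h1 := continuous_integral_norm_pow 1
  have h2 := continuous_integral_norm_pow 2
  exact (((gradL.continuous.norm.pow 2).const_mul _).sub (h1.const_mul _)).sub (h2.const_mul _)

/-! ### The cubic-quintic nonlinearity -/

/-- The nonlinearity `|z|²z + |z|⁴z`. -/
def nl (z : ℂ) : ℂ := ((‖z‖ ^ 2 + ‖z‖ ^ 4 : ℝ) : ℂ) * z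

/-- The potential `¼|z|⁴ + ⅙|z|⁶`, whose gradient is `nl`. -/
def pot (z : ℂ) : ℝ := 1 / 4 * ‖z‖ ^ 4 + 1 / 6 * ‖z‖ ^ 6

theorem norm_nl_sub_le {a b : ℂ} {M : ℝ} (ha : ‖a‖ ≤ M) (hb : ‖b‖ ≤ M) :
    ‖nl a - nl b‖ ≤ (3 * M ^ 2 + 5 * M ^ 4) * ‖a - b‖ := by
  have hM : 0 ≤ M := (norm_nonneg _).trans ha
  have hd : |‖a‖ - ‖b‖| ≤ ‖a - b‖ := abs_norm_sub_norm_le a b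
  have he : nl a - nl b = ((‖a‖ ^ 2 + ‖a‖ ^ 4 : ℝ) : ℂ) * (a - b) +
      (((‖a‖ - ‖b‖) * ((‖a‖ + ‖b‖) + (‖a‖ + ‖b‖) * (‖a‖ ^ 2 + ‖b‖ ^ 2)) : ℝ) : ℂ) * b := by
    unfold nl; push_cast; ring
  have na := norm_nonneg a
  have nb := norm_nonneg b
  have a2 : ‖a‖ ^ 2 ≤ M ^ 2 := by gcongr
  have b2 : ‖b‖ ^ 2 ≤ M ^ 2 := by gcongr
  have a4 : ‖a‖ ^ 4 ≤ M ^ 4 := by gcongr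
  rw [he]
  refine (norm_add_le _ _).trans ?_
  rw [norm_mul, norm_mul, Complex.norm_real, Complex.norm_real, Real.norm_eq_abs, Real.norm_eq_abs,
    abs_mul, abs_of_nonneg (by positivity), abs_of_nonneg (a := (‖a‖ + ‖b‖) + _) (by positivity)]
  calc _ ≤ (M ^ 2 + M ^ 4) * ‖a - b‖ +
        ‖a - b‖ * ((M + M) + (M + M) * (M ^ 2 + M ^ 2)) * M := by gcongr
    _ = _ := by ring

theorem hasDerivAt_pot_segment (p q : ℂ) (s : ℝ) :
    HasDerivAt (fun s : ℝ => pot (p + s * (q - p)))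
      (((starRingEnd ℂ) (q - p) * nl (p + s * (q - p))).re) s := by
  have h1 : HasDerivAt (fun s : ℝ => p + s * (q - p)) (q - p) s := by
    simpa using ((Complex.ofRealCLM.hasDerivAt (x := s)).mul_const (q - p)).const_add p
  have h2 : HasDerivAt (fun s : ℝ => ‖p + s * (q - p)‖ ^ 2)
      (2 * ((starRingEnd ℂ) (q - p) * (p + s * (q - p))).re) s := by
    have := h1.norm_sq
    convert this using 1
    rw [Complex.inner]
    simp; ring
  have h3 := ((h2.pow 2).const_mul (1 / 4 : ℝ)).add ((h2.pow 3).const_mul (1 / 6 : ℝ))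
  have hf : (fun s : ℝ => pot (p + s * (q - p))) =
      fun s : ℝ => 1 / 4 * (‖p + s * (q - p)‖ ^ 2) ^ 2 + 1 / 6 * (‖p + s * (q - p)‖ ^ 2) ^ 3 := by
    funext s
    simp only [pot]
    ring
  rw [hf]
  refine h3.congr_deriv ?_
  rw [nl, mul_left_comm ((starRingEnd ℂ) (q - p)), Complex.re_ofReal_mul]
  push_cast
  ring

/-- Second-order accuracy of the linearisation of the potential, with the nonlinearity evaluated
at a third nearby point. -/
theorem abs_pot_sub_le {p q f : ℂ} {M : ℝ} (hp : ‖p‖ ≤ M) (hq : ‖q‖ ≤ M) (hf : ‖f‖ ≤ M) :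
    |pot q - pot p - ((starRingEnd ℂ) (q - p) * nl f).re| ≤
      (3 * M ^ 2 + 5 * M ^ 4) * (‖q - p‖ * (‖p - f‖ + ‖q - f‖)) := by
  obtain ⟨s, hs, he⟩ := exists_hasDerivAt_eq_slope (fun s : ℝ => pot (p + s * (q - p)))
    (fun s : ℝ => ((starRingEnd ℂ) (q - p) * nl (p + s * (q - p))).re) zero_lt_one
    (fun s _ => (hasDerivAt_pot_segment p q s).continuousAt.continuousWithinAt)
    (fun s _ => hasDerivAt_pot_segment p q s)
  simp only [Complex.ofReal_one, one_mul, add_sub_cancel, Complex.ofReal_zero, zero_mul, add_zero,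
    sub_zero, div_one] at he
  have hconv : p + s * (q - p) = (1 - s : ℝ) * p + (s : ℝ) * q := by push_cast; ring
  have n1 : ‖((1 - s : ℝ) : ℂ)‖ = 1 - s := by
    rw [Complex.norm_real, Real.norm_of_nonneg (by linarith [hs.2])]
  have n2 : ‖((s : ℝ) : ℂ)‖ = s := by
    rw [Complex.norm_real, Real.norm_of_nonneg hs.1.le]
  have h1s : 0 ≤ 1 - s := by linarith [hs.2]
  have hM : ‖p + s * (q - p)‖ ≤ M := by
    rw [hconv]
    refine (norm_add_le _ _).trans ?_
    rw [norm_mul, norm_mul, n1, n2]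
    nlinarith [hs.1]
  have hdiff : ‖p + s * (q - p) - f‖ ≤ ‖p - f‖ + ‖q - f‖ := by
    have : p + s * (q - p) - f = (1 - s : ℝ) * (p - f) + (s : ℝ) * (q - f) := by push_cast; ring
    rw [this]
    refine (norm_add_le _ _).trans ?_
    rw [norm_mul, norm_mul, n1, n2]
    nlinarith [hs.1, hs.2, norm_nonneg (p - f), norm_nonneg (q - f)]
  rw [← he, ← Complex.sub_re, ← mul_sub]
  refine (Complex.abs_re_le_norm _).trans ?_
  rw [norm_mul, Complex.norm_conj]
  calc _ ≤ ‖q - p‖ * ((3 * M ^ 2 + 5 * M ^ 4) * (‖p - f‖ + ‖q - f‖)) := by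
        gcongr
        refine (norm_nl_sub_le hM hf).trans ?_
        gcongr
    _ = _ := by ring

instance : ENNReal.HolderTriple ((2 * (2 + 1) : ℕ) : ℝ≥0∞) ((2 * (2 + 1) : ℕ) : ℝ≥0∞) 3 := ⟨by
  rw [← ENNReal.toReal_eq_toReal_iff' (by simp) (by simp)]
  rw [ENNReal.toReal_add (by simp) (by simp)]
  simp; norm_num⟩

instance : ENNReal.HolderTriple 3 ((2 * (2 + 1) : ℕ) : ℝ≥0∞) 2 := ⟨by
  rw [← ENNReal.toReal_eq_toReal_iff' (by simp) (by simp)]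
  rw [ENNReal.toReal_add (by simp) (by simp)]
  simp; norm_num⟩

instance : ENNReal.HolderTriple ((2 * (4 + 1) : ℕ) : ℝ≥0∞) ((2 * (4 + 1) : ℕ) : ℝ≥0∞) 5 := ⟨by
  rw [← ENNReal.toReal_eq_toReal_iff' (by simp) (by simp)]
  rw [ENNReal.toReal_add (by simp) (by simp)]
  simp; norm_num⟩

instance : ENNReal.HolderTriple 5 5 (5 / 2) := ⟨by
  rw [← ENNReal.toReal_eq_toReal_iff' (by simp) (by simp)]
  rw [ENNReal.toReal_add (by simp) (by simp)]
  simp; norm_num⟩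

instance : ENNReal.HolderTriple (5 / 2) ((2 * (4 + 1) : ℕ) : ℝ≥0∞) 2 := ⟨by
  rw [← ENNReal.toReal_eq_toReal_iff' (by simp) (by simp)]
  rw [ENNReal.toReal_add (by simp) (by simp)]
  simp; norm_num⟩

instance : Fact ((1 : ℝ≥0∞) ≤ 3) := ⟨by norm_num⟩
instance : Fact ((1 : ℝ≥0∞) ≤ 5) := ⟨by norm_num⟩
instance : Fact ((1 : ℝ≥0∞) ≤ 5 / 2) := ⟨by
  rw [ENNReal.le_div_iff_mul_le (by simp) (by simp)]; norm_num⟩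

/-- Complex conjugation on `Lᵖ`. -/
def conjLp (p : ℝ≥0∞) [Fact (1 ≤ p)] :
    Lp ℂ p (volume : Measure Plane) →L[ℝ] Lp ℂ p (volume : Measure Plane) :=
  (Complex.conjCLE : ℂ →L[ℝ] ℂ).compLpL p volume

theorem coeFn_conjLp (p : ℝ≥0∞) [Fact (1 ≤ p)] (f : Lp ℂ p (volume : Measure Plane)) :
    conjLp p f =ᵐ[volume] fun x => (starRingEnd ℂ) (f x) := by
  filter_upwards [ContinuousLinearMap.coeFn_compLpL (p := p) (μ := volume)
    (Complex.conjCLE : ℂ →L[ℝ] ℂ) f] with x hx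
  exact hx

/-- Pointwise multiplication of `Lᵖ` functions. -/
abbrev mulLp (p q r : ℝ≥0∞) [Fact (1 ≤ p)] [Fact (1 ≤ q)] [Fact (1 ≤ r)]
    [ENNReal.HolderTriple p q r] :=
  (ContinuousLinearMap.mul ℂ ℂ).holderL (volume : Measure Plane) p q r

theorem coeFn_mulLp {p q r : ℝ≥0∞} [Fact (1 ≤ p)] [Fact (1 ≤ q)] [Fact (1 ≤ r)]
    [ENNReal.HolderTriple p q r] (f : Lp ℂ p (volume : Measure Plane)) (g : Lp ℂ q volume) :
    mulLp p q r f g =ᵐ[volume] fun x => f x * g x :=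
  (ContinuousLinearMap.mul ℂ ℂ).coeFn_holder f g

/-- The squared modulus of an `Lᵖ` function. -/
def sqLp (p r : ℝ≥0∞) [Fact (1 ≤ p)] [Fact (1 ≤ r)] [ENNReal.HolderTriple p p r]
    (f : Lp ℂ p (volume : Measure Plane)) : Lp ℂ r (volume : Measure Plane) :=
  mulLp p p r f (conjLp p f)

theorem continuous_sqLp (p r : ℝ≥0∞) [Fact (1 ≤ p)] [Fact (1 ≤ r)] [ENNReal.HolderTriple p p r] :
    Continuous (sqLp p r) := by
  unfold sqLp
  fun_prop

theorem coeFn_sqLp (p r : ℝ≥0∞) [Fact (1 ≤ p)] [Fact (1 ≤ r)] [ENNReal.HolderTriple p p r]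
    (f : Lp ℂ p (volume : Measure Plane)) :
    sqLp p r f =ᵐ[volume] fun x => ((‖f x‖ ^ 2 : ℝ) : ℂ) := by
  filter_upwards [coeFn_mulLp (r := r) f (conjLp p f), coeFn_conjLp p f] with x h1 h2
  rw [sqLp, h1, h2, Complex.mul_conj, Complex.normSq_eq_norm_sq]

/-- The cubic part `|v|²v`, which is in `L²` since `H¹ ⊂ L⁶`. -/
def cubicH (v : H1) : L2 := mulLp 3 _ 2 (sqLp _ 3 (embL 2 v)) (embL 2 v)

/-- The quintic part `|v|⁴v`, which is in `L²` since `H¹ ⊂ L¹⁰`. -/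
def quinticH (v : H1) : L2 :=
  mulLp (5 / 2) _ 2 (sqLp 5 (5 / 2) (sqLp _ 5 (embL 4 v))) (embL 4 v)

theorem coeFn_cubicH (v : H1) :
    cubicH v =ᵐ[volume] fun x => ((‖v.fn x‖ ^ 2 : ℝ) : ℂ) * v.fn x := by
  have h2 := coeFn_sqLp _ 3 (embL 2 v)
  have h3 := coeFn_mulLp (r := 2) (sqLp _ 3 (embL 2 v)) (embL 2 v)
  filter_upwards [coeFn_embL 2 v, h2, h3] with x h1 h2 h3
  rw [cubicH, h3, h2, h1]

theorem coeFn_quinticH (v : H1) :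
    quinticH v =ᵐ[volume] fun x => ((‖v.fn x‖ ^ 4 : ℝ) : ℂ) * v.fn x := by
  have h2 := coeFn_sqLp _ 5 (embL 4 v)
  have h3 := coeFn_sqLp 5 (5 / 2) (sqLp _ 5 (embL 4 v))
  have h4 := coeFn_mulLp (r := 2) (sqLp 5 (5 / 2) (sqLp _ 5 (embL 4 v))) (embL 4 v)
  filter_upwards [coeFn_embL 4 v, h2, h3, h4] with x h1 h2 h3 h4
  rw [quinticH, h4, h3, h2, h1, Complex.norm_real, Real.norm_of_nonneg (by positivity), ← pow_mul]

/-- The nonlinearity as a map `H¹ → L²`. -/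
def nlH (v : H1) : L2 := cubicH v + quinticH v

theorem continuous_nlH : Continuous nlH := by
  have h3 := continuous_sqLp ((2 * (2 + 1) : ℕ) : ℝ≥0∞) 3
  have h5 := continuous_sqLp ((2 * (4 + 1) : ℕ) : ℝ≥0∞) 5
  have h5' := continuous_sqLp 5 (5 / 2)
  unfold nlH cubicH quinticH
  fun_prop

theorem coeFn_nlH (v : H1) : nlH v =ᵐ[volume] fun x => nl (v.fn x) := by
  filter_upwards [coeFn_cubicH v, coeFn_quinticH v, Lp.coeFn_add (cubicH v) (quinticH v)]
    with x h1 h2 h3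
  rw [nlH, h3, Pi.add_apply, h1, h2, nl]
  push_cast
  ring

/-- The nonlinearity applied to a Schwartz function. -/
def nlS (φ : 𝓢(Plane, ℂ)) : 𝓢(Plane, ℂ) :=
  let m := SchwartzMap.pairing (D := Plane) (ContinuousLinearMap.mul ℂ ℂ)
  m (m φ (conjS φ)) φ + m (m (m φ (conjS φ)) (m φ (conjS φ))) φ

theorem nlS_eq (φ : 𝓢(Plane, ℂ)) (x : Plane) :
    nlS φ x = φ x * conjS φ x * φ x + φ x * conjS φ x * (φ x * conjS φ x) * φ x := by
  simp [nlS]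

theorem nlS_apply (φ : 𝓢(Plane, ℂ)) (x : Plane) : nlS φ x = nl (φ x) := by
  rw [nlS_eq, conjS_apply, Complex.mul_conj, nl, Complex.normSq_eq_norm_sq]
  push_cast
  ring

theorem nlH_ofSchwartz (φ : 𝓢(Plane, ℂ)) : nlH (ofSchwartz φ) = (nlS φ).toLp 2 := by
  apply Lp.ext
  filter_upwards [coeFn_nlH (ofSchwartz φ), (nlS φ).coeFn_toLp 2 volume,
    φ.coeFn_toLp 2 volume] with x h1 h2 h3
  rw [h1, h2, fn_ofSchwartz, h3, nlS_apply]

theorem norm_nl (z : ℂ) : ‖nl z‖ = ‖z‖ ^ 3 + ‖z‖ ^ 5 := by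
  rw [nl, norm_mul, Complex.norm_real, Real.norm_of_nonneg (by positivity)]
  ring

/-- Pointwise chain rule bound: the nonlinearity has derivative of size `3|z|² + 5|z|⁴`. -/
theorem norm_dS_nlS_le (φ : 𝓢(Plane, ℂ)) (j : Fin 2) (x : Plane) :
    ‖dS j (nlS φ) x‖ ≤ (3 * ‖φ x‖ ^ 2 + 5 * ‖φ x‖ ^ 4) * ‖gradS φ x‖ := by
  have h := φ.hasFDerivAt x
  have hc := (conjS φ).hasFDerivAt x
  have hp := (((h.mul hc).mul h).add (((h.mul hc).mul (h.mul hc)).mul h)).fderiv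
  have he : dS j (nlS φ) x =
      2 * (φ x * conjS φ x) * dS j φ x + φ x * φ x * conjS (dS j φ) x +
      3 * (φ x * conjS φ x) ^ 2 * dS j φ x +
      2 * (φ x * conjS φ x) * (φ x * φ x) * conjS (dS j φ) x := by
    rw [← dS_conjS, coe_dS, coe_dS, coe_dS]
    simp only [partialDeriv]
    have hf : (⇑(nlS φ) : Plane → ℂ) = (⇑φ * ⇑(conjS φ)) * ⇑φ +
        ((⇑φ * ⇑(conjS φ)) * (⇑φ * ⇑(conjS φ))) * ⇑φ := funext fun y => nlS_eq φ y
    rw [hf, hp]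
    simp
    ring
  have hj : ‖dS j φ x‖ ≤ ‖gradS φ x‖ := by
    rw [← gradS_apply]
    exact PiLp.norm_apply_le _ _
  rw [he]
  refine (norm_add_le _ _).trans ((add_le_add_left (norm_add_le _ _) _).trans
    ((add_le_add_left (add_le_add_left (norm_add_le _ _) _) _).trans ?_))
  simp only [norm_mul, norm_pow, conjS_apply, Complex.norm_conj, Complex.norm_ofNat]
  calc _ = (3 * ‖φ x‖ ^ 2 + 5 * ‖φ x‖ ^ 4) * ‖dS j φ x‖ := by ring
    _ ≤ _ := by gcongr

/-- A quantity continuous on `H¹` which dominates the `W^{1,1}` norm of the nonlinearity. -/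
def nlBound (v : H1) : ℝ :=
  (∫ x, ‖v.fn x‖ ^ (2 * (0 + 1))) + 6 * (∫ x, ‖v.fn x‖ ^ (2 * (1 + 1))) +
    (∫ x, ‖v.fn x‖ ^ (2 * (2 + 1))) + 5 * (∫ x, ‖v.fn x‖ ^ (2 * (3 + 1))) + 5 * ‖v.grad‖ ^ 2

theorem continuous_nlBound : Continuous nlBound := by
  unfold nlBound
  have h0 := continuous_integral_norm_pow 0
  have h1 := continuous_integral_norm_pow 1
  have h2 := continuous_integral_norm_pow 2
  have h3 := continuous_integral_norm_pow 3
  exact (((h0.add (h1.const_mul _)).add h2).add (h3.const_mul _)).add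
    ((gradL.continuous.norm.pow 2).const_mul _)

theorem integral_norm_sq_eq {F : Type*} [NormedAddCommGroup F]
    (f : Lp F 2 (volume : Measure Plane)) : ∫ x, ‖f x‖ ^ 2 = ‖f‖ ^ 2 := by
  rw [integral_eq_lintegral_of_nonneg_ae (.of_forall fun x => by positivity)
    (by exact (Lp.memLp f).1.norm.pow 2)]
  have := lintegral_enorm_sq_eq f
  simp_rw [← ofReal_norm, ← ENNReal.ofReal_pow (norm_nonneg _)] at this
  rw [this, ENNReal.toReal_ofReal (by positivity)]

theorem integral_norm_pow_ofSchwartz (φ : 𝓢(Plane, ℂ)) (k : ℕ) :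
    ∫ x, ‖(ofSchwartz φ).fn x‖ ^ k = ∫ x, ‖φ x‖ ^ k := by
  apply integral_congr_ae
  filter_upwards [φ.coeFn_toLp 2 volume] with x hx
  rw [fn_ofSchwartz, hx]

theorem integrable_schwartz_norm_pow (φ : 𝓢(Plane, ℂ)) (k : ℕ) :
    Integrable fun x => ‖φ x‖ ^ (2 * (k + 1)) := by
  refine (integrable_norm_pow (ofSchwartz φ) k).congr ?_
  filter_upwards [φ.coeFn_toLp 2 volume] with x hx
  rw [fn_ofSchwartz, hx]

theorem integrable_gradS_sq (φ : 𝓢(Plane, ℂ)) : Integrable fun x => ‖gradS φ x‖ ^ 2 :=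
  ((gradS φ).memLp 2 volume).integrable_norm_pow (by norm_num)

theorem integral_gradS_sq (φ : 𝓢(Plane, ℂ)) :
    ∫ x, ‖gradS φ x‖ ^ 2 = ‖(ofSchwartz φ).grad‖ ^ 2 := by
  rw [← integral_norm_sq_eq]
  apply integral_congr_ae
  filter_upwards [(gradS φ).coeFn_toLp 2 volume] with x hx
  rw [grad_ofSchwartz, hx]

theorem integral_norm_nlS_le (φ : 𝓢(Plane, ℂ)) :
    ∫ x, ‖nlS φ x‖ ≤ nlBound (ofSchwartz φ) := by
  have i := integrable_schwartz_norm_pow φ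
  have h : ∫ x, ‖nlS φ x‖ ≤ ∫ x, ((‖φ x‖ ^ (2 * (0 + 1)) + 6 * ‖φ x‖ ^ (2 * (1 + 1)))
      + ‖φ x‖ ^ (2 * (2 + 1))) := by
    refine integral_mono (nlS φ).integrable.norm (((i 0).add ((i 1).const_mul 6)).add (i 2))
      fun x => ?_
    simp only [nlS_apply, norm_nl]
    have := norm_nonneg (φ x)
    norm_num
    nlinarith [sq_nonneg (‖φ x‖ - ‖φ x‖ ^ 2), sq_nonneg (‖φ x‖ ^ 2 - ‖φ x‖ ^ 3),
      pow_nonneg this 4]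
  have i01 : Integrable fun x => ‖φ x‖ ^ (2 * (0 + 1)) + 6 * ‖φ x‖ ^ (2 * (1 + 1)) :=
    (i 0).add ((i 1).const_mul 6)
  rw [integral_add i01 (i 2), integral_add (i 0) ((i 1).const_mul 6),
    integral_const_mul] at h
  simp only [nlBound, integral_norm_pow_ofSchwartz]
  have h3 : 0 ≤ ∫ x, ‖φ x‖ ^ (2 * (3 + 1)) := integral_nonneg fun x => by positivity
  nlinarith [sq_nonneg ‖(ofSchwartz φ).grad‖]

theorem integral_norm_dS_nlS_le (φ : 𝓢(Plane, ℂ)) (j : Fin 2) :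
    ∫ x, ‖dS j (nlS φ) x‖ ≤ nlBound (ofSchwartz φ) := by
  have i := integrable_schwartz_norm_pow φ
  have ig := integrable_gradS_sq φ
  have h : ∫ x, ‖dS j (nlS φ) x‖ ≤ ∫ x, ((6 * ‖φ x‖ ^ (2 * (1 + 1)) + 5 * ‖φ x‖ ^ (2 * (3 + 1)))
      + 5 * ‖gradS φ x‖ ^ 2) := by
    refine integral_mono (dS j (nlS φ)).integrable.norm
      ((((i 1).const_mul 6).add ((i 3).const_mul 5)).add (ig.const_mul 5)) fun x => ?_
    refine (norm_dS_nlS_le φ j x).trans ?_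
    have := norm_nonneg (φ x)
    norm_num
    nlinarith [sq_nonneg (‖φ x‖ ^ 2 - ‖gradS φ x‖), sq_nonneg (‖φ x‖ ^ 4 - ‖gradS φ x‖),
      sq_nonneg (‖gradS φ x‖), pow_nonneg this 4, pow_nonneg this 8]
  have i13 : Integrable fun x => 6 * ‖φ x‖ ^ (2 * (1 + 1)) + 5 * ‖φ x‖ ^ (2 * (3 + 1)) :=
    ((i 1).const_mul 6).add ((i 3).const_mul 5)
  rw [integral_add i13 (ig.const_mul 5),
    integral_add ((i 1).const_mul 6) ((i 3).const_mul 5),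
    integral_const_mul, integral_const_mul, integral_const_mul, integral_gradS_sq] at h
  simp only [nlBound, integral_norm_pow_ofSchwartz]
  have h0 : 0 ≤ ∫ x, ‖φ x‖ ^ (2 * (0 + 1)) := integral_nonneg fun x => by positivity
  have h2 : 0 ≤ ∫ x, ‖φ x‖ ^ (2 * (2 + 1)) := integral_nonneg fun x => by positivity
  linarith

/-! ### The free Schrödinger propagator on Schwartz functions -/

@[fun_prop]
theorem hasTemperateGrowth_cexp_mul_I (c : ℝ) :
    (fun y : ℝ => Complex.exp ((c * y : ℝ) * Complex.I)).HasTemperateGrowth := by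
  have hd : ∀ y : ℝ, HasDerivAt (fun y : ℝ => Complex.exp ((c * y : ℝ) * Complex.I))
      ((c * Complex.I) * Complex.exp ((c * y : ℝ) * Complex.I)) y := by
    intro y
    have h1 : HasDerivAt (fun y : ℝ => ((c * y : ℝ) : ℂ) * Complex.I) (c * Complex.I) y := by
      have := (((hasDerivAt_id y).const_mul c).ofReal_comp).mul_const Complex.I
      simpa using this
    simpa [mul_comm] using h1.cexp
  have hi : ∀ n : ℕ, iteratedDeriv n (fun y : ℝ => Complex.exp ((c * y : ℝ) * Complex.I)) =
      fun y => (c * Complex.I) ^ n * Complex.exp ((c * y : ℝ) * Complex.I) := by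
    intro n
    induction n with
    | zero => simp
    | succ n ih =>
      rw [iteratedDeriv_succ, ih]
      funext y
      rw [((hd y).const_mul _).deriv]
      ring
  refine ⟨((Complex.ofRealCLM.contDiff.comp (by fun_prop : ContDiff ℝ _ fun y : ℝ => c * y)).mul
    contDiff_const).cexp, fun n => ⟨0, |c| ^ n, fun y => ?_⟩⟩
  rw [norm_iteratedFDeriv_eq_norm_iteratedDeriv, hi, norm_mul, Complex.norm_exp_ofReal_mul_I]
  simp

/-- The symbol `exp(-it·4π²|ξ|²)` of `exp(itΔ)`. -/
def schSym (t : ℝ) (ξ : Plane) : ℂ := Complex.exp ((-t * lapSym ξ : ℝ) * Complex.I)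

@[fun_prop]
theorem hasTemperateGrowth_schSym (t : ℝ) : (schSym t).HasTemperateGrowth :=
  (hasTemperateGrowth_cexp_mul_I (-t)).comp hasTemperateGrowth_lapSym

theorem norm_schSym (t : ℝ) (ξ : Plane) : ‖schSym t ξ‖ = 1 := Complex.norm_exp_ofReal_mul_I _

/-- The free Schrödinger propagator `exp(itΔ)` on Schwartz functions. -/
def propS (t : ℝ) (φ : 𝓢(Plane, ℂ)) : 𝓢(Plane, ℂ) := mulF (schSym t) φ

theorem fourier_propS (t : ℝ) (φ : 𝓢(Plane, ℂ)) (ξ : Plane) :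
    𝓕 (propS t φ) ξ = schSym t ξ * 𝓕 φ ξ := fourier_mulF (by fun_prop) φ ξ

@[simp] theorem propS_zero (φ : 𝓢(Plane, ℂ)) : propS 0 φ = φ :=
  fourier_injective fun ξ => by simp [fourier_propS, schSym]

theorem propS_propS (s t : ℝ) (φ : 𝓢(Plane, ℂ)) : propS s (propS t φ) = propS (s + t) φ :=
  fourier_injective fun ξ => by
    rw [fourier_propS, fourier_propS, fourier_propS, ← mul_assoc, schSym, schSym, schSym,
      ← Complex.exp_add]
    congr 2
    push_cast
    ring

theorem fourier_dS (j : Fin 2) (φ : 𝓢(Plane, ℂ)) (ξ : Plane) :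
    𝓕 (dS j φ) ξ = (2 * π * Complex.I * ξ j) * 𝓕 φ ξ := by
  rw [dS, SchwartzMap.fourier_lineDerivOp_eq, smul_apply,
    SchwartzMap.smulLeftCLM_apply_apply (by fun_prop)]
  simp [EuclideanSpace.inner_single_right]
  ring

theorem dS_propS (j : Fin 2) (t : ℝ) (φ : 𝓢(Plane, ℂ)) : dS j (propS t φ) = propS t (dS j φ) :=
  fourier_injective fun ξ => by
    rw [fourier_dS, fourier_propS, fourier_propS, fourier_dS]; ring

theorem dS_resolventS (j : Fin 2) (φ : 𝓢(Plane, ℂ)) :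
    dS j (resolventS φ) = resolventS (dS j φ) :=
  fourier_injective fun ξ => by
    rw [fourier_dS, fourier_resolventS, fourier_resolventS, fourier_dS]; ring

theorem propS_resolventS (t : ℝ) (φ : 𝓢(Plane, ℂ)) :
    propS t (resolventS φ) = resolventS (propS t φ) :=
  fourier_injective fun ξ => by
    rw [fourier_propS, fourier_resolventS, fourier_resolventS, fourier_propS]; ring

theorem norm_toLp_le_of_fourier {φ ψ : 𝓢(Plane, ℂ)} {C : ℝ}
    (h : ∀ ξ, ‖𝓕 φ ξ‖ ≤ C * ‖𝓕 ψ ξ‖) :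
    ‖φ.toLp 2 (volume : Measure Plane)‖ ≤ C * ‖ψ.toLp 2 (volume : Measure Plane)‖ := by
  rw [← SchwartzMap.norm_fourier_toL2_eq φ, ← SchwartzMap.norm_fourier_toL2_eq ψ]
  apply Lp.norm_le_mul_norm_of_ae_le_mul
  filter_upwards [(𝓕 φ).coeFn_toLp 2 volume, (𝓕 ψ).coeFn_toLp 2 volume] with ξ h1 h2
  rw [h1, h2]
  exact h ξ

theorem fourier_sub (φ ψ : 𝓢(Plane, ℂ)) (ξ : Plane) : 𝓕 (φ - ψ) ξ = 𝓕 φ ξ - 𝓕 ψ ξ := by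
  have : 𝓕 (φ - ψ) = 𝓕 φ - 𝓕 ψ := map_sub (FourierTransform.fourierCLM ℂ 𝓢(Plane, ℂ)) _ _
  rw [this, sub_apply]

theorem fourier_smul_apply (c : ℂ) (φ : 𝓢(Plane, ℂ)) (ξ : Plane) :
    𝓕 (c • φ) ξ = c * 𝓕 φ ξ := by
  rw [FourierTransform.fourier_smul, smul_apply, smul_eq_mul]

theorem norm_cexp_sub_one_sub_le (y : ℝ) :
    ‖Complex.exp (y * Complex.I) - 1 - y * Complex.I‖ ≤ 3 * y ^ 2 := by
  have hn : ‖(y : ℂ) * Complex.I‖ = |y| := by simp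
  rcases le_total |y| 1 with h | h
  · have := Complex.norm_exp_sub_one_sub_id_le (x := y * Complex.I) (by rwa [hn])
    rw [hn, sq_abs] at this
    nlinarith [sq_nonneg y]
  · have h1 : ‖Complex.exp (y * Complex.I) - 1 - y * Complex.I‖ ≤ 1 + 1 + |y| := by
      refine (norm_sub_le _ _).trans (add_le_add ((norm_sub_le _ _).trans ?_) hn.le)
      rw [Complex.norm_exp_ofReal_mul_I, norm_one]
    have h2 : y ^ 2 = |y| ^ 2 := (sq_abs y).symm
    nlinarith

/-- The free evolution of a Schwartz function is differentiable in time as an `L²`-valued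
function, and solves the free Schrödinger equation. -/
theorem hasDerivAt_propS (φ : 𝓢(Plane, ℂ)) (t : ℝ) :
    HasDerivAt (fun t => (propS t φ).toLp 2 (volume : Measure Plane))
      ((Complex.I • Δ (propS t φ) : 𝓢(Plane, ℂ)).toLp 2 (volume : Measure Plane)) t := by
  rw [hasDerivAt_iff_isLittleO_nhds_zero]
  have hO : (fun h : ℝ => (propS (t + h) φ).toLp 2 (volume : Measure Plane) -
      (propS t φ).toLp 2 (volume : Measure Plane) -
      h • (Complex.I • Δ (propS t φ) : 𝓢(Plane, ℂ)).toLp 2 (volume : Measure Plane))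
      =O[𝓝 0] fun h : ℝ => h ^ 2 := by
    refine Asymptotics.IsBigO.of_bound
      (3 * ‖(Δ (Δ φ) : 𝓢(Plane, ℂ)).toLp 2 (volume : Measure Plane)‖) (.of_forall fun h => ?_)
    have e : (propS (t + h) φ).toLp 2 (volume : Measure Plane) -
        (propS t φ).toLp 2 (volume : Measure Plane) -
        h • (Complex.I • Δ (propS t φ) : 𝓢(Plane, ℂ)).toLp 2 (volume : Measure Plane) =
        (propS (t + h) φ - propS t φ - (h : ℂ) • (Complex.I • Δ (propS t φ))).toLp 2 volume := by
      rw [toLp_sub, toLp_sub]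
      congr 1
    rw [e]
    refine (norm_toLp_le_of_fourier (ψ := Δ (Δ φ)) (C := 3 * h ^ 2) fun ξ => ?_).trans_eq ?_
    · rw [fourier_sub, fourier_sub, fourier_smul_apply, fourier_smul_apply, fourier_laplacian,
        fourier_laplacian, fourier_laplacian, fourier_propS, fourier_propS]
      have e2 : schSym (t + h) ξ * 𝓕 φ ξ - schSym t ξ * 𝓕 φ ξ -
          h * (Complex.I * (-(lapSym ξ : ℂ) * (schSym t ξ * 𝓕 φ ξ))) =
          schSym t ξ * (Complex.exp ((-h * lapSym ξ : ℝ) * Complex.I) - 1 -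
            (-h * lapSym ξ : ℝ) * Complex.I) * 𝓕 φ ξ := by
        have : schSym (t + h) ξ = schSym t ξ * Complex.exp ((-h * lapSym ξ : ℝ) * Complex.I) := by
          rw [schSym, schSym, ← Complex.exp_add]
          congr 1
          push_cast
          ring
        rw [this]
        push_cast
        ring
      rw [e2, norm_mul, norm_mul, norm_schSym, one_mul, norm_mul, norm_mul, norm_neg,
        Complex.norm_real, Real.norm_of_nonneg (lapSym_nonneg ξ)]
      have := norm_cexp_sub_one_sub_le (-h * lapSym ξ)
      calc _ ≤ 3 * (-h * lapSym ξ) ^ 2 * ‖𝓕 φ ξ‖ := by gcongr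
        _ = _ := by ring
    · rw [Real.norm_of_nonneg (by positivity)]
      exact mul_right_comm _ _ _
  refine hO.trans_isLittleO ?_
  exact Asymptotics.isLittleO_pow_id one_lt_two

theorem continuous_propS (φ : 𝓢(Plane, ℂ)) :
    Continuous fun t => (propS t φ).toLp 2 (volume : Measure Plane) :=
  continuous_iff_continuousAt.2 fun t => (hasDerivAt_propS φ t).continuousAt

/-! ### Kernel bounds for the regularised propagator -/

/-- The kernel `(4πz)⁻¹ exp(-|w|²/(4z))` of `exp(zΔ)` for `Re z > 0`. -/
def heatKer (z : ℂ) (w : Plane) : ℂ := (4 * π * z)⁻¹ * Complex.exp (-‖w‖ ^ 2 / (4 * z))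

/-- `exp(zΔ)φ`, defined through the Fourier transform. -/
def heat (z : ℂ) (φ : 𝓢(Plane, ℂ)) (x : Plane) : ℂ :=
  ∫ ξ, Complex.exp (-(4 * π ^ 2 * z) * ‖ξ‖ ^ 2 + 2 * π * Complex.I * ⟪x, ξ⟫_ℝ) * 𝓕 φ ξ

/-- `exp(zΔ)` is convolution with the complex heat kernel, by Fourier inversion and the Fourier
transform of a Gaussian. -/
theorem heat_eq_integral_heatKer {z : ℂ} (hz : 0 < z.re) (φ : 𝓢(Plane, ℂ)) (x : Plane) :
    heat z φ x = ∫ y, heatKer z (x - y) * φ y := by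
  have hb : 0 < (4 * π ^ 2 * z : ℂ).re := by
    have : (4 * π ^ 2 * z : ℂ).re = 4 * π ^ 2 * z.re := by
      rw [show (4 * π ^ 2 * z : ℂ) = ((4 * π ^ 2 : ℝ) : ℂ) * z by push_cast; ring,
        Complex.re_ofReal_mul]
    rw [this]; positivity
  have hg := GaussianFourier.integrable_cexp_neg_mul_sq_norm_add hb (2 * π * Complex.I) x
  have h := VectorFourier.integral_fourierIntegral_smul_eq_flip (μ := (volume : Measure Plane))
    (ν := (volume : Measure Plane)) (L := innerₗ Plane) (g := φ) Real.continuous_fourierChar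
    continuous_inner hg φ.integrable
  have hflip : (innerₗ Plane).flip = innerₗ Plane := by
    ext x y
    simp
  rw [hflip] at h
  have hz0 : z ≠ 0 := by rintro rfl; simp at hz
  have hF : ∀ y : Plane, VectorFourier.fourierIntegral 𝐞 volume (innerₗ Plane)
      (fun v : Plane => Complex.exp (-(4 * π ^ 2 * z) * ‖v‖ ^ 2 + 2 * π * Complex.I * ⟪x, v⟫_ℝ)) y
      = heatKer z (x - y) := by
    intro y
    have := fourier_gaussian_innerProductSpace' hb x y
    rw [Real.fourier_eq] at this
    rw [VectorFourier.fourierIntegral]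
    refine Eq.trans ?_ (this.trans ?_)
    · rfl
    · rw [finrank_plane, heatKer]
      have hpi : (π : ℂ) ≠ 0 := by exact_mod_cast Real.pi_ne_zero
      congr 1
      · norm_num
        field_simp
      · congr 1
        field_simp
  simp only [smul_eq_mul] at h
  rw [heat]
  refine Eq.trans ?_ (h.symm.trans ?_)
  · rfl
  · exact integral_congr_ae (.of_forall fun y => by simp only [hF])

theorem norm_cexp_neg_sq_div (z : ℂ) (w : Plane) :
    ‖Complex.exp (-‖w‖ ^ 2 / (4 * z))‖ = Real.exp (-(z.re / (4 * ‖z‖ ^ 2)) * ‖w‖ ^ 2) := by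
  rw [Complex.norm_exp]
  congr 1
  rw [show (-(‖w‖ : ℂ) ^ 2 / (4 * z)) = ((-‖w‖ ^ 2 / 4 : ℝ) : ℂ) * z⁻¹ by
    push_cast; rw [div_mul_eq_div_div, div_eq_mul_inv _ z], Complex.re_ofReal_mul, Complex.inv_re,
    Complex.normSq_eq_norm_sq]
  ring

theorem norm_heatKer_le {z : ℂ} (hz : 0 ≤ z.re) (w : Plane) : ‖heatKer z w‖ ≤ ‖z‖⁻¹ := by
  rw [heatKer, norm_mul, norm_cexp_neg_sq_div, norm_inv, norm_mul, norm_mul]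
  have h1 : Real.exp (-(z.re / (4 * ‖z‖ ^ 2)) * ‖w‖ ^ 2) ≤ 1 := by
    rw [Real.exp_le_one_iff]
    have : 0 ≤ z.re / (4 * ‖z‖ ^ 2) * ‖w‖ ^ 2 := by positivity
    linarith
  have h2 : (‖(4 : ℂ)‖ * ‖(π : ℂ)‖ * ‖z‖)⁻¹ ≤ ‖z‖⁻¹ := by
    rcases eq_or_ne z 0 with rfl | h0
    · simp
    have h0 : 0 < ‖z‖ := norm_pos_iff.2 h0
    apply inv_anti₀ h0
    have : ‖(π : ℂ)‖ = π := by simp [Real.pi_pos.le, abs_of_nonneg]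
    rw [this]
    have := Real.pi_gt_three
    norm_num
    nlinarith
  calc _ ≤ ‖z‖⁻¹ * 1 := by gcongr
    _ = _ := mul_one _

theorem hasFDerivAt_heatKer (z : ℂ) (w : Plane) (e : Plane) :
    fderiv ℝ (heatKer z) w e = heatKer z w * (-(2 * ⟪w, e⟫_ℝ : ℝ) / (4 * z)) ∧
      DifferentiableAt ℝ (heatKer z) w := by
  have h1 : HasFDerivAt (fun w : Plane => ((‖w‖ ^ 2 : ℝ) : ℂ))
      (Complex.ofRealCLM.comp (2 • innerSL ℝ w)) w :=
    Complex.ofRealCLM.hasFDerivAt.comp w (hasStrictFDerivAt_norm_sq w).hasFDerivAt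
  have h2 : HasFDerivAt (heatKer z) _ w :=
    ((((h1.const_mul (-(4 * z)⁻¹)).cexp).const_mul (4 * π * z)⁻¹).congr_of_eventuallyEq
      (.of_forall fun w => by
        simp only [heatKer]; congr 2; push_cast; ring))
  refine ⟨?_, h2.differentiableAt⟩
  rw [h2.fderiv]
  simp only [heatKer, smul_apply, ContinuousLinearMap.comp_apply, nsmul_eq_mul,
    innerSL_apply_apply, smul_eq_mul, Complex.ofRealCLM_apply]
  have : (-(‖w‖ : ℂ) ^ 2 / (4 * z)) = -(4 * z)⁻¹ * ((‖w‖ ^ 2 : ℝ) : ℂ) := by push_cast; ring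
  rw [this]
  push_cast
  ring

theorem mul_exp_neg_sq_le {a : ℝ} (ha : 0 < a) (r : ℝ) :
    r * Real.exp (-a * r ^ 2) ≤ (√a)⁻¹ := by
  have h1 := Real.add_one_le_exp (a * r ^ 2)
  have hs : √a ^ 2 = a := Real.sq_sqrt ha.le
  have hsp : 0 < √a := Real.sqrt_pos.2 ha
  rw [show -a * r ^ 2 = -(a * r ^ 2) by ring, Real.exp_neg, ← div_eq_mul_inv,
    div_le_iff₀ (Real.exp_pos _)]
  have h2 : r ≤ (√a)⁻¹ * (a * r ^ 2 + 1) := by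
    rw [inv_mul_eq_div, le_div_iff₀ hsp]
    have : a * r ^ 2 = (√a * r) ^ 2 := by rw [mul_pow, hs]
    nlinarith [sq_nonneg (√a * r - 1)]
  exact h2.trans (by gcongr)

theorem norm_fderiv_heatKer_le {z : ℂ} (hz : 0 < z.re) (w : Plane) (j : Fin 2) :
    ‖fderiv ℝ (heatKer z) w (EuclideanSpace.single j 1)‖ ≤ (√z.re)⁻¹ * ‖z‖⁻¹ := by
  have hz0 : z ≠ 0 := by rintro rfl; simp at hz
  have hz0 : 0 < ‖z‖ := norm_pos_iff.2 hz0
  rw [(hasFDerivAt_heatKer z w _).1, heatKer, norm_mul, norm_mul, norm_cexp_neg_sq_div, norm_inv,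
    norm_mul, norm_mul, norm_div, norm_neg, norm_mul, Complex.norm_real,
    EuclideanSpace.inner_single_right]
  have hw : ‖(2 * (1 * (starRingEnd ℝ) (w j)) : ℝ)‖ ≤ 2 * ‖w‖ := by
    simp only [one_mul, norm_mul]
    gcongr
    · simp
    · simpa using PiLp.norm_apply_le w j
  have ha : 0 < z.re / (4 * ‖z‖ ^ 2) := by positivity
  have hm := mul_exp_neg_sq_le ha ‖w‖
  have hsq : √(z.re / (4 * ‖z‖ ^ 2)) = √z.re / (2 * ‖z‖) := by
    rw [Real.sqrt_div hz.le, show 4 * ‖z‖ ^ 2 = (2 * ‖z‖) ^ 2 by ring,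
      Real.sqrt_sq (by positivity)]
  rw [hsq, inv_div] at hm
  norm_num
  rw [abs_of_pos Real.pi_pos]
  have hs : 0 < √z.re := Real.sqrt_pos.2 hz
  norm_num at hw
  calc _ ≤ ‖z‖⁻¹ * (π⁻¹ * (1/4)) * Real.exp (-(z.re / (4 * ‖z‖ ^ 2) * ‖w‖ ^ 2)) *
        (2 * ‖w‖ / (4 * ‖z‖)) := by gcongr
    _ = (‖w‖ * Real.exp (-(z.re / (4 * ‖z‖ ^ 2)) * ‖w‖ ^ 2)) *
        (‖z‖⁻¹ * (π⁻¹ * (1/4)) * (1 / (2 * ‖z‖))) := by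
          rw [neg_mul]; ring
    _ ≤ (2 * ‖z‖ / √z.re) * (‖z‖⁻¹ * (π⁻¹ * (1/4)) * (1 / (2 * ‖z‖))) := by gcongr
    _ = (√z.re)⁻¹ * ‖z‖⁻¹ * (π⁻¹ * (1/4)) := by field_simp
    _ ≤ (√z.re)⁻¹ * ‖z‖⁻¹ * 1 := by
        gcongr
        have : π⁻¹ ≤ 1 := inv_le_one_of_one_le₀ (by linarith [Real.pi_gt_three])
        linarith
    _ = _ := mul_one _

/-! ### Dispersive bounds for the resolvent-smoothed propagator -/

theorem eq_integral_fourier (φ : 𝓢(Plane, ℂ)) (x : Plane) :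
    φ x = ∫ ξ, Complex.exp (2 * π * Complex.I * ⟪x, ξ⟫_ℝ) * 𝓕 φ ξ := by
  conv_lhs => rw [← FourierTransform.fourierInv_fourier_eq (F := 𝓢(Plane, ℂ)) φ]
  rw [SchwartzMap.fourierInv_coe, Real.fourierInv_eq']
  apply integral_congr_ae (.of_forall fun ξ => ?_)
  simp only [smul_eq_mul]
  congr 2
  rw [real_inner_comm]
  push_cast
  ring

/-- Since `(1 - Δ)⁻¹ = ∫₀^∞ exp(-σ) exp(σΔ) dσ`, the smoothed propagator `(1 - Δ)⁻¹ exp(iτΔ)` is an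
average of the operators `exp((σ + iτ)Δ)`, whose kernels are explicit and absolutely integrable. -/
theorem resolventS_propS_eq_integral_heat (τ : ℝ) (φ : 𝓢(Plane, ℂ)) (x : Plane) :
    resolventS (propS τ φ) x =
      ∫ σ in Ioi (0 : ℝ), (Real.exp (-σ) : ℂ) * heat (σ + τ * Complex.I) φ x := by
  set F : ℝ → Plane → ℂ := fun σ ξ => (Real.exp (-σ) : ℂ) *
    (Complex.exp (-(4 * π ^ 2 * (σ + τ * Complex.I)) * ‖ξ‖ ^ 2 + 2 * π * Complex.I * ⟪x, ξ⟫_ℝ) *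
      𝓕 φ ξ) with hF
  have hint : Integrable (Function.uncurry F) ((volume.restrict (Ioi (0 : ℝ))).prod volume) := by
    have hb : Integrable (fun p : ℝ × Plane => Real.exp (-p.1) * ‖𝓕 φ p.2‖)
        ((volume.restrict (Ioi (0 : ℝ))).prod volume) := by
      have h1 : Integrable (fun ξ => ‖𝓕 φ ξ‖) (volume : Measure Plane) :=
        (𝓕 φ : 𝓢(Plane, ℂ)).integrable.norm
      exact Integrable.mul_prod (f := fun σ : ℝ => Real.exp (-σ)) (integrableOn_exp_neg_Ioi 0) h1
    refine hb.mono' ?_ ?_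
    · apply Continuous.aestronglyMeasurable
      have : Continuous ⇑(𝓕 φ : 𝓢(Plane, ℂ)) := (𝓕 φ : 𝓢(Plane, ℂ)).continuous
      simp only [Function.uncurry_def, hF]
      fun_prop
    · have h0 : ∀ᵐ p ∂((volume.restrict (Ioi (0 : ℝ))).prod (volume : Measure Plane)),
          p.1 ∈ Ioi (0 : ℝ) :=
        Measure.quasiMeasurePreserving_fst.ae (ae_restrict_mem measurableSet_Ioi)
      filter_upwards [h0] with p hp
      have hp : 0 < p.1 := hp
      simp only [Function.uncurry_def, hF, norm_mul, Complex.norm_real, Real.norm_eq_abs,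
        Real.abs_exp]
      have hr : (-(4 * π ^ 2 * (p.1 + τ * Complex.I)) * ‖p.2‖ ^ 2 +
          2 * π * Complex.I * ⟪x, p.2⟫_ℝ : ℂ).re = -(4 * π ^ 2 * p.1 * ‖p.2‖ ^ 2) := by
        have : (-(4 * π ^ 2 * (p.1 + τ * Complex.I)) * ‖p.2‖ ^ 2 +
          2 * π * Complex.I * ⟪x, p.2⟫_ℝ : ℂ) = ((-(4 * π ^ 2 * p.1 * ‖p.2‖ ^ 2) : ℝ) : ℂ) +
            ((-(4 * π ^ 2 * τ * ‖p.2‖ ^ 2) + 2 * π * ⟪x, p.2⟫_ℝ : ℝ) : ℂ) * Complex.I := by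
          push_cast; ring
        rw [this, Complex.add_re, Complex.re_ofReal_mul, Complex.I_re, Complex.ofReal_re]
        ring
      rw [Complex.norm_exp, hr]
      have h1 : Real.exp (-(4 * π ^ 2 * p.1 * ‖p.2‖ ^ 2)) ≤ 1 :=
        Real.exp_le_one_iff.2 (neg_nonpos.2 (by positivity))
      calc _ ≤ Real.exp (-p.1) * (1 * ‖𝓕 φ p.2‖) := by gcongr
        _ = _ := by rw [one_mul]
  have hswap := integral_integral_swap hint
  have hL : ∀ σ : ℝ, ∫ ξ, F σ ξ = (Real.exp (-σ) : ℂ) * heat (σ + τ * Complex.I) φ x := by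
    intro σ
    simp only [hF, heat]
    rw [integral_const_mul]
  simp only [hL] at hswap
  rw [hswap, eq_integral_fourier]
  apply integral_congr_ae (.of_forall fun ξ => ?_)
  have hX := lapSym_nonneg ξ
  have e1 : ∀ σ : ℝ, F σ ξ = ((Real.exp (-(1 + lapSym ξ) * σ) : ℝ) : ℂ) *
      (schSym τ ξ * Complex.exp (2 * π * Complex.I * ⟪x, ξ⟫_ℝ) * 𝓕 φ ξ) := by
    intro σ
    simp only [hF]
    rw [← mul_assoc, ← mul_assoc]
    congr 1
    rw [schSym, Complex.ofReal_exp, Complex.ofReal_exp, ← Complex.exp_add, ← Complex.exp_add,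
      ← Complex.exp_add]
    congr 1
    rw [lapSym]
    push_cast
    ring
  simp only [e1]
  rw [integral_mul_const, integral_complex_ofReal, integral_exp_mul_Ioi (by linarith),
    fourier_resolventS,
    fourier_propS, resSym]
  have : (1 + lapSym ξ : ℂ) ≠ 0 := by exact_mod_cast (by linarith : (0 : ℝ) < 1 + lapSym ξ).ne'
  rw [mul_zero, Real.exp_zero, neg_div_neg_eq]
  push_cast
  field_simp

theorem norm_heat_le {z : ℂ} (hz : 0 < z.re) (φ : 𝓢(Plane, ℂ)) (x : Plane) :
    ‖heat z φ x‖ ≤ ‖z‖⁻¹ * ∫ y, ‖φ y‖ := by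
  rw [heat_eq_integral_heatKer hz, ← integral_const_mul]
  refine norm_integral_le_of_norm_le (φ.integrable.norm.const_mul _) (.of_forall fun y => ?_)
  rw [norm_mul]
  gcongr
  exact norm_heatKer_le hz.le _

/-- A derivative moved onto the heat kernel costs the factor `(Re z)^(-1/2)`. -/
theorem norm_heat_dS_le {z : ℂ} (hz : 0 < z.re) (φ : 𝓢(Plane, ℂ)) (j : Fin 2) (x : Plane) :
    ‖heat z (dS j φ) x‖ ≤ (√z.re)⁻¹ * ‖z‖⁻¹ * ∫ y, ‖φ y‖ := by
  have hd : ∀ y, DifferentiableAt ℝ (fun y => heatKer z (x - y)) y := fun y =>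
    ((hasFDerivAt_heatKer z (x - y) 0).2).comp y (differentiableAt_id.const_sub x)
  have hf : ∀ y, fderiv ℝ (fun y => heatKer z (x - y)) y (EuclideanSpace.single j 1) =
      -fderiv ℝ (heatKer z) (x - y) (EuclideanSpace.single j 1) := by
    intro y
    have := (((hasFDerivAt_heatKer z (x - y) 0).2).hasFDerivAt.comp y
      ((hasFDerivAt_id y).const_sub x)).fderiv
    have e : (heatKer z ∘ HSub.hSub x) = fun y => heatKer z (x - y) := rfl
    rw [e] at this
    rw [this]
    simp
  have hk : Continuous (heatKer z) := by unfold heatKer; fun_prop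
  have hk' : Continuous fun w => fderiv ℝ (heatKer z) w (EuclideanSpace.single j 1) := by
    simp only [(hasFDerivAt_heatKer z _ _).1]
    fun_prop
  have i1 : Integrable (fun y => fderiv ℝ (fun y => heatKer z (x - y)) y
      (EuclideanSpace.single j 1) * φ y) := by
    simp only [hf]
    refine φ.integrable.bdd_mul (c := (√z.re)⁻¹ * ‖z‖⁻¹) ?_ (.of_forall fun y => ?_)
    · exact (hk'.comp (continuous_const.sub continuous_id)).neg.aestronglyMeasurable
    · rw [norm_neg]; exact norm_fderiv_heatKer_le hz _ j
  have hbd : ∀ ψ : 𝓢(Plane, ℂ), Integrable (fun y => heatKer z (x - y) * ψ y) := fun ψ =>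
    ψ.integrable.bdd_mul (c := ‖z‖⁻¹)
      (hk.comp (continuous_const.sub continuous_id)).aestronglyMeasurable
      (.of_forall fun y => norm_heatKer_le hz.le _)
  have i2 := hbd (dS j φ)
  rw [coe_dS] at i2
  have hip := integral_mul_fderiv_eq_neg_fderiv_mul_of_integrable (μ := (volume : Measure Plane))
    i1 i2 (hbd φ) (fun y _ => hd y) (fun y _ => φ.differentiableAt)
  rw [heat_eq_integral_heatKer hz, coe_dS]
  change ‖∫ y, heatKer z (x - y) * fderiv ℝ φ y (EuclideanSpace.single j 1)‖ ≤ _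
  rw [hip, norm_neg, ← integral_const_mul]
  refine norm_integral_le_of_norm_le (φ.integrable.norm.const_mul _) (.of_forall fun y => ?_)
  rw [norm_mul, hf, norm_neg]
  gcongr
  exact norm_fderiv_heatKer_le hz _ j

/-- A bound `A σ^(-3/4)` for `exp((σ + iτ)Δ)φ` integrates against `exp(-σ)` to `A Γ(1/4)`. -/
theorem norm_resolventS_propS_le_of_heat {τ A : ℝ} {φ : 𝓢(Plane, ℂ)} {x : Plane}
    (h : ∀ σ : ℝ, 0 < σ → ‖heat (σ + τ * Complex.I) φ x‖ ≤ A * σ ^ (-(3 / 4) : ℝ)) :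
    ‖resolventS (propS τ φ) x‖ ≤ A * Real.Gamma (1 / 4) := by
  rw [resolventS_propS_eq_integral_heat, Real.Gamma_eq_integral (by norm_num),
    ← integral_const_mul]
  refine norm_integral_le_of_norm_le
    ((Real.GammaIntegral_convergent (by norm_num)).const_mul A) ?_
  filter_upwards [ae_restrict_mem measurableSet_Ioi] with σ hσ
  rw [norm_mul, Complex.norm_real, Real.norm_eq_abs, Real.abs_exp]
  calc _ ≤ Real.exp (-σ) * (A * σ ^ (-(3 / 4) : ℝ)) := by gcongr; exact h σ hσ
    _ = _ := by norm_num; ring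

/-- Interpolation between `|z| ≥ σ` and `|z| ≥ |τ|` for `z = σ + iτ`, which trades decay in `σ` for
decay in `τ`. -/
theorem inv_norm_le_rpow {σ τ a b : ℝ} (hσ : 0 < σ) (hτ : τ ≠ 0) (ha : 0 ≤ a) (hb : 0 ≤ b)
    (hab : a + b = 1) : ‖(σ + τ * Complex.I : ℂ)‖⁻¹ ≤ σ ^ (-a) * |τ| ^ (-b) := by
  set z : ℂ := σ + τ * Complex.I
  have h1 : σ ≤ ‖z‖ := by
    have := Complex.abs_re_le_norm z
    simp only [z, Complex.add_re, Complex.ofReal_re, Complex.re_ofReal_mul, Complex.I_re, mul_zero,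
      add_zero] at this
    exact (le_abs_self σ).trans this
  have h2 : |τ| ≤ ‖z‖ := by
    have := Complex.abs_im_le_norm z
    simpa [z] using this
  have hz : 0 < ‖z‖ := hσ.trans_le h1
  have hτ' : 0 < |τ| := abs_pos.2 hτ
  rw [Real.rpow_neg hσ.le, Real.rpow_neg hτ'.le, ← mul_inv]
  apply inv_anti₀ (by positivity)
  calc σ ^ a * |τ| ^ b ≤ ‖z‖ ^ a * ‖z‖ ^ b := by gcongr
    _ = ‖z‖ := by rw [← Real.rpow_add hz, hab, Real.rpow_one]

/-- `L¹ → L^∞` decay of the smoothed propagator. The true singularity at `τ = 0` is logarithmic; the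
power `-1/4` is enough, as its square is locally integrable. -/
theorem norm_resolventS_propS_le {τ : ℝ} (hτ : τ ≠ 0) (φ : 𝓢(Plane, ℂ)) (x : Plane) :
    ‖resolventS (propS τ φ) x‖ ≤
      Real.Gamma (1 / 4) * |τ| ^ (-(1 / 4) : ℝ) * ∫ y, ‖φ y‖ := by
  have hn : 0 ≤ ∫ y, ‖φ y‖ := integral_nonneg fun _ => norm_nonneg _
  refine (norm_resolventS_propS_le_of_heat (A := |τ| ^ (-(1 / 4) : ℝ) * ∫ y, ‖φ y‖)
    fun σ hσ => ?_).trans_eq (by ring)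
  refine (norm_heat_le (by simpa using hσ) φ x).trans ?_
  calc _ ≤ (σ ^ (-(3 / 4) : ℝ) * |τ| ^ (-(1 / 4) : ℝ)) * ∫ y, ‖φ y‖ := by
        gcongr; exact inv_norm_le_rpow hσ hτ (by norm_num) (by norm_num) (by norm_num)
    _ = _ := by ring

/-- The analogue with one derivative, whose singularity `|τ|^(-3/4)` is still locally integrable. -/
theorem norm_dS_resolventS_propS_le {τ : ℝ} (hτ : τ ≠ 0) (φ : 𝓢(Plane, ℂ)) (j : Fin 2)
    (x : Plane) :
    ‖dS j (resolventS (propS τ φ)) x‖ ≤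
      Real.Gamma (1 / 4) * |τ| ^ (-(3 / 4) : ℝ) * ∫ y, ‖φ y‖ := by
  have hn : 0 ≤ ∫ y, ‖φ y‖ := integral_nonneg fun _ => norm_nonneg _
  rw [dS_resolventS, dS_propS]
  refine (norm_resolventS_propS_le_of_heat (A := |τ| ^ (-(3 / 4) : ℝ) * ∫ y, ‖φ y‖)
    fun σ hσ => ?_).trans_eq (by ring)
  have hre : (σ + τ * Complex.I : ℂ).re = σ := by simp
  refine (norm_heat_dS_le (by simpa using hσ) φ j x).trans ?_
  rw [hre]
  calc _ ≤ (σ ^ (-(1 / 2) : ℝ) * (σ ^ (-(1 / 4) : ℝ) * |τ| ^ (-(3 / 4) : ℝ))) * ∫ y, ‖φ y‖ := by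
        gcongr
        · rw [Real.rpow_neg hσ.le, Real.sqrt_eq_rpow]
        · exact inv_norm_le_rpow hσ hτ (by norm_num) (by norm_num) (by norm_num)
    _ = (σ ^ (-(1 / 2) : ℝ) * σ ^ (-(1 / 4) : ℝ)) * (|τ| ^ (-(3 / 4) : ℝ) * ∫ y, ‖φ y‖) := by ring
    _ = _ := by rw [← Real.rpow_add hσ]; norm_num; ring

/-! ### The `TT*` argument -/

section TTstar

variable {H : Type*} [NormedAddCommGroup H] [InnerProductSpace ℂ H] [CompleteSpace H]

/-- `TT*` bound: if `|⟨E s, E t⟩|²` is dominated by a kernel with bounded marginals, then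
`t ↦ ⟨E t, f⟩` is bounded in `L⁴` by a constant that depends only on `‖f‖` and the marginals. -/
theorem integral_inner_pow_four_le {α : Type*} [MeasurableSpace α] {μ : Measure α}
    [IsFiniteMeasure μ] {E : α → H} (hE : AEStronglyMeasurable E μ) {M : ℝ}
    (hM : ∀ᵐ t ∂μ, ‖E t‖ ≤ M) {q : α → α → ℝ} (hq : Measurable (Function.uncurry q))
    (hsymm : ∀ s t, q s t = q t s) {B : ℝ}
    (hB : ∀ᵐ s ∂μ, ∫⁻ t, ENNReal.ofReal (q s t) ∂μ ≤ ENNReal.ofReal B)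
    (hEq : ∀ s, ∀ᵐ t ∂μ, ‖⟪E s, E t⟫_ℂ‖ ^ 2 ≤ q s t) (hB0 : 0 ≤ B) (hq0 : ∀ s t, 0 ≤ q s t)
    (f : H) :
    ∫⁻ t, ‖⟪E t, f⟫_ℂ‖ₑ ^ 4 ∂μ ≤ ENNReal.ofReal ((‖f‖ ^ 2 + 1) ^ 2 * B) := by
  set c : α → ℂ := fun t => ⟪E t, f⟫_ℂ with hc
  set g : α → H := fun t => (((‖c t‖ ^ 2 : ℝ) : ℂ) * c t) • E t with hg
  -- weight in the inequality `x ^ 2 * k ≤ (lam * k ^ 2 + x ^ 4 / lam) / 2` below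
  set lam : ℝ := ‖f‖ ^ 2 + 1 with hlam
  have hlam0 : 0 < lam := by positivity
  have hcm : AEStronglyMeasurable c μ := hE.inner aestronglyMeasurable_const
  have hcb : ∀ᵐ t ∂μ, ‖c t‖ ≤ M * ‖f‖ := by
    filter_upwards [hM] with t ht
    exact (norm_inner_le_norm _ _).trans (by gcongr)
  have hgm : AEStronglyMeasurable g μ := by
    have : AEStronglyMeasurable (fun t => ((‖c t‖ ^ 2 : ℝ) : ℂ) * c t) μ :=
      (Complex.continuous_ofReal.comp_aestronglyMeasurable (hcm.norm.pow 2)).mul hcm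
    exact this.smul hE
  have hgn : ∀ t, ‖g t‖ = ‖c t‖ ^ 3 * ‖E t‖ := by
    intro t
    simp only [hg, norm_smul, norm_mul, Complex.norm_real, norm_pow, norm_norm]
    ring
  have hgi : Integrable g μ := by
    refine Integrable.of_bound hgm ((M * ‖f‖) ^ 3 * M) ?_
    filter_upwards [hM, hcb] with t h1 h2
    rw [hgn]
    have := (norm_nonneg _).trans h1
    gcongr
  have hXi : Integrable (fun t => ‖c t‖ ^ 4) μ := by
    refine Integrable.of_bound (hcm.norm.pow 4) ((M * ‖f‖) ^ 4) ?_
    filter_upwards [hcb] with t h2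
    simp only [norm_pow, norm_norm]
    gcongr
  set X : ℝ := ∫ t, ‖c t‖ ^ 4 ∂μ with hX
  have hX0 : 0 ≤ X := integral_nonneg fun t => by positivity
  have hXl : ENNReal.ofReal X = ∫⁻ t, ENNReal.ofReal (‖c t‖ ^ 4) ∂μ :=
    ofReal_integral_eq_lintegral_ofReal hXi (.of_forall fun t => by positivity)
  have hXl' : ∫⁻ t, ‖c t‖ₑ ^ 4 ∂μ = ENNReal.ofReal X := by
    rw [hXl]
    refine lintegral_congr fun t => ?_
    rw [ENNReal.ofReal_pow (norm_nonneg _), ofReal_norm]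
  rw [hXl']
  apply ENNReal.ofReal_le_ofReal
  -- duality: `X = ⟪f, Ψ⟫`, and `‖Ψ‖ ^ 2` is a double integral of correlations
  set Ψ : H := ∫ t, g t ∂μ with hΨ
  have hXΨ : (X : ℂ) = ⟪f, Ψ⟫_ℂ := by
    rw [hΨ, ← integral_inner hgi, hX, ← integral_complex_ofReal]
    refine integral_congr_ae (.of_forall fun t => ?_)
    simp only [hg, inner_smul_right]
    rw [← inner_conj_symm f (E t), mul_assoc, Complex.mul_conj, Complex.normSq_eq_norm_sq]
    push_cast
    ring
  have hX2 : X ^ 2 ≤ ‖f‖ ^ 2 * ‖Ψ‖ ^ 2 := by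
    have : X ≤ ‖f‖ * ‖Ψ‖ := by
      have h1 := norm_inner_le_norm (𝕜 := ℂ) f Ψ
      rwa [← hXΨ, Complex.norm_real, Real.norm_of_nonneg hX0] at h1
    rw [← mul_pow]
    gcongr
  have hpt : ∀ s, ∀ᵐ t ∂μ, ‖⟪g s, g t⟫_ℂ‖ₑ ≤
      ENNReal.ofReal (lam / 4) * (ENNReal.ofReal (‖c s‖ ^ 4) * ENNReal.ofReal (q s t)) +
      ENNReal.ofReal (lam / 4) * (ENNReal.ofReal (q s t) * ENNReal.ofReal (‖c t‖ ^ 4)) +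
      ENNReal.ofReal (1 / (2 * lam)) * (ENNReal.ofReal (‖c s‖ ^ 4) *
        ENNReal.ofReal (‖c t‖ ^ 4)) := by
    intro s
    filter_upwards [hEq s] with t ht
    have hq := hq0 s t
    rw [← ofReal_norm, ← ENNReal.ofReal_mul (by positivity), ← ENNReal.ofReal_mul (by positivity),
      ← ENNReal.ofReal_mul (by positivity), ← ENNReal.ofReal_mul (by positivity),
      ← ENNReal.ofReal_mul (by positivity), ← ENNReal.ofReal_mul (by positivity),
      ← ENNReal.ofReal_add (by positivity) (by positivity),
      ← ENNReal.ofReal_add (by positivity) (by positivity)]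
    apply ENNReal.ofReal_le_ofReal
    have e1 : ‖⟪g s, g t⟫_ℂ‖ = ‖c s‖ ^ 3 * ‖c t‖ ^ 3 * ‖⟪E s, E t⟫_ℂ‖ := by
      simp only [hg, inner_smul_left, inner_smul_right, norm_mul, RCLike.norm_conj,
        Complex.norm_real, norm_pow, norm_norm]
      ring
    rw [e1]
    generalize ‖⟪E s, E t⟫_ℂ‖ = k at *
    generalize hx : ‖c s‖ = x at *
    generalize hy : ‖c t‖ = y at *
    have h1 : x ^ 2 * k ≤ (lam * q s t + x ^ 4 / lam) / 2 := by
      have h2 : 0 ≤ (lam * k - x ^ 2) ^ 2 / lam := by positivity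
      have h3 : (lam * k - x ^ 2) ^ 2 / lam = lam * k ^ 2 - 2 * (x ^ 2 * k) + x ^ 4 / lam := by
        field_simp
        ring
      nlinarith
    have h1' : y ^ 2 * k ≤ (lam * q s t + y ^ 4 / lam) / 2 := by
      have h2 : 0 ≤ (lam * k - y ^ 2) ^ 2 / lam := by positivity
      have h3 : (lam * k - y ^ 2) ^ 2 / lam = lam * k ^ 2 - 2 * (y ^ 2 * k) + y ^ 4 / lam := by
        field_simp
        ring
      nlinarith
    have hk : 0 ≤ k ∨ k < 0 := le_or_gt 0 k
    have hx0 : 0 ≤ x := hx ▸ norm_nonneg _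
    have hy0 : 0 ≤ y := hy ▸ norm_nonneg _
    rcases hk with hk | hk
    · calc x ^ 3 * y ^ 3 * k = (x * y) * (x ^ 2 * y ^ 2 * k) := by ring
        _ ≤ ((x ^ 2 + y ^ 2) / 2) * (x ^ 2 * y ^ 2 * k) := by
          gcongr; nlinarith [sq_nonneg (x - y)]
        _ = (x ^ 4 * (y ^ 2 * k) + y ^ 4 * (x ^ 2 * k)) / 2 := by ring
        _ ≤ (x ^ 4 * ((lam * q s t + y ^ 4 / lam) / 2) +
            y ^ 4 * ((lam * q s t + x ^ 4 / lam) / 2)) / 2 := by gcongr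
        _ = _ := by field_simp; ring
    · have : x ^ 3 * y ^ 3 * k ≤ 0 := mul_nonpos_of_nonneg_of_nonpos (by positivity) hk.le
      exact this.trans (by positivity)
  have hms : ∀ s, Measurable fun t => ENNReal.ofReal (q s t) := fun s =>
    (hq.comp measurable_prodMk_left).ennreal_ofReal
  have hcl : AEMeasurable (fun t => ENNReal.ofReal (‖c t‖ ^ 4)) μ :=
    (hcm.norm.pow 4).aemeasurable.ennreal_ofReal
  have hΨn : ENNReal.ofReal (‖Ψ‖ ^ 2) ≤ ∫⁻ s, ∫⁻ t, ‖⟪g s, g t⟫_ℂ‖ₑ ∂μ ∂μ := by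
    have e1 : ENNReal.ofReal (‖Ψ‖ ^ 2) = ‖⟪Ψ, Ψ⟫_ℂ‖ₑ := by
      rw [← ofReal_norm]
      congr 1
      rw [inner_self_eq_norm_sq_to_K]
      simp
    have e2 : ⟪Ψ, Ψ⟫_ℂ = ∫ s, ⟪Ψ, g s⟫_ℂ ∂μ := (integral_inner hgi Ψ).symm
    rw [e1, e2]
    refine (enorm_integral_le_lintegral_enorm _).trans (lintegral_mono fun s => ?_)
    have e3 : ‖⟪Ψ, g s⟫_ℂ‖ₑ = ‖⟪g s, Ψ⟫_ℂ‖ₑ := by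
      rw [← ofReal_norm, ← ofReal_norm, norm_inner_symm]
    rw [e3, hΨ, ← integral_inner hgi]
    exact enorm_integral_le_lintegral_enorm _
  have hdouble : ∫⁻ s, ∫⁻ t, ‖⟪g s, g t⟫_ℂ‖ₑ ∂μ ∂μ ≤
      ENNReal.ofReal (lam / 4) * (ENNReal.ofReal X * ENNReal.ofReal B) +
      ENNReal.ofReal (lam / 4) * (ENNReal.ofReal B * ENNReal.ofReal X) +
      ENNReal.ofReal (1 / (2 * lam)) * (ENNReal.ofReal X * ENNReal.ofReal X) := by
    have hm1 : ∀ s, Measurable fun t => ENNReal.ofReal (‖c s‖ ^ 4) * ENNReal.ofReal (q s t) :=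
      fun s => (hms s).const_mul _
    have hm2 : ∀ s, AEMeasurable (fun t => ENNReal.ofReal (q s t) * ENNReal.ofReal (‖c t‖ ^ 4)) μ :=
      fun s => (hms s).aemeasurable.mul hcl
    have hqq : Measurable fun p : α × α => ENNReal.ofReal (q p.1 p.2) := hq.ennreal_ofReal
    calc _ ≤ ∫⁻ s, (ENNReal.ofReal (lam / 4) * (ENNReal.ofReal (‖c s‖ ^ 4) *
              ∫⁻ t, ENNReal.ofReal (q s t) ∂μ) +
            ENNReal.ofReal (lam / 4) * (∫⁻ t, ENNReal.ofReal (q s t) *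
              ENNReal.ofReal (‖c t‖ ^ 4) ∂μ) +
            ENNReal.ofReal (1 / (2 * lam)) * (ENNReal.ofReal (‖c s‖ ^ 4) *
              ENNReal.ofReal X)) ∂μ := by
          refine lintegral_mono fun s => (lintegral_mono_ae (hpt s)).trans_eq ?_
          rw [lintegral_add_left' (by exact (((hm1 s).const_mul _).aemeasurable.add
              ((hm2 s).const_mul _))), lintegral_add_left ((hm1 s).const_mul _),
            lintegral_const_mul _ (hm1 s), lintegral_const_mul _ (hms s),
            lintegral_const_mul'' _ (hm2 s), lintegral_const_mul'' _ (hcl.const_mul _),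
            lintegral_const_mul'' _ hcl, ← hXl]
      _ ≤ ∫⁻ s, (ENNReal.ofReal (lam / 4) * (ENNReal.ofReal (‖c s‖ ^ 4) *
              ENNReal.ofReal B) +
            ENNReal.ofReal (lam / 4) * (∫⁻ t, ENNReal.ofReal (q s t) *
              ENNReal.ofReal (‖c t‖ ^ 4) ∂μ) +
            ENNReal.ofReal (1 / (2 * lam)) * (ENNReal.ofReal (‖c s‖ ^ 4) *
              ENNReal.ofReal X)) ∂μ := by
          refine lintegral_mono_ae ?_
          filter_upwards [hB] with s hs
          gcongr
      _ = ENNReal.ofReal (lam / 4) * (ENNReal.ofReal X * ENNReal.ofReal B) +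
          ENNReal.ofReal (lam / 4) * (∫⁻ s, ∫⁻ t, ENNReal.ofReal (q s t) *
              ENNReal.ofReal (‖c t‖ ^ 4) ∂μ ∂μ) +
          ENNReal.ofReal (1 / (2 * lam)) * (ENNReal.ofReal X * ENNReal.ofReal X) := by
          have hm3 : AEMeasurable (fun s => ∫⁻ t, ENNReal.ofReal (q s t) *
              ENNReal.ofReal (‖c t‖ ^ 4) ∂μ) μ := by
            refine AEMeasurable.lintegral_prod_right' (f := fun p : α × α =>
              ENNReal.ofReal (q p.1 p.2) * ENNReal.ofReal (‖c p.2‖ ^ 4)) ?_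
            exact hqq.aemeasurable.mul hcl.comp_snd
          rw [lintegral_add_left' (by exact ((hcl.mul_const _).const_mul _).add (hm3.const_mul _)),
            lintegral_add_left' (by exact (hcl.mul_const _).const_mul _),
            lintegral_const_mul'' _ (hcl.mul_const _), lintegral_const_mul'' _ (hcl.mul_const _),
            lintegral_const_mul'' _ hm3, lintegral_mul_const'' _ hcl, lintegral_mul_const'' _ hcl,
            ← hXl]
      _ ≤ _ := by
          have hsw : ∫⁻ s, ∫⁻ t, ENNReal.ofReal (q s t) * ENNReal.ofReal (‖c t‖ ^ 4) ∂μ ∂μ ≤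
              ENNReal.ofReal B * ENNReal.ofReal X := by
            rw [lintegral_lintegral_swap (by exact hqq.aemeasurable.mul hcl.comp_snd), hXl,
              ← lintegral_const_mul'' _ hcl]
            refine lintegral_mono_ae ?_
            filter_upwards [hB] with t ht
            have hm4 : Measurable fun s => ENNReal.ofReal (q s t) := by
              simpa only [hsymm _ t] using hms t
            rw [lintegral_mul_const _ hm4]
            gcongr
            simpa only [hsymm _ t] using ht
          gcongr
  have hfin := hΨn.trans hdouble
  rw [← ENNReal.ofReal_mul hX0, ← ENNReal.ofReal_mul hB0, ← ENNReal.ofReal_mul hX0,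
    ← ENNReal.ofReal_mul (by positivity), ← ENNReal.ofReal_mul (by positivity),
    ← ENNReal.ofReal_mul (by positivity), ← ENNReal.ofReal_add (by positivity) (by positivity),
    ← ENNReal.ofReal_add (by positivity) (by positivity),
    ENNReal.ofReal_le_ofReal_iff (by positivity)] at hfin
  -- the choice of `lam` absorbs the quadratic term
  have h1 : X ^ 2 ≤ ‖f‖ ^ 2 * (lam / 2 * (X * B)) + X ^ 2 / 2 := by
    have h2 : ‖f‖ ^ 2 * (1 / (2 * lam) * (X * X)) ≤ X ^ 2 / 2 := by
      rw [show ‖f‖ ^ 2 * (1 / (2 * lam) * (X * X)) = (‖f‖ ^ 2 / lam) * (X ^ 2 / 2) by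
        field_simp]
      have : ‖f‖ ^ 2 / lam ≤ 1 := (div_le_one hlam0).2 (by simp [hlam])
      calc _ ≤ 1 * (X ^ 2 / 2) := by gcongr
        _ = _ := one_mul _
    calc X ^ 2 ≤ ‖f‖ ^ 2 * ‖Ψ‖ ^ 2 := hX2
      _ ≤ ‖f‖ ^ 2 * (lam / 4 * (X * B) + lam / 4 * (B * X) + 1 / (2 * lam) * (X * X)) := by gcongr
      _ = ‖f‖ ^ 2 * (lam / 2 * (X * B)) + ‖f‖ ^ 2 * (1 / (2 * lam) * (X * X)) := by ring
      _ ≤ _ := by gcongr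
  rcases hX0.eq_or_lt with h0 | h0
  · rw [← h0]; positivity
  · have h2 : X ≤ ‖f‖ ^ 2 * lam * B := by
      have : X * X ≤ X * (‖f‖ ^ 2 * lam * B) := by nlinarith
      exact le_of_mul_le_mul_left this h0
    refine h2.trans ?_
    have : ‖f‖ ^ 2 ≤ lam := by simp [hlam]
    rw [sq lam]
    gcongr

/-- If the vectors `e k t` decorrelate in time like `|t - s|^(-1/4)`, uniformly in `k`, then
the maximal function `t ↦ supₖ |⟨e k t, f⟩|` is in `L⁴` on bounded intervals. -/
theorem lintegral_iSup_inner_pow_four_lt_top {e : ℕ → ℝ → H} (he : ∀ k, Continuous (e k)) {C : ℝ}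
    (hC : ∀ j k s t, s ≠ t → ‖⟪e j s, e k t⟫_ℂ‖ ≤ C * |s - t| ^ (-(1 / 4) : ℝ)) (f : H)
    (a b : ℝ) : ∫⁻ t in Icc a b, (⨆ k, ‖⟪e k t, f⟫_ℂ‖ₑ) ^ 4 < ∞ := by
  classical
  set μ : Measure ℝ := volume.restrict (Icc a b)
  set m : ℕ → ℝ → ℝ := fun k t => ‖⟪e k t, f⟫_ℂ‖ with hm
  have hmc : ∀ k, Continuous (m k) := fun k => ((he k).inner continuous_const).norm
  have hex : ∀ (N : ℕ) (t : ℝ), ∃ k, k ≤ N ∧ ∀ j ≤ N, m j t ≤ m k t := by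
    intro N t
    obtain ⟨k, hk, hmax⟩ := Finset.exists_max_image (Finset.range (N + 1))
      (fun k => m k t) ⟨0, by simp⟩
    exact ⟨k, by simpa [Nat.lt_succ_iff] using hk, fun j hj => hmax j (by simpa [Nat.lt_succ_iff])⟩
  -- a measurable choice of an index in `{0, …, N}` at which the maximum is attained linearises
  -- the maximal function
  set κ : ℕ → ℝ → ℕ := fun N t => Nat.find (hex N t) with hκ
  have hκm : ∀ N, Measurable (κ N) := by
    intro N
    refine measurable_find (hex N) fun k => ?_
    have hset : {t | k ≤ N ∧ ∀ j ≤ N, m j t ≤ m k t} =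
        {_t | k ≤ N} ∩ ⋂ (j : ℕ) (_ : j ≤ N), {t | m j t ≤ m k t} := by
      ext t; simp
    rw [hset]
    exact (MeasurableSet.const _).inter (MeasurableSet.iInter fun j => MeasurableSet.iInter fun _ =>
      measurableSet_le (hmc j).measurable (hmc k).measurable)
  have hκle : ∀ N t, κ N t ≤ N := fun N t => (Nat.find_spec (hex N t)).1
  have hκmax : ∀ N t, ∀ j ≤ N, m j t ≤ m (κ N t) t := fun N t => (Nat.find_spec (hex N t)).2
  set E : ℕ → ℝ → H := fun N t => e (κ N t) t with hEdef
  have hEsm : ∀ N, StronglyMeasurable (E N) := by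
    intro N
    have h : E N = fun t => ∑ k ∈ Finset.range (N + 1), (κ N ⁻¹' {k}).indicator (e k) t := by
      funext t
      rw [Finset.sum_eq_single (κ N t)]
      · rw [indicator_of_mem (by simp)]
      · intro k _ hk
        rw [indicator_of_notMem (by simpa using hk.symm)]
      · intro h
        exact absurd (Finset.mem_range.2 (Nat.lt_succ_of_le (hκle N t))) h
    rw [h]
    exact Finset.stronglyMeasurable_fun_sum _ fun k _ =>
      ((he k).stronglyMeasurable).indicator (hκm N (measurableSet_singleton k))
  -- the square of the correlation bound has an integrable singularity
  set q : ℝ → ℝ → ℝ := fun s t => C ^ 2 * |s - t| ^ (-(1 / 2) : ℝ) with hq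
  have hq0 : ∀ s t, 0 ≤ q s t := fun s t => by positivity
  have hloc : LocallyIntegrable (fun r : ℝ => C ^ 2 * |r| ^ (-(1 / 2) : ℝ)) := by
    refine locallyIntegrable_of_norm_le_rpow (C := C ^ 2) (α := 1 / 2) (by simp) (by simp; norm_num)
      (.of_forall fun r => ?_) (Measurable.aestronglyMeasurable (by fun_prop))
    rw [Real.norm_of_nonneg (by positivity), Real.norm_eq_abs]
  have hloc' : IntegrableOn (fun r : ℝ => C ^ 2 * |r| ^ (-(1 / 2) : ℝ)) (Icc (a - b) (b - a)) :=
    hloc.integrableOn_isCompact isCompact_Icc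
  set B : ℝ := ∫ r in Icc (a - b) (b - a), C ^ 2 * |r| ^ (-(1 / 2) : ℝ) with hBdef
  have hB0 : 0 ≤ B := integral_nonneg fun r => by positivity
  have hBl : ENNReal.ofReal B = ∫⁻ r in Icc (a - b) (b - a),
      ENNReal.ofReal (C ^ 2 * |r| ^ (-(1 / 2) : ℝ)) :=
    ofReal_integral_eq_lintegral_ofReal hloc' (.of_forall fun r => by positivity)
  have hB : ∀ᵐ s ∂μ, ∫⁻ t, ENNReal.ofReal (q s t) ∂μ ≤ ENNReal.ofReal B := by
    filter_upwards [ae_restrict_mem measurableSet_Icc] with s hs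
    rw [hBl, ← lintegral_indicator measurableSet_Icc, ← lintegral_indicator measurableSet_Icc,
      ← lintegral_sub_left_eq_self _ s]
    refine lintegral_mono fun t => ?_
    by_cases ht : s - t ∈ Icc a b
    · rw [indicator_of_mem ht, indicator_of_mem (by
        simp only [mem_Icc] at hs ht ⊢; constructor <;> linarith)]
      simp only [hq, sub_sub_cancel, le_refl]
    · rw [indicator_of_notMem ht]
      exact zero_le
  have hbound : ∀ N, ∃ M, ∀ᵐ t ∂μ, ‖E N t‖ ≤ M := by
    intro N
    have h1 : ∀ k, ∃ M, ∀ t ∈ Icc a b, ‖e k t‖ ≤ M := fun k =>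
      isCompact_Icc.exists_bound_of_continuousOn (he k).continuousOn
    choose M hMk using h1
    refine ⟨∑ k ∈ Finset.range (N + 1), |M k|, ?_⟩
    filter_upwards [ae_restrict_mem measurableSet_Icc] with t ht
    refine ((hMk (κ N t) t ht).trans (le_abs_self _)).trans ?_
    exact Finset.single_le_sum (f := fun k => |M k|) (fun k _ => abs_nonneg _)
      (Finset.mem_range.2 (Nat.lt_succ_of_le (hκle N t)))
  have hEq : ∀ N s, ∀ᵐ t ∂μ, ‖⟪E N s, E N t⟫_ℂ‖ ^ 2 ≤ q s t := by
    intro N s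
    have hne : ∀ᵐ t ∂μ, t ≠ s := by
      refine ae_restrict_of_ae ?_
      exact compl_mem_ae_iff.2 (measure_singleton s)
    filter_upwards [hne] with t ht
    have h1 := hC (κ N s) (κ N t) s t ht.symm
    calc _ ≤ (C * |s - t| ^ (-(1 / 4) : ℝ)) ^ 2 := by gcongr
      _ = q s t := by
        rw [mul_pow, hq, ← Real.rpow_natCast (|s - t| ^ _), ← Real.rpow_mul (abs_nonneg _)]
        norm_num
  have hfin : ∀ N, ∫⁻ t, ‖⟪E N t, f⟫_ℂ‖ₑ ^ 4 ∂μ ≤ ENNReal.ofReal ((‖f‖ ^ 2 + 1) ^ 2 * B) := by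
    intro N
    obtain ⟨M, hM⟩ := hbound N
    exact integral_inner_pow_four_le (hEsm N).aestronglyMeasurable hM (by fun_prop)
      (fun s t => by simp only [hq, abs_sub_comm]) hB (hEq N) hB0 hq0 f
  have hmono : ∀ t, Monotone fun N => ‖⟪E N t, f⟫_ℂ‖ₑ ^ 4 := by
    intro t
    refine monotone_nat_of_le_succ fun N => ?_
    gcongr
    rw [← ofReal_norm, ← ofReal_norm]
    exact ENNReal.ofReal_le_ofReal (hκmax (N + 1) t (κ N t) ((hκle N t).trans N.le_succ))
  calc _ ≤ ∫⁻ t, ⨆ N, ‖⟪E N t, f⟫_ℂ‖ₑ ^ 4 ∂μ := by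
        refine lintegral_mono fun t => ?_
        have h1 : ∀ k, ‖⟪e k t, f⟫_ℂ‖ₑ ≤ ‖⟪E k t, f⟫_ℂ‖ₑ := by
          intro k
          rw [← ofReal_norm, ← ofReal_norm]
          exact ENNReal.ofReal_le_ofReal (hκmax k t k le_rfl)
        have h2 : (⨆ k, ‖⟪e k t, f⟫_ℂ‖ₑ) ^ 4 = ⨆ k, ‖⟪e k t, f⟫_ℂ‖ₑ ^ 4 :=
          ENNReal.iSup_pow_of_ne_zero (by norm_num) _
        simp only [h2]
        exact iSup_mono fun k => by gcongr; exact h1 k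
    _ = ⨆ N, ∫⁻ t, ‖⟪E N t, f⟫_ℂ‖ₑ ^ 4 ∂μ := by
        refine lintegral_iSup (fun N => ?_) fun N N' h t => hmono t h
        exact ((hEsm N).inner stronglyMeasurable_const).enorm.pow_const 4
    _ ≤ ENNReal.ofReal ((‖f‖ ^ 2 + 1) ^ 2 * B) := iSup_le hfin
    _ < ∞ := ENNReal.ofReal_lt_top

end TTstar

/-! ### The weak equation and conservation of mass -/

/-- A continuous `H¹`-valued function on the line which solves the equation weakly on the open
interval `(a, b)`, written with `L²` inner products. -/
structure IsWeakSolution (a b : ℝ) (v : ℝ → H1) : Prop where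
  continuous : Continuous v
  hasDerivAt : ∀ ψ : 𝓢(Plane, ℂ), ∀ t ∈ Ioo a b,
    HasDerivAt (fun s => ⟪ψ.toLp 2 (volume : Measure Plane), (v s).fn⟫_ℂ)
      (Complex.I * (⟪(Δ ψ : 𝓢(Plane, ℂ)).toLp 2 (volume : Measure Plane), (v t).fn⟫_ℂ +
        ⟪ψ.toLp 2 (volume : Measure Plane), nlH (v t)⟫_ℂ)) t

/-- A solution on `I`, frozen outside `[a, b] ⊆ I`, is a weak solution on `(a, b)`. -/
theorem IsSolution.isWeakSolution {I : Set ℝ} {u : ℝ → H1} (hu : IsSolution I u) {a b : ℝ}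
    (hab : a ≤ b) (hI : Icc a b ⊆ I) :
    IsWeakSolution a b (fun t => u (projIcc a b hab t)) where
  continuous := by
    have h1 : ContinuousOn u (Icc a b) := hu.continuousOn.mono hI
    exact (continuousOn_iff_continuous_domRestrict.1 h1).comp continuous_projIcc
  hasDerivAt ψ t ht := by
    have htI : t ∈ Icc a b := Ioo_subset_Icc_self ht
    have h := ((hu.equation (conjS ψ) t (hI htI)).mono hI).hasDerivAt (Icc_mem_nhds ht.1 ht.2)
    have hpt : ∀ s ∈ Icc a b, u (projIcc a b hab s) = u s := fun s hs => by
      rw [projIcc_of_mem hab hs]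
    simp only [hpt t htI]
    have h2 : HasDerivAt (fun s => ⟪ψ.toLp 2 (volume : Measure Plane), (u s).fn⟫_ℂ)
      (Complex.I * (⟪(Δ ψ : 𝓢(Plane, ℂ)).toLp 2 (volume : Measure Plane), (u t).fn⟫_ℂ +
        ⟪ψ.toLp 2 (volume : Measure Plane), nlH (u t)⟫_ℂ)) t := by
      simp only [inner_toLp_eq_integral]
      have e1 := sum_grad_pairing (u t) (conjS ψ)
      simp only [coe_dS] at e1
      have e2 : ∫ x, nlH (u t) x * conjS ψ x = ∫ x,
          ((‖(u t).fn x‖ ^ 2 + ‖(u t).fn x‖ ^ 4 : ℝ) : ℂ) * (u t).fn x * conjS ψ x := by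
        apply integral_congr_ae
        filter_upwards [coeFn_nlH (u t)] with x hx
        rw [hx, nl]
      rwa [e1, neg_neg, ← conjS_laplacian, ← e2] at h
    refine h2.congr_of_eventuallyEq ?_
    filter_upwards [Icc_mem_nhds ht.1 ht.2] with s hs
    rw [hpt s hs]

namespace IsWeakSolution

variable {a b : ℝ} {v : ℝ → H1}

theorem continuous_fn (hv : IsWeakSolution a b v) : Continuous fun t => (v t).fn :=
  fnL.continuous.comp hv.continuous

theorem continuous_grad (hv : IsWeakSolution a b v) : Continuous fun t => (v t).grad :=
  gradL.continuous.comp hv.continuous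

theorem continuous_nl (hv : IsWeakSolution a b v) : Continuous fun t => nlH (v t) :=
  continuous_nlH.comp hv.continuous

/-- The integrated equation, tested against an arbitrary element of `H¹`. -/
theorem inner_sub (hv : IsWeakSolution a b v) (w : H1) {s t : ℝ} (hs : a ≤ s) (hst : s ≤ t)
    (ht : t ≤ b) : ⟪w.fn, (v t).fn - (v s).fn⟫_ℂ =
      Complex.I * (-⟪w.grad, ∫ r in s..t, (v r).grad⟫_ℂ + ⟪w.fn, ∫ r in s..t, nlH (v r)⟫_ℂ) := by
  have hd := denseRange_ofSchwartz
  refine hd.induction_on (p := fun w : H1 => ⟪w.fn, (v t).fn - (v s).fn⟫_ℂ =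
      Complex.I * (-⟪w.grad, ∫ r in s..t, (v r).grad⟫_ℂ + ⟪w.fn, ∫ r in s..t, nlH (v r)⟫_ℂ)) w ?_ ?_
  · have hc := fnL.continuous
    have hg := gradL.continuous
    refine isClosed_eq (hc.inner continuous_const) (continuous_const.mul
      ((hg.inner continuous_const).neg.add (hc.inner continuous_const)))
  · intro ψ
    set Ψ := ψ.toLp 2 (volume : Measure Plane) with hΨ
    have hcont : Continuous fun r => Complex.I *
        (⟪(Δ ψ : 𝓢(Plane, ℂ)).toLp 2 (volume : Measure Plane), (v r).fn⟫_ℂ + ⟪Ψ, nlH (v r)⟫_ℂ) :=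
      continuous_const.mul ((continuous_const.inner hv.continuous_fn).add
        (continuous_const.inner hv.continuous_nl))
    have hftc := intervalIntegral.integral_eq_sub_of_hasDerivAt_of_le hst
      (f := fun r => ⟪Ψ, (v r).fn⟫_ℂ) (continuous_const.inner hv.continuous_fn).continuousOn
      (fun r hr => hv.hasDerivAt ψ r ⟨hs.trans_lt hr.1, hr.2.trans_le ht⟩)
      (hcont.intervalIntegrable (μ := volume) _ _)
    rw [fn_ofSchwartz, grad_ofSchwartz, inner_sub_right, ← hftc,
      intervalIntegral.integral_const_mul]
    congr 1
    have c1 : Continuous fun r =>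
        ⟪(Δ ψ : 𝓢(Plane, ℂ)).toLp 2 (volume : Measure Plane), (v r).fn⟫_ℂ :=
      continuous_const.inner hv.continuous_fn
    have c2 : Continuous fun r => ⟪Ψ, nlH (v r)⟫_ℂ := continuous_const.inner hv.continuous_nl
    rw [intervalIntegral.integral_add (c1.intervalIntegrable _ _) (c2.intervalIntegrable _ _)]
    congr 1
    · have h1 := (innerSL ℂ ((gradS ψ).toLp 2 (volume : Measure Plane))).intervalIntegral_comp_comm
        (hv.continuous_grad.intervalIntegrable (μ := volume) s t)
      simp only [innerSL_apply_apply, inner_gradS_grad] at h1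
      rw [← h1, intervalIntegral.integral_neg, neg_neg]
    · have h1 := (innerSL ℂ Ψ).intervalIntegral_comp_comm
        (hv.continuous_nl.intervalIntegrable (μ := volume) s t)
      simpa only [innerSL_apply_apply] using h1

end IsWeakSolution

/-- A product rule in which the first factor is only continuous, at a zero of the second. -/
theorem hasDerivAt_inner_of_eq_zero {H : Type*} [NormedAddCommGroup H] [InnerProductSpace ℂ H]
    {A B : ℝ → H} {B' : H} {s : ℝ} (hA : ContinuousAt A s) (hB : HasDerivAt B B' s)
    (h0 : B s = 0) : HasDerivAt (fun t => ⟪A t, B t⟫_ℂ) ⟪A s, B'⟫_ℂ s := by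
  rw [hasDerivAt_iff_tendsto_slope] at hB ⊢
  have h1 := (hA.tendsto.mono_left nhdsWithin_le_nhds : Tendsto A (𝓝[≠] s) _).inner (𝕜 := ℂ) hB
  refine h1.congr fun t => ?_
  simp only [slope_def_module, h0, sub_zero, inner_zero_right]
  rw [← Complex.coe_smul, inner_smul_right, ← Complex.coe_smul, smul_eq_mul]

/-- Gauge invariance: `v̄ (|v|²v + |v|⁴v)` is real. -/
theorem inner_fn_nlH_im (v : H1) : (⟪v.fn, nlH v⟫_ℂ).im = 0 := by
  rw [L2.inner_def]
  have h : ∫ x, ⟪v.fn x, nlH v x⟫_ℂ = ∫ x, ((‖v.fn x‖ ^ 4 + ‖v.fn x‖ ^ 6 : ℝ) : ℂ) := by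
    apply integral_congr_ae
    filter_upwards [coeFn_nlH v] with x hx
    rw [hx, nl, RCLike.inner_apply, mul_assoc, Complex.mul_conj, Complex.normSq_eq_norm_sq]
    push_cast
    ring
  rw [h, integral_complex_ofReal, Complex.ofReal_im]

namespace IsWeakSolution

variable {a b : ℝ} {v : ℝ → H1}

/-- Conservation of mass. The integrated equation over `[s, t]` is tested against `v t + v s`, which
makes the left side `‖v t‖² - ‖v s‖²`; only continuity of `v` in `H¹` is needed to differentiate the
right side at `t = s`. -/
theorem mass_eq (hv : IsWeakSolution a b v) {t : ℝ} (ht : t ∈ Icc a b) :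
    mass (v t) = mass (v a) := by
  have hsq : ∀ t ∈ Icc a b, ‖(v t).fn‖ ^ 2 = ‖(v a).fn‖ ^ 2 := by
    refine constant_of_has_deriv_right_zero (hv.continuous_fn.norm.pow 2).continuousOn ?_
    intro s hs
    have hG : HasDerivAt (fun t => ∫ r in s..t, (v r).grad) (v s).grad s :=
      intervalIntegral.integral_hasDerivAt_right (hv.continuous_grad.intervalIntegrable _ _)
        hv.continuous_grad.aestronglyMeasurable.stronglyMeasurableAtFilter
        hv.continuous_grad.continuousAt
    have hN : HasDerivAt (fun t => ∫ r in s..t, nlH (v r)) (nlH (v s)) s :=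
      intervalIntegral.integral_hasDerivAt_right (hv.continuous_nl.intervalIntegrable _ _)
        hv.continuous_nl.aestronglyMeasurable.stronglyMeasurableAtFilter
        hv.continuous_nl.continuousAt
    have h1 := hasDerivAt_inner_of_eq_zero (A := fun t => (v t + v s).grad)
      (gradL.continuous.comp (hv.continuous.add continuous_const)).continuousAt hG (by simp)
    have h2 := hasDerivAt_inner_of_eq_zero (A := fun t => (v t + v s).fn)
      (fnL.continuous.comp (hv.continuous.add continuous_const)).continuousAt hN (by simp)
    have h3 := (h1.neg.add h2).const_mul Complex.I
    have h4 : HasDerivAt (fun t => (Complex.I * (-⟪(v t + v s).grad, ∫ r in s..t, (v r).grad⟫_ℂ +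
        ⟪(v t + v s).fn, ∫ r in s..t, nlH (v r)⟫_ℂ)).re + ‖(v s).fn‖ ^ 2) 0 s := by
      have h5 := (Complex.reCLM.hasFDerivAt.comp_hasDerivAt s h3).add_const (‖(v s).fn‖ ^ 2)
      refine h5.congr_deriv ?_
      have e1 : (v s + v s).grad = (2 : ℂ) • (v s).grad := by
        rw [two_smul]; exact map_add gradL _ _
      have e2 : (v s + v s).fn = (2 : ℂ) • (v s).fn := by
        rw [two_smul]; exact map_add fnL _ _
      rw [e1, e2, inner_smul_left, inner_smul_left, inner_self_eq_norm_sq_to_K]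
      have := inner_fn_nlH_im (v s)
      simp [this, ← Complex.ofReal_pow]
    refine h4.hasDerivWithinAt.congr_of_eventuallyEq_of_mem ?_ self_mem_Ici
    filter_upwards [inter_mem_nhdsWithin _ (Iio_mem_nhds hs.2)] with t ht
    have hw := hv.inner_sub (v t + v s) hs.1 ht.1 (le_of_lt ht.2)
    rw [← hw]
    have e2 : (v t + v s).fn = (v t).fn + (v s).fn := map_add fnL _ _
    have e3 : (⟪(v t).fn + (v s).fn, (v t).fn - (v s).fn⟫_ℂ).re =
        ‖(v t).fn‖ ^ 2 - ‖(v s).fn‖ ^ 2 := by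
      rw [inner_add_left, inner_sub_right, inner_sub_right, inner_self_eq_norm_sq_to_K,
        inner_self_eq_norm_sq_to_K]
      have := inner_re_symm (𝕜 := ℂ) (v t).fn (v s).fn
      simp only [RCLike.re_eq_complex_re] at this
      simp [← Complex.ofReal_pow, this]
    rw [e2, e3]
    ring
  have := hsq t ht
  exact (pow_left_inj₀ (norm_nonneg _) (norm_nonneg _) two_ne_zero).1 this

/-- In `L²`, a solution is Hölder continuous of order `1/2` in time, with a constant that tends to
zero on short time intervals. -/
theorem exists_norm_sub_sq_le (hv : IsWeakSolution a b v) {ε : ℝ} (hε : 0 < ε) :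
    ∃ h₀ > 0, ∀ h, 0 < h → h ≤ h₀ → ∀ s ∈ Icc a b, ∀ t ∈ Icc a b, |t - s| ≤ h →
      ‖(v t).fn - (v s).fn‖ ^ 2 ≤ ε * h := by
  obtain ⟨D₁, hD₁⟩ := isCompact_Icc.exists_bound_of_continuousOn (s := Icc a b)
    hv.continuous_grad.continuousOn
  obtain ⟨D₂, hD₂⟩ := isCompact_Icc.exists_bound_of_continuousOn (s := Icc a b)
    hv.continuous_nl.continuousOn
  set D := |D₁| + |D₂| + 1 with hD
  have hDp : 0 < D := by positivity
  have huc := isCompact_Icc.uniformContinuousOn_of_continuous (s := Icc a b)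
    hv.continuous.continuousOn
  obtain ⟨δ, hδ, hδ'⟩ := Metric.uniformContinuousOn_iff.1 huc (ε / D) (by positivity)
  have key : ∀ h, 0 < h → h ≤ δ / 2 → ∀ s ∈ Icc a b, ∀ t ∈ Icc a b, s ≤ t → |t - s| ≤ h →
      ‖(v t).fn - (v s).fn‖ ^ 2 ≤ ε * h := by
    intro h h0 hh s hs t ht hst hts
    -- test the integrated equation against the increment, which is small in `H¹`
    set d := v t - v s with hd
    have e1 : d.fn = (v t).fn - (v s).fn := map_sub fnL _ _
    have hw := hv.inner_sub d hs.1 hst ht.2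
    have hn : ‖d.fn‖ ^ 2 = ‖⟪d.fn, (v t).fn - (v s).fn⟫_ℂ‖ := by
      rw [← e1, inner_self_eq_norm_sq_to_K]; simp
    have hsub : ∀ r ∈ uIoc s t, r ∈ Icc a b := by
      intro r hr
      rw [uIoc_of_le hst] at hr
      exact ⟨hs.1.trans hr.1.le, hr.2.trans ht.2⟩
    have b1 : ‖∫ r in s..t, (v r).grad‖ ≤ |D₁| * |t - s| :=
      intervalIntegral.norm_integral_le_of_norm_le_const fun r hr =>
        (hD₁ r (hsub r hr)).trans (le_abs_self _)
    have b2 : ‖∫ r in s..t, nlH (v r)‖ ≤ |D₂| * |t - s| :=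
      intervalIntegral.norm_integral_le_of_norm_le_const fun r hr =>
        (hD₂ r (hsub r hr)).trans (le_abs_self _)
    have hdn : ‖d‖ ≤ ε / D := by
      have := hδ' t ht s hs (by rw [Real.dist_eq]; linarith)
      rw [dist_eq_norm] at this
      exact this.le
    rw [← e1, hn, hw, norm_mul, Complex.norm_I, one_mul]
    calc _ ≤ ‖d.grad‖ * ‖∫ r in s..t, (v r).grad‖ + ‖d.fn‖ * ‖∫ r in s..t, nlH (v r)‖ := by
          refine (norm_add_le _ _).trans ?_
          rw [norm_neg]
          exact add_le_add (norm_inner_le_norm _ _) (norm_inner_le_norm _ _)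
      _ ≤ (ε / D) * (|D₁| * h) + (ε / D) * (|D₂| * h) := by
          have g1 := (norm_grad_le d).trans hdn
          have g2 := (norm_fn_le d).trans hdn
          have g3 := b1.trans (mul_le_mul_of_nonneg_left hts (abs_nonneg D₁))
          have g4 := b2.trans (mul_le_mul_of_nonneg_left hts (abs_nonneg D₂))
          gcongr
      _ = (ε / D) * ((|D₁| + |D₂|) * h) := by ring
      _ ≤ (ε / D) * (D * h) := by gcongr; simp [hD]
      _ = ε * h := by field_simp
  refine ⟨δ / 2, by positivity, fun h h0 hh s hs t ht hts => ?_⟩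
  rcases le_total s t with hst | hst
  · exact key h h0 hh s hs t ht hst hts
  · rw [norm_sub_rev]
    exact key h h0 hh t ht s hs hst (by rwa [abs_sub_comm])

end IsWeakSolution

/-! ### Duhamel's formula and the space-time bound -/

theorem norm_ofSchwartz_resolventS_le (φ : 𝓢(Plane, ℂ)) :
    ‖ofSchwartz (resolventS φ)‖ ≤ ‖φ.toLp 2 (volume : Measure Plane)‖ := by
  set w := ofSchwartz (resolventS φ) with hw
  have h1 : ‖w‖ ^ 2 ≤ ‖φ.toLp 2 (volume : Measure Plane)‖ * ‖w‖ := by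
    have h2 : ‖w‖ ^ 2 = ‖⟪w, w⟫_ℂ‖ := by
      have := inner_self_eq_norm_sq_to_K (𝕜 := ℂ) w
      rw [this]
      simp
    rw [h2, hw, inner_ofSchwartz, resolventS_sub_laplacian, ← hw]
    refine (norm_inner_le_norm _ _).trans ?_
    gcongr
    exact norm_fn_le w
  rcases (norm_nonneg w).eq_or_lt with h | h
  · rw [← h]; exact norm_nonneg _
  · rw [sq] at h1
    exact le_of_mul_le_mul_right h1 h

theorem resolventS_sub (φ ψ : 𝓢(Plane, ℂ)) :
    resolventS (φ - ψ) = resolventS φ - resolventS ψ :=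
  map_sub (SchwartzMap.fourierMultiplierCLM ℂ resSym) φ ψ

theorem continuous_ofSchwartz_resolventS_propS (φ : 𝓢(Plane, ℂ)) :
    Continuous fun t => ofSchwartz (resolventS (propS t φ)) := by
  refine continuous_iff_continuousAt.2 fun t => ?_
  have h := (continuous_propS φ).continuousAt (x := t)
  rw [ContinuousAt, tendsto_iff_norm_sub_tendsto_zero] at h ⊢
  refine squeeze_zero (fun _ => norm_nonneg _) (fun s => ?_) h
  rw [← map_sub, ← resolventS_sub, ← toLp_sub]
  exact norm_ofSchwartz_resolventS_le _

theorem inner_propS (t : ℝ) (φ ψ : 𝓢(Plane, ℂ)) :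
    ⟪(propS t φ).toLp 2 (volume : Measure Plane), ψ.toLp 2 (volume : Measure Plane)⟫_ℂ =
      ⟪φ.toLp 2 (volume : Measure Plane), (propS (-t) ψ).toLp 2 (volume : Measure Plane)⟫_ℂ := by
  rw [← SchwartzMap.inner_fourier_toL2_eq (propS t φ), ← SchwartzMap.inner_fourier_toL2_eq φ,
    L2.inner_def, L2.inner_def]
  apply integral_congr_ae
  filter_upwards [(𝓕 (propS t φ) : 𝓢(Plane, ℂ)).coeFn_toLp 2 volume,
    (𝓕 ψ : 𝓢(Plane, ℂ)).coeFn_toLp 2 volume, (𝓕 φ : 𝓢(Plane, ℂ)).coeFn_toLp 2 volume,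
    (𝓕 (propS (-t) ψ) : 𝓢(Plane, ℂ)).coeFn_toLp 2 volume] with ξ h1 h2 h3 h4
  rw [h1, h2, h3, h4, fourier_propS, fourier_propS, RCLike.inner_apply, RCLike.inner_apply, map_mul]
  have : (starRingEnd ℂ) (schSym t ξ) = schSym (-t) ξ := by
    rw [schSym, schSym, ← Complex.exp_conj, map_mul, Complex.conj_ofReal, Complex.conj_I]
    congr 1
    push_cast
    ring
  rw [this]
  ring

theorem norm_integral_mul_le_of_bound {f g : Plane → ℂ} {S : ℝ} (hf : Integrable f)
    (hg : ∀ x, ‖g x‖ ≤ S) : ‖∫ x, f x * g x‖ ≤ S * ∫ x, ‖f x‖ := by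
  rw [← integral_const_mul]
  refine norm_integral_le_of_norm_le (hf.norm.const_mul _) (.of_forall fun x => ?_)
  rw [norm_mul, mul_comm]
  gcongr
  exact hg x

theorem norm_inner_toLp_le {φ ψ : 𝓢(Plane, ℂ)} {S : ℝ} (h : ∀ x, ‖φ x‖ ≤ S) :
    ‖⟪φ.toLp 2 (volume : Measure Plane), ψ.toLp 2 (volume : Measure Plane)⟫_ℂ‖ ≤
      S * ∫ x, ‖ψ x‖ := by
  have e : ⟪φ.toLp 2 (volume : Measure Plane), ψ.toLp 2 (volume : Measure Plane)⟫_ℂ =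
      ∫ x, ψ x * conjS φ x := by
    rw [inner_toLp_eq_integral]
    apply integral_congr_ae
    filter_upwards [ψ.coeFn_toLp 2 volume] with x hx
    rw [hx]
  rw [e]
  exact norm_integral_mul_le_of_bound ψ.integrable fun x => by simpa using h x

/-- Decorrelation in time, in `H¹`, of the resolvent-smoothed free waves. -/
theorem norm_inner_ofSchwartz_propS_le {s t : ℝ} (hst : s ≠ t) {φ ψ : 𝓢(Plane, ℂ)}
    (hφ : ∫ x, ‖φ x‖ ≤ 1) (hψ : ∫ x, ‖ψ x‖ ≤ 1) :
    ‖⟪ofSchwartz (resolventS (propS s φ)), ofSchwartz (resolventS (propS t ψ))⟫_ℂ‖ ≤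
      Real.Gamma (1 / 4) * |s - t| ^ (-(1 / 4) : ℝ) := by
  have hG : 0 ≤ Real.Gamma (1 / 4) := (Real.Gamma_pos_of_pos (by norm_num)).le
  rw [inner_ofSchwartz, resolventS_sub_laplacian, fn_ofSchwartz, inner_propS, propS_resolventS,
    propS_propS, norm_inner_symm]
  have hb := norm_resolventS_propS_le (τ := -s + t) (fun h => hst (by linarith)) ψ
  refine (norm_inner_toLp_le hb).trans ?_
  rw [show |-s + t| = |s - t| by rw [abs_sub_comm]; congr 1; ring]
  have h0 : 0 ≤ Real.Gamma (1 / 4) * |s - t| ^ (-(1 / 4) : ℝ) := by positivity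
  calc _ ≤ Real.Gamma (1 / 4) * |s - t| ^ (-(1 / 4) : ℝ) * 1 * 1 := by
        gcongr
    _ = _ := by ring

/-- The time kernel which controls the Duhamel term. -/
def duhamelKer (τ : ℝ) : ℝ :=
  Real.Gamma (1 / 4) * |τ| ^ (-(1 / 4) : ℝ) + 2 * (Real.Gamma (1 / 4) * |τ| ^ (-(3 / 4) : ℝ))

theorem duhamelKer_nonneg (τ : ℝ) : 0 ≤ duhamelKer τ := by
  have hG : 0 ≤ Real.Gamma (1 / 4) := (Real.Gamma_pos_of_pos (by norm_num)).le
  unfold duhamelKer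
  positivity

theorem locallyIntegrable_duhamelKer : LocallyIntegrable duhamelKer := by
  have h : ∀ α : ℝ, α < 1 → LocallyIntegrable fun τ : ℝ => |τ| ^ (-α) := by
    intro α hα
    refine locallyIntegrable_of_norm_le_rpow (C := 1) (α := α) (by simp) (by simpa using hα)
      (.of_forall fun r => ?_) (Measurable.aestronglyMeasurable (by fun_prop))
    rw [Real.norm_of_nonneg (by positivity), Real.norm_eq_abs, one_mul]
  exact ((h (1 / 4) (by norm_num)).smul (Real.Gamma (1 / 4))).add
    (((h (3 / 4) (by norm_num)).smul (Real.Gamma (1 / 4))).smul (2 : ℝ))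

/-- `L^∞` bound, by duality, for the free evolution of the nonlinearity: writing
`1 = (1 - Δ)(1 - Δ)⁻¹` and integrating by parts once puts one derivative on each factor, and the
nonlinearity of an `H¹` function has a derivative in `L¹`. -/
theorem norm_inner_propS_nlH_le {τ : ℝ} (hτ : τ ≠ 0) {ψ : 𝓢(Plane, ℂ)} (hψ : ∫ x, ‖ψ x‖ ≤ 1)
    (v : H1) :
    ‖⟪(propS τ ψ).toLp 2 (volume : Measure Plane), nlH v⟫_ℂ‖ ≤ duhamelKer τ * nlBound v := by
  have hG : 0 ≤ Real.Gamma (1 / 4) := (Real.Gamma_pos_of_pos (by norm_num)).le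
  refine denseRange_ofSchwartz.induction_on (p := fun v : H1 =>
    ‖⟪(propS τ ψ).toLp 2 (volume : Measure Plane), nlH v⟫_ℂ‖ ≤ duhamelKer τ * nlBound v) v ?_ ?_
  · exact isClosed_le (continuous_const.inner continuous_nlH).norm
      (continuous_const.mul continuous_nlBound)
  · intro φ
    have hψ0 : 0 ≤ ∫ x, ‖ψ x‖ := integral_nonneg fun _ => norm_nonneg _
    set R := resolventS (propS τ ψ) with hR
    -- the `L²` pairing is the `H¹` pairing with `(1 - Δ)⁻¹` of the free wave
    have e : ⟪(propS τ ψ).toLp 2 (volume : Measure Plane), nlH (ofSchwartz φ)⟫_ℂ =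
        ⟪ofSchwartz R, ofSchwartz (nlS φ)⟫_ℂ := by
      rw [inner_ofSchwartz, hR, resolventS_sub_laplacian, nlH_ofSchwartz, fn_ofSchwartz]
    have hR0 : ∀ x, ‖R x‖ ≤ Real.Gamma (1 / 4) * |τ| ^ (-(1 / 4) : ℝ) := fun x =>
      (norm_resolventS_propS_le hτ ψ x).trans (mul_le_of_le_one_right (by positivity) hψ)
    have hR1 : ∀ j x, ‖dS j R x‖ ≤ Real.Gamma (1 / 4) * |τ| ^ (-(3 / 4) : ℝ) := fun j x =>
      (norm_dS_resolventS_propS_le hτ ψ j x).trans (mul_le_of_le_one_right (by positivity) hψ)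
    have hgr : ∀ j, ‖∫ x, ((ofSchwartz (nlS φ)).grad x) j * dS j (conjS R) x‖ ≤
        Real.Gamma (1 / 4) * |τ| ^ (-(3 / 4) : ℝ) * nlBound (ofSchwartz φ) := by
      intro j
      have e2 : ∫ x, ((ofSchwartz (nlS φ)).grad x) j * dS j (conjS R) x =
          ∫ x, dS j (nlS φ) x * dS j (conjS R) x := by
        apply integral_congr_ae
        filter_upwards [(gradS (nlS φ)).coeFn_toLp 2 volume] with x hx
        rw [grad_ofSchwartz, hx, gradS_apply]
      rw [e2]
      refine (norm_integral_mul_le_of_bound (dS j (nlS φ)).integrable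
        (S := Real.Gamma (1 / 4) * |τ| ^ (-(3 / 4) : ℝ)) fun x => ?_).trans ?_
      · rw [dS_conjS, conjS_apply, RCLike.norm_conj]
        exact hR1 j x
      · gcongr
        exact integral_norm_dS_nlS_le φ j
    rw [e, inner_H1]
    have h1 : ‖⟪(ofSchwartz R).fn, (ofSchwartz (nlS φ)).fn⟫_ℂ‖ ≤
        Real.Gamma (1 / 4) * |τ| ^ (-(1 / 4) : ℝ) * nlBound (ofSchwartz φ) := by
      refine (norm_inner_toLp_le hR0).trans ?_
      gcongr
      exact integral_norm_nlS_le φ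
    have h2 : ‖⟪(ofSchwartz R).grad, (ofSchwartz (nlS φ)).grad⟫_ℂ‖ ≤
        2 * (Real.Gamma (1 / 4) * |τ| ^ (-(3 / 4) : ℝ) * nlBound (ofSchwartz φ)) := by
      rw [grad_ofSchwartz R, inner_gradS_eq_integral, Fin.sum_univ_two, two_mul]
      exact (norm_add_le _ _).trans (add_le_add (hgr 0) (hgr 1))
    refine (norm_add_le _ _).trans ((add_le_add h1 h2).trans_eq ?_)
    rw [duhamelKer]
    ring

namespace IsWeakSolution

variable {a b : ℝ} {v : ℝ → H1}

/-- In the interaction picture only the nonlinearity contributes to the time derivative. -/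
theorem hasDerivAt_inner_propS (hv : IsWeakSolution a b v) (ψ : 𝓢(Plane, ℂ)) (t : ℝ) {s : ℝ}
    (hs : s ∈ Ioo a b) :
    HasDerivAt (fun s => ⟪(propS (s - t) ψ).toLp 2 (volume : Measure Plane), (v s).fn⟫_ℂ)
      (Complex.I * ⟪(propS (s - t) ψ).toLp 2 (volume : Measure Plane), nlH (v s)⟫_ℂ) s := by
  set p : ℝ → L2 := fun r => (propS (r - t) ψ).toLp 2 (volume : Measure Plane) with hp
  have hpd : HasDerivAt p ((Complex.I • Δ (propS (s - t) ψ) : 𝓢(Plane, ℂ)).toLp 2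
      (volume : Measure Plane)) s := by
    have := (hasDerivAt_propS ψ (s - t)).scomp s ((hasDerivAt_id s).sub_const t)
    rw [one_smul] at this
    exact this
  have h1 : HasDerivAt (fun r => ⟪(v r).fn, p r - p s⟫_ℂ) _ s :=
    hasDerivAt_inner_of_eq_zero hv.continuous_fn.continuousAt (hpd.sub_const (p s)) (sub_self _)
  have h1' := (Complex.conjCLE : ℂ →L[ℝ] ℂ).hasFDerivAt.comp_hasDerivAt s h1
  have h2 := hv.hasDerivAt (propS (s - t) ψ) s hs
  refine ((h1'.add h2).congr_of_eventuallyEq (.of_forall fun r => ?_)).congr_deriv ?_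
  · simp only [Pi.add_apply, Function.comp_apply, ContinuousLinearEquiv.coe_coe,
      Complex.conjCLE_apply, inner_conj_symm]
    rw [← inner_add_left]
    simp [hp]
  · simp only [ContinuousLinearEquiv.coe_coe, Complex.conjCLE_apply, inner_conj_symm]
    have e : (Complex.I • Δ (propS (s - t) ψ) : 𝓢(Plane, ℂ)).toLp 2 (volume : Measure Plane) =
        Complex.I • (Δ (propS (s - t) ψ) : 𝓢(Plane, ℂ)).toLp 2 (volume : Measure Plane) :=
      map_smul (SchwartzMap.toLpCLM ℂ ℂ 2 (volume : Measure Plane)) Complex.I _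
    rw [e, inner_smul_left, Complex.conj_I]
    ring

/-- Duhamel's formula, tested against a Schwartz function. The free term is written as an `H¹` inner
product, in which form the `TT*` argument applies. -/
theorem inner_eq_duhamel (hv : IsWeakSolution a b v) (ψ : 𝓢(Plane, ℂ)) {t : ℝ}
    (ht : t ∈ Icc a b) :
    ⟪ψ.toLp 2 (volume : Measure Plane), (v t).fn⟫_ℂ =
      ⟪ofSchwartz (resolventS (propS (a - t) ψ)), v a⟫_ℂ +
        ∫ s in a..t, Complex.I *
          ⟪(propS (s - t) ψ).toLp 2 (volume : Measure Plane), nlH (v s)⟫_ℂ := by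
  -- fundamental theorem of calculus for the interaction picture
  have hpc : Continuous fun s => (propS (s - t) ψ).toLp 2 (volume : Measure Plane) :=
    (continuous_propS ψ).comp (continuous_id.sub continuous_const)
  have hc : Continuous fun s => Complex.I *
      ⟪(propS (s - t) ψ).toLp 2 (volume : Measure Plane), nlH (v s)⟫_ℂ :=
    continuous_const.mul (hpc.inner hv.continuous_nl)
  have h := intervalIntegral.integral_eq_sub_of_hasDerivAt_of_le ht.1
    (f := fun s => ⟪(propS (s - t) ψ).toLp 2 (volume : Measure Plane), (v s).fn⟫_ℂ)
    (hpc.inner hv.continuous_fn).continuousOn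
    (fun s hs => hv.hasDerivAt_inner_propS ψ t ⟨hs.1, hs.2.trans_le ht.2⟩)
    (hc.intervalIntegrable (μ := volume) _ _)
  rw [h, inner_ofSchwartz, resolventS_sub_laplacian]
  simp

/-- The Duhamel term is bounded in `L^∞`, uniformly in time, because the time kernel is
integrable. -/
theorem exists_duhamel_bound (hv : IsWeakSolution a b v) : ∃ C : ℝ, ∀ t ∈ Icc a b,
    ∀ ψ : 𝓢(Plane, ℂ), ∫ x, ‖ψ x‖ ≤ 1 →
      ‖∫ s in a..t, Complex.I * ⟪(propS (s - t) ψ).toLp 2 (volume : Measure Plane),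
        nlH (v s)⟫_ℂ‖ ≤ C := by
  obtain ⟨N, hN⟩ := isCompact_Icc.exists_bound_of_continuousOn (s := Icc a b)
    (continuous_nlBound.comp hv.continuous).continuousOn
  have hki : IntegrableOn duhamelKer (Icc (a - b) 0) :=
    locallyIntegrable_duhamelKer.integrableOn_isCompact isCompact_Icc
  refine ⟨|N| * ∫ τ in Icc (a - b) 0, duhamelKer τ, fun t ht ψ hψ => ?_⟩
  have hsh : ∫ s in a..t, duhamelKer (s - t) = ∫ τ in (a - t)..0, duhamelKer τ := by
    rw [intervalIntegral.integral_comp_sub_right duhamelKer t, sub_self]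
  have hkt : IntervalIntegrable duhamelKer volume (a - t) 0 := by
    rw [intervalIntegrable_iff_integrableOn_Icc_of_le (by linarith [ht.1])]
    exact hki.mono_set (Icc_subset_Icc_left (by linarith [ht.2]))
  have hki2 : IntervalIntegrable (fun s => |N| * duhamelKer (s - t)) volume a t := by
    have := (hkt.comp_sub_right t).const_mul |N|
    simpa using this
  refine (intervalIntegral.norm_integral_le_of_norm_le ht.1 ?_ hki2).trans ?_
  · have hne : ∀ᵐ s : ℝ, s ≠ t := compl_mem_ae_iff.2 (measure_singleton t)
    filter_upwards [hne] with s hs hst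
    rw [norm_mul, Complex.norm_I, one_mul, mul_comm]
    refine (norm_inner_propS_nlH_le (sub_ne_zero.2 hs) hψ (v s)).trans ?_
    gcongr
    · exact duhamelKer_nonneg _
    · have := hN s ⟨hst.1.le, hst.2.trans ht.2⟩
      exact (le_abs_self _).trans (this.trans (le_abs_self N))
  · rw [intervalIntegral.integral_const_mul, hsh,
      intervalIntegral.integral_of_le (by linarith [ht.1]),
      ← integral_Icc_eq_integral_Ioc]
    refine mul_le_mul_of_nonneg_left
      (setIntegral_mono_set hki (.of_forall duhamelKer_nonneg) ?_) (abs_nonneg N)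
    exact (Icc_subset_Icc_left (by linarith [ht.2])).eventuallyLE

end IsWeakSolution

/-- A function whose pairings with all Schwartz functions in the unit ball of `L¹` are bounded by
`A` is bounded by `A`, by mollification. -/
theorem ae_norm_le_of_forall_inner_le {f : L2} {A : ℝ}
    (h : ∀ ψ : 𝓢(Plane, ℂ), ∫ x, ‖ψ x‖ ≤ 1 →
      ‖⟪ψ.toLp 2 (volume : Measure Plane), f⟫_ℂ‖ ≤ A) : ∀ᵐ x, ‖f x‖ ≤ A := by
  obtain ⟨φ, hφ, hφ2⟩ : ∃ φ : ℕ → ContDiffBump (0 : Plane),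
      Tendsto (fun n => (φ n).rOut) atTop (𝓝 0) ∧ ∀ n, (φ n).rOut ≤ 2 * (φ n).rIn := by
    refine ⟨fun n => ⟨(n + 1 : ℝ)⁻¹, 2 * (n + 1 : ℝ)⁻¹, by positivity, ?_⟩, ?_, fun n => le_rfl⟩
    · have : (0 : ℝ) < (n + 1 : ℝ)⁻¹ := by positivity
      linarith
    · have := (tendsto_one_div_add_atTop_nhds_zero_nat (𝕜 := ℝ)).const_mul 2
      simpa using this
  have hloc : LocallyIntegrable f (volume : Measure Plane) :=
    (Lp.memLp f).locallyIntegrable (by norm_num)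
  have hae := ContDiffBump.ae_convolution_tendsto_right_of_locallyIntegrable
    (μ := (volume : Measure Plane)) (φ := φ) (K := 2) hφ
    (.of_forall hφ2) hloc
  filter_upwards [hae] with x hx
  refine le_of_tendsto hx.norm (.of_forall fun n => ?_)
  set ρ : Plane → ℂ := fun y => (((φ n).normed volume (x - y) : ℝ) : ℂ) with hρ
  have hρs : ContDiff ℝ ((⊤ : ℕ∞) : WithTop ℕ∞) ρ :=
    Complex.ofRealCLM.contDiff.comp ((φ n).contDiff_normed.comp (contDiff_const.sub contDiff_id))
  have hρc : HasCompactSupport ρ := by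
    have h1 : HasCompactSupport fun y => (φ n).normed volume (x - y) :=
      (φ n).hasCompactSupport_normed.comp_homeomorph (Homeomorph.subLeft x)
    exact h1.comp_left (g := fun r : ℝ => (r : ℂ)) Complex.ofReal_zero
  have hρn : ∫ y, ‖ρ y‖ = 1 := by
    have : ∀ y, ‖ρ y‖ = (φ n).normed volume (x - y) := fun y => by
      rw [hρ, Complex.norm_real, Real.norm_of_nonneg ((φ n).nonneg_normed _)]
    simp only [this]
    rw [integral_sub_left_eq_self (fun y => (φ n).normed volume y)]
    exact (φ n).integral_normed
  have := h (hρc.toSchwartzMap hρs) (by simpa using hρn.le)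
  rw [inner_toLp_eq_integral] at this
  refine le_trans (le_of_eq ?_) this
  congr 1
  rw [convolution_def, ← integral_sub_left_eq_self _ _ x]
  refine integral_congr_ae (.of_forall fun y => ?_)
  simp [hρ, mul_comm]

/-- A sequence of Schwartz functions in the unit ball of `L¹` that suffices to test
boundedness of all `L²` functions. -/
theorem exists_testing_seq : ∃ ψ : ℕ → 𝓢(Plane, ℂ), (∀ k, ∫ x, ‖ψ k x‖ ≤ 1) ∧
    ∀ (f : L2) (A : ℝ), (∀ k, ‖⟪(ψ k).toLp 2 (volume : Measure Plane), f⟫_ℂ‖ ≤ A) →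
      ∀ᵐ x, ‖f x‖ ≤ A := by
  set S : Set L2 := (fun ψ : 𝓢(Plane, ℂ) => ψ.toLp 2 (volume : Measure Plane)) ''
    {ψ | ∫ x, ‖ψ x‖ ≤ 1} with hS
  have hne : Nonempty S := ⟨⟨_, ⟨0, by simp, rfl⟩⟩⟩
  have : Fact ((2 : ℝ≥0∞) ≠ ∞) := ⟨by norm_num⟩
  obtain ⟨g, hg⟩ := TopologicalSpace.exists_dense_seq S
  choose ψ hψ hψg using fun k => (g k).2
  refine ⟨ψ, hψ, fun f A h => ae_norm_le_of_forall_inner_le fun χ hχ => ?_⟩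
  have hcl : IsClosed {w : S | ‖⟪(w : L2), f⟫_ℂ‖ ≤ A} :=
    isClosed_le (continuous_subtype_val.inner continuous_const).norm continuous_const
  refine hg.induction_on (p := fun w : S => ‖⟪(w : L2), f⟫_ℂ‖ ≤ A) ⟨_, ⟨χ, hχ, rfl⟩⟩ hcl
    fun k => ?_
  have := h k
  rwa [show (ψ k).toLp 2 (volume : Measure Plane) = g k from hψg k] at this

theorem ENNReal_add_pow_four_le (x y : ℝ≥0∞) : (x + y) ^ 4 ≤ 16 * (x ^ 4 + y ^ 4) := by
  have h : x + y ≤ 2 * max x y := by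
    rw [two_mul]; exact add_le_add (le_max_left _ _) (le_max_right _ _)
  have h2 : (max x y) ^ 4 ≤ x ^ 4 + y ^ 4 := by
    rcases le_total x y with h | h
    · rw [max_eq_right h]; exact le_add_self
    · rw [max_eq_left h]; exact le_self_add
  calc (x + y) ^ 4 ≤ (2 * max x y) ^ 4 := by gcongr
    _ = 16 * (max x y) ^ 4 := by rw [mul_pow]; norm_num
    _ ≤ _ := by gcongr

/-- Solutions lie in `L⁴` of time with values in `L^∞` of space. -/
theorem IsWeakSolution.exists_sup_bound {a b : ℝ} {v : ℝ → H1} (hv : IsWeakSolution a b v) :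
    ∃ A : ℝ → ℝ≥0∞, Measurable A ∧ ∫⁻ t in Icc a b, A t ^ 4 < ∞ ∧
      ∀ t ∈ Icc a b, ∀ᵐ x, ‖(v t).fn x‖ₑ ≤ A t := by
  obtain ⟨ψ, hψ, htest⟩ := exists_testing_seq
  obtain ⟨C, hC⟩ := hv.exists_duhamel_bound
  set e : ℕ → ℝ → H1 := fun k t => ofSchwartz (resolventS (propS (a - t) (ψ k))) with he
  have hec : ∀ k, Continuous (e k) := fun k =>
    (continuous_ofSchwartz_resolventS_propS (ψ k)).comp (continuous_const.sub continuous_id)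
  have hfree := lintegral_iSup_inner_pow_four_lt_top hec (C := Real.Gamma (1 / 4))
    (fun j k s t hst => by
      have := norm_inner_ofSchwartz_propS_le (s := a - s) (t := a - t)
        (fun h => hst (by linarith)) (hψ j) (hψ k)
      rwa [show a - s - (a - t) = -(s - t) by ring, abs_neg] at this) (v a) a b
  have hm : Measurable fun t => ⨆ k, ‖⟪e k t, v a⟫_ℂ‖ₑ :=
    Measurable.iSup fun k => ((hec k).inner continuous_const).enorm.measurable
  refine ⟨fun t => ENNReal.ofReal C + ⨆ k, ‖⟪e k t, v a⟫_ℂ‖ₑ, hm.const_add _, ?_, ?_⟩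
  · calc _ ≤ ∫⁻ t in Icc a b, 16 * (ENNReal.ofReal C ^ 4 + (⨆ k, ‖⟪e k t, v a⟫_ℂ‖ₑ) ^ 4) :=
          lintegral_mono fun t => ENNReal_add_pow_four_le _ _
      _ = 16 * (ENNReal.ofReal C ^ 4 * volume (Icc a b) +
          ∫⁻ t in Icc a b, (⨆ k, ‖⟪e k t, v a⟫_ℂ‖ₑ) ^ 4) := by
          rw [lintegral_const_mul _ ((hm.pow_const 4).const_add _),
            lintegral_add_left measurable_const, lintegral_const, Measure.restrict_apply_univ]
      _ < ∞ := by
          refine ENNReal.mul_lt_top (by norm_num) (ENNReal.add_lt_top.2 ⟨?_, hfree⟩)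
          exact ENNReal.mul_lt_top (by finiteness) (by simp)
  · intro t ht
    by_cases htop : ENNReal.ofReal C + ⨆ k, ‖⟪e k t, v a⟫_ℂ‖ₑ = ∞
    · simp only [htop, le_top, Filter.eventually_true]
    · set A := ENNReal.ofReal C + ⨆ k, ‖⟪e k t, v a⟫_ℂ‖ₑ with hA
      have key : ∀ k, ‖⟪(ψ k).toLp 2 (volume : Measure Plane), (v t).fn⟫_ℂ‖ ≤ A.toReal := by
        intro k
        rw [← ENNReal.ofReal_le_iff_le_toReal htop, hv.inner_eq_duhamel (ψ k) ht]
        refine (ENNReal.ofReal_le_ofReal (norm_add_le _ _)).trans ?_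
        rw [ENNReal.ofReal_add (norm_nonneg _) (norm_nonneg _), add_comm, hA]
        gcongr
        · exact hC t ht (ψ k) (hψ k)
        · rw [ofReal_norm]
          exact le_iSup (fun k => ‖⟪e k t, v a⟫_ℂ‖ₑ) k
      filter_upwards [htest _ _ key] with x hx
      rw [← ofReal_norm]
      exact (ENNReal.ofReal_le_iff_le_toReal htop).2 hx

/-! ### Conservation of energy -/

/-- The potential energy `¼‖v‖₄⁴ + ⅙‖v‖₆⁶`. -/
def potE (v : H1) : ℝ := 1 / 4 * (∫ x, ‖v.fn x‖ ^ 4) + 1 / 6 * (∫ x, ‖v.fn x‖ ^ 6)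

theorem energy_eq (v : H1) : energy v = 1 / 2 * ‖v.grad‖ ^ 2 - potE v := by
  rw [energy, potE]; ring

theorem continuous_potE : Continuous potE :=
  ((continuous_integral_norm_pow 1).const_mul _).add ((continuous_integral_norm_pow 2).const_mul _)

theorem integrable_pot (v : H1) : Integrable fun x => pot (v.fn x) :=
  ((integrable_norm_pow v 1).const_mul _).add ((integrable_norm_pow v 2).const_mul _)

theorem integral_pot (v : H1) : ∫ x, pot (v.fn x) = potE v := by
  rw [potE, ← integral_const_mul, ← integral_const_mul]
  exact integral_add ((integrable_norm_pow v 1).const_mul _) ((integrable_norm_pow v 2).const_mul _)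

theorem integrable_norm_sq (f : L2) : Integrable fun x => ‖f x‖ ^ 2 :=
  (Lp.memLp f).integrable_norm_pow (by norm_num)

/-- First-order Taylor estimate for the potential energy, linearised at a nearby function, for
functions with a common `L^∞` bound. -/
theorem abs_potE_sub_le {p q f : H1} {M D : ℝ} (hp : ∀ᵐ x, ‖p.fn x‖ ≤ M)
    (hq : ∀ᵐ x, ‖q.fn x‖ ≤ M) (hf : ∀ᵐ x, ‖f.fn x‖ ≤ M) (h1 : ‖q.fn - p.fn‖ ^ 2 ≤ D)
    (h2 : ‖p.fn - f.fn‖ ^ 2 ≤ D) (h3 : ‖q.fn - f.fn‖ ^ 2 ≤ D) :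
    |potE q - potE p - (⟪q.fn - p.fn, nlH f⟫_ℂ).re| ≤ (3 * M ^ 2 + 5 * M ^ 4) * (2 * D) := by
  have hi : Integrable fun x => ⟪(q.fn - p.fn) x, nlH f x⟫_ℂ := L2.integrable_inner _ _
  have e1 : potE q - potE p - (⟪q.fn - p.fn, nlH f⟫_ℂ).re =
      ∫ x, (pot (q.fn x) - pot (p.fn x) - (⟪(q.fn - p.fn) x, nlH f x⟫_ℂ).re) := by
    have hre : (⟪q.fn - p.fn, nlH f⟫_ℂ).re = ∫ x, (⟪(q.fn - p.fn) x, nlH f x⟫_ℂ).re := by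
      rw [L2.inner_def]
      exact (integral_re hi).symm
    rw [hre, ← integral_pot, ← integral_pot,
      ← integral_sub (integrable_pot q) (integrable_pot p)]
    exact (integral_sub ((integrable_pot q).sub (integrable_pot p)) hi.re).symm
  have i1 := integrable_norm_sq (q.fn - p.fn)
  have i2 := integrable_norm_sq (p.fn - f.fn)
  have i3 := integrable_norm_sq (q.fn - f.fn)
  have hM : 0 ≤ 3 * M ^ 2 + 5 * M ^ 4 := by positivity
  rw [e1]
  have hle : ∫ x, (3 * M ^ 2 + 5 * M ^ 4) * (‖(q.fn - p.fn) x‖ ^ 2 +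
      (1 / 2 * ‖(p.fn - f.fn) x‖ ^ 2 + 1 / 2 * ‖(q.fn - f.fn) x‖ ^ 2)) ≤
      (3 * M ^ 2 + 5 * M ^ 4) * (2 * D) := by
    rw [integral_const_mul]
    gcongr
    have := integral_add i1 ((i2.const_mul (1 / 2)).add (i3.const_mul (1 / 2)))
    have h' := integral_add (i2.const_mul (1 / 2)) (i3.const_mul (1 / 2))
    simp only [Pi.add_apply] at this
    rw [this, h', integral_const_mul, integral_const_mul, integral_norm_sq_eq, integral_norm_sq_eq,
      integral_norm_sq_eq]
    linarith
  have hgi : Integrable fun x => (3 * M ^ 2 + 5 * M ^ 4) * (‖(q.fn - p.fn) x‖ ^ 2 +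
      (1 / 2 * ‖(p.fn - f.fn) x‖ ^ 2 + 1 / 2 * ‖(q.fn - f.fn) x‖ ^ 2)) :=
    (i1.add ((i2.const_mul (1 / 2)).add (i3.const_mul (1 / 2)))).const_mul _
  rw [← Real.norm_eq_abs]
  refine le_trans (norm_integral_le_of_norm_le hgi ?_) hle
  filter_upwards [hp, hq, hf, Lp.coeFn_sub q.fn p.fn, Lp.coeFn_sub p.fn f.fn,
    Lp.coeFn_sub q.fn f.fn, coeFn_nlH f] with x a1 a2 a3 s1 s2 s3 s4
  have hk := abs_pot_sub_le a1 a2 a3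
  have e2 : ⟪(q.fn - p.fn) x, nlH f x⟫_ℂ =
      (starRingEnd ℂ) (q.fn x - p.fn x) * nl (f.fn x) := by
    rw [RCLike.inner_apply, s1, s4, Pi.sub_apply, mul_comm]
  rw [Real.norm_eq_abs, e2]
  refine hk.trans ?_
  simp only [s1, s2, s3, Pi.sub_apply]
  gcongr
  nlinarith [sq_nonneg (‖q.fn x - p.fn x‖ - ‖p.fn x - f.fn x‖),
    sq_nonneg (‖q.fn x - p.fn x‖ - ‖q.fn x - f.fn x‖)]

/-- The Taylor estimate in a form that also allows infinite `L^∞` bounds; it costs only the fourth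
power of each bound, which is integrable in time. -/
theorem ofReal_abs_potE_sub_le {p q f : H1} {α β γ : ℝ≥0∞} {D : ℝ} (hD : 0 < D)
    (hp : ∀ᵐ x, ‖p.fn x‖ₑ ≤ α) (hq : ∀ᵐ x, ‖q.fn x‖ₑ ≤ β) (hf : ∀ᵐ x, ‖f.fn x‖ₑ ≤ γ)
    (h1 : ‖q.fn - p.fn‖ ^ 2 ≤ D) (h2 : ‖p.fn - f.fn‖ ^ 2 ≤ D) (h3 : ‖q.fn - f.fn‖ ^ 2 ≤ D) :
    ENNReal.ofReal |potE q - potE p - (⟪q.fn - p.fn, nlH f⟫_ℂ).re| ≤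
      ENNReal.ofReal (16 * D) * (1 + α ^ 4 + β ^ 4 + γ ^ 4) := by
  by_cases htop : 1 + α ^ 4 + β ^ 4 + γ ^ 4 = ∞
  · rw [htop, ENNReal.mul_top (by simpa using hD)]
    exact le_top
  have hfin : α ≠ ∞ ∧ β ≠ ∞ ∧ γ ≠ ∞ := by
    simp only [ENNReal.add_eq_top, not_or, ENNReal.pow_eq_top_iff] at htop
    refine ⟨fun h => htop.1.1.2 (by simp [h]), fun h => htop.1.2 (by simp [h]),
      fun h => htop.2 (by simp [h])⟩
  lift α to ℝ≥0 using hfin.1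
  lift β to ℝ≥0 using hfin.2.1
  lift γ to ℝ≥0 using hfin.2.2
  set M : ℝ≥0 := max α (max β γ) with hM
  have conv : ∀ (w : H1) (δ : ℝ≥0), δ ≤ M → (∀ᵐ x, ‖w.fn x‖ₑ ≤ δ) → ∀ᵐ x, ‖w.fn x‖ ≤ M := by
    intro w δ hδ hw
    filter_upwards [hw] with x hx
    have : ‖w.fn x‖₊ ≤ M := (by exact_mod_cast hx : ‖w.fn x‖₊ ≤ δ).trans hδ
    exact_mod_cast this
  have hb := abs_potE_sub_le (conv p α (le_max_left _ _) hp)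
    (conv q β ((le_max_left _ _).trans (le_max_right _ _)) hq)
    (conv f γ ((le_max_right _ _).trans (le_max_right _ _)) hf) h1 h2 h3
  have hM4 : (M : ℝ) ^ 4 ≤ (α : ℝ) ^ 4 + β ^ 4 + γ ^ 4 := by
    have h : M = α ∨ M = β ∨ M = γ := by
      rcases max_choice α (max β γ) with h | h
      · exact Or.inl h
      · rcases max_choice β γ with h' | h'
        · exact Or.inr (Or.inl (h.trans h'))
        · exact Or.inr (Or.inr (h.trans h'))
    have a4 : 0 ≤ (α : ℝ) ^ 4 := by positivity
    have b4 : 0 ≤ (β : ℝ) ^ 4 := by positivity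
    have c4 : 0 ≤ (γ : ℝ) ^ 4 := by positivity
    rcases h with h | h | h <;> rw [h] <;> linarith
  have hreal : |potE q - potE p - (⟪q.fn - p.fn, nlH f⟫_ℂ).re| ≤
      16 * D * (1 + (α : ℝ) ^ 4 + β ^ 4 + γ ^ 4) := by
    refine hb.trans ?_
    have : 3 * (M : ℝ) ^ 2 + 5 * M ^ 4 ≤ 8 * (1 + M ^ 4) := by
      nlinarith [sq_nonneg ((M : ℝ) ^ 2 - 1)]
    calc (3 * (M : ℝ) ^ 2 + 5 * M ^ 4) * (2 * D) ≤ 8 * (1 + M ^ 4) * (2 * D) := by gcongr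
      _ ≤ 8 * (1 + ((α : ℝ) ^ 4 + β ^ 4 + γ ^ 4)) * (2 * D) := by gcongr
      _ = _ := by ring
  refine (ENNReal.ofReal_le_ofReal hreal).trans_eq ?_
  rw [ENNReal.ofReal_mul (by positivity)]
  congr 1
  rw [ENNReal.ofReal_add (by positivity) (by positivity),
    ENNReal.ofReal_add (by positivity) (by positivity),
    ENNReal.ofReal_add (by positivity) (by positivity), ENNReal.ofReal_one,
    ENNReal.ofReal_pow α.coe_nonneg, ENNReal.ofReal_pow β.coe_nonneg,
    ENNReal.ofReal_pow γ.coe_nonneg]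
  simp only [ENNReal.ofReal_coe_nnreal]

theorem tendsto_average_integral {F : Type*} [NormedAddCommGroup F] [NormedSpace ℝ F]
    [CompleteSpace F] {f : ℝ → F} (hf : Continuous f) (r : ℝ) :
    Tendsto (fun h : ℝ => h⁻¹ • ∫ s in r..(r + h), f s) (𝓝[>] 0) (𝓝 (f r)) := by
  have hd : HasDerivAt (fun t => ∫ s in r..t, f s) (f r) r :=
    intervalIntegral.integral_hasDerivAt_right (hf.intervalIntegrable _ _)
      hf.aestronglyMeasurable.stronglyMeasurableAtFilter hf.continuousAt
  have h := hasDerivAt_iff_tendsto_slope_zero.1 hd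
  simp only [intervalIntegral.integral_same, sub_zero] at h
  exact h.mono_left (nhdsWithin_mono _ fun x hx => ne_of_gt hx)

theorem hasDerivAt_integral_window {F : Type*} [NormedAddCommGroup F] [NormedSpace ℝ F]
    [CompleteSpace F] {f : ℝ → F} (hf : Continuous f) (h r : ℝ) :
    HasDerivAt (fun r => ∫ s in r..(r + h), f s) (f (r + h) - f r) r := by
  have hd : ∀ r, HasDerivAt (fun t => ∫ s in (0 : ℝ)..t, f s) (f r) r := fun r =>
    intervalIntegral.integral_hasDerivAt_right (hf.intervalIntegrable _ _)
      hf.aestronglyMeasurable.stronglyMeasurableAtFilter hf.continuousAt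
  have h1 := (hd (r + h)).scomp r ((hasDerivAt_id r).add_const h)
  rw [one_smul] at h1
  refine (h1.sub (hd r)).congr_of_eventuallyEq (.of_forall fun t => ?_)
  exact (intervalIntegral.integral_interval_sub_left (hf.intervalIntegrable (μ := volume) _ _)
    (hf.intervalIntegrable (μ := volume) _ _)).symm

theorem hasDerivAt_norm_sq_complex {H : Type*} [NormedAddCommGroup H] [InnerProductSpace ℂ H]
    {B : ℝ → H} {B' : H} {r : ℝ} (hB : HasDerivAt B B' r) :
    HasDerivAt (fun t => ‖B t‖ ^ 2) (2 * (⟪B', B r⟫_ℂ).re) r := by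
  have h1 := Complex.reCLM.hasFDerivAt.comp_hasDerivAt r (hB.inner ℂ hB)
  refine (h1.congr_of_eventuallyEq (.of_forall fun t => ?_)).congr_deriv ?_
  · simp [← Complex.ofReal_pow]
  · have := inner_re_symm (𝕜 := ℂ) (B r) B'
    simp only [RCLike.re_eq_complex_re] at this
    simp only [Complex.reCLM_apply, Complex.add_re, this]
    ring

namespace IsWeakSolution

variable {a b : ℝ} {v : ℝ → H1}

/-- The kinetic energy of the window average of a solution is differentiable, although the kinetic
energy of the solution itself is not known to be. The derivative in `r` of `∫ ∇v` over `[r, r + h]`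
is the increment of `∇v`, so the derivative of the kinetic term is what the equation integrated over
the window yields when tested against the increment `v (r + h) - v r`. -/
theorem average_energy_identity (hv : IsWeakSolution a b v) {h : ℝ} (hh : 0 ≤ h) {r : ℝ}
    (hr : a ≤ r) (hrb : r + h ≤ b) :
    HasDerivAt (fun r => 1 / 2 * ‖∫ s in r..(r + h), (v s).grad‖ ^ 2)
      (∫ θ in (0 : ℝ)..h, (⟪(v (r + h)).fn - (v r).fn, nlH (v (r + θ))⟫_ℂ).re) r := by
  set w := v (r + h) - v r with hw
  have ef : w.fn = (v (r + h)).fn - (v r).fn := map_sub fnL _ _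
  have eg : w.grad = (v (r + h)).grad - (v r).grad := map_sub gradL _ _
  have hd := hasDerivAt_integral_window hv.continuous_grad h r
  have hid := hv.inner_sub w hr (by linarith) hrb
  rw [← ef] at hid ⊢
  have hN : ∫ s in r..(r + h), nlH (v s) = ∫ θ in (0 : ℝ)..h, nlH (v (r + θ)) := by
    rw [intervalIntegral.integral_comp_add_left (fun s => nlH (v s)) r, add_zero]
  have hc : Continuous fun θ => nlH (v (r + θ)) :=
    hv.continuous_nl.comp (continuous_const.add continuous_id)
  have hre : (⟪w.fn, ∫ s in r..(r + h), nlH (v s)⟫_ℂ).re =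
      ∫ θ in (0 : ℝ)..h, (⟪w.fn, nlH (v (r + θ))⟫_ℂ).re := by
    rw [hN]
    have h1 := (innerSL ℂ w.fn).intervalIntegral_comp_comm
      (hc.intervalIntegrable (μ := volume) 0 h)
    simp only [innerSL_apply_apply] at h1
    have hcw : Continuous fun θ => ⟪w.fn, nlH (v (r + θ))⟫_ℂ := continuous_const.inner hc
    have h2 := Complex.reCLM.intervalIntegral_comp_comm
      (hcw.intervalIntegrable (μ := volume) 0 h)
    simp only [Complex.reCLM_apply] at h2
    rw [h2, h1]
  -- the left side of the tested equation is real, so the imaginary part gives the identity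
  have him := congrArg Complex.im hid
  rw [inner_self_eq_norm_sq_to_K] at him
  simp only [Complex.mul_im, Complex.I_re, Complex.I_im, zero_mul, one_mul, zero_add,
    Complex.add_re, Complex.neg_re, Complex.coe_algebraMap, ← Complex.ofReal_pow,
    Complex.ofReal_im] at him
  refine ((hasDerivAt_norm_sq_complex hd).const_mul (1 / 2)).congr_deriv ?_
  rw [← hre, ← eg]
  linarith

/-- Comparison of the window averages of the energy at two times. The kinetic and potential terms
change by nearly the same amount: the difference is a second-order Taylor remainder, of size
`‖v (r + h) - v r‖₂² ≤ ε h` times a function of time that is integrable. -/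
theorem abs_average_energy_sub_le (hv : IsWeakSolution a b v) {A : ℝ → ℝ≥0∞} (hAm : Measurable A)
    (hA : ∀ t ∈ Icc a b, ∀ᵐ x, ‖(v t).fn x‖ₑ ≤ A t) {K : ℝ} (hK0 : 0 ≤ K)
    (hK : ∫⁻ t in Icc a b, A t ^ 4 ≤ ENNReal.ofReal K) {ε h t : ℝ} (hε : 0 < ε) (hh : 0 < h)
    (hat : a ≤ t) (htb : t + h ≤ b)
    (hsmall : ∀ s ∈ Icc a b, ∀ t ∈ Icc a b, |t - s| ≤ h →
      ‖(v t).fn - (v s).fn‖ ^ 2 ≤ ε * h) :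
    |(1 / 2 * ‖h⁻¹ • ∫ s in t..(t + h), (v s).grad‖ ^ 2 - h⁻¹ • ∫ s in t..(t + h), potE (v s)) -
      (1 / 2 * ‖h⁻¹ • ∫ s in a..(a + h), (v s).grad‖ ^ 2 - h⁻¹ • ∫ s in a..(a + h), potE (v s))| ≤
      16 * ε * ((t - a) + 3 * K) := by
  obtain ⟨g, hg⟩ : ∃ g : ℝ → ℝ → ℝ, ∀ r θ,
      g r θ = (⟪(v (r + h)).fn - (v r).fn, nlH (v (r + θ))⟫_ℂ).re := ⟨_, fun _ _ => rfl⟩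
  set P : ℝ → ℝ := fun s => potE (v s) with hP
  have hPc : Continuous P := continuous_potE.comp hv.continuous
  have hgc : Continuous (Function.uncurry g) := by
    have c1 := hv.continuous_fn
    have c2 := hv.continuous_nl
    have d1 : Continuous fun p : ℝ × ℝ => (v (p.1 + h)).fn - (v p.1).fn :=
      (c1.comp (continuous_fst.add continuous_const)).sub (c1.comp continuous_fst)
    have d2 : Continuous fun p : ℝ × ℝ => nlH (v (p.1 + p.2)) :=
      c2.comp (continuous_fst.add continuous_snd)
    have e : Function.uncurry g = fun p : ℝ × ℝ =>
        (⟪(v (p.1 + h)).fn - (v p.1).fn, nlH (v (p.1 + p.2))⟫_ℂ).re :=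
      funext fun p => hg p.1 p.2
    rw [e]
    exact Complex.continuous_re.comp (d1.inner (𝕜 := ℂ) d2)
  have hgr : ∀ θ, Continuous fun r => g r θ := fun θ =>
    hgc.comp (continuous_id.prodMk continuous_const)
  have hGc : Continuous fun r => ∫ θ in (0 : ℝ)..h, g r θ :=
    intervalIntegral.continuous_parametric_intervalIntegral_of_continuous' hgc 0 h
  have hGc' : Continuous fun θ => ∫ r in a..t, g r θ :=
    intervalIntegral.continuous_parametric_intervalIntegral_of_continuous'
      (f := fun θ r => g r θ) (hgc.comp continuous_swap) a t
  -- integrate the energy identity and exchange the integrals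
  have hkin : 1 / 2 * ‖∫ s in t..(t + h), (v s).grad‖ ^ 2 -
      1 / 2 * ‖∫ s in a..(a + h), (v s).grad‖ ^ 2 = ∫ θ in (0 : ℝ)..h, ∫ r in a..t, g r θ := by
    have hftc := intervalIntegral.integral_eq_sub_of_hasDerivAt
      (f := fun r => 1 / 2 * ‖∫ s in r..(r + h), (v s).grad‖ ^ 2)
      (f' := fun r => ∫ θ in (0 : ℝ)..h, g r θ) (a := a) (b := t)
      (fun r hr => by
        rw [uIcc_of_le hat] at hr
        simp only [hg]
        exact hv.average_energy_identity hh.le hr.1 (by linarith [hr.2]))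
      (hGc.intervalIntegrable _ _)
    rw [← hftc]
    refine intervalIntegral_intervalIntegral_swap ?_
    refine (hgc.continuousOn.integrableOn_compact
      ((isCompact_uIcc (a := a) (b := t)).prod (isCompact_uIcc (a := 0) (b := h)))).mono_set ?_
    exact prod_mono uIoc_subset_uIcc uIoc_subset_uIcc
  have hPd : ∫ r in a..t, (P (r + h) - P r) =
      (∫ s in t..(t + h), P s) - ∫ s in a..(a + h), P s := by
    have i : ∀ x y, IntervalIntegrable P volume x y := fun x y => hPc.intervalIntegrable x y
    have hPh : Continuous fun r => P (r + h) := hPc.comp (continuous_id.add continuous_const)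
    rw [intervalIntegral.integral_sub (hPh.intervalIntegrable _ _) (i _ _),
      intervalIntegral.integral_comp_add_right,
      intervalIntegral.integral_interval_sub_interval_comm' (i _ _) (i _ _) (i _ _)]
  -- translates of the fourth power of the sup bound
  have htr : ∀ η, 0 ≤ η → η ≤ h → ∫⁻ r in Ioc a t, A (r + η) ^ 4 ≤ ENNReal.ofReal K := by
    intro η h0 h1
    refine le_trans ?_ hK
    rw [← lintegral_indicator measurableSet_Ioc, ← lintegral_indicator measurableSet_Icc,
      ← lintegral_add_right_eq_self ((Icc a b).indicator fun t => A t ^ 4) η]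
    refine lintegral_mono fun r => ?_
    by_cases hr : r ∈ Ioc a t
    · rw [indicator_of_mem hr, indicator_of_mem (by
        simp only [mem_Icc, mem_Ioc] at hr ⊢; constructor <;> linarith)]
    · rw [indicator_of_notMem hr]
      exact zero_le
  have hθ : ∀ θ ∈ Icc 0 h, |∫ r in a..t, (g r θ - (P (r + h) - P r))| ≤
      16 * (ε * h) * ((t - a) + 3 * K) := by
    intro θ hθ
    have hεh : 0 < ε * h := by positivity
    have hta : 0 ≤ t - a := sub_nonneg.2 hat
    rw [← ENNReal.ofReal_le_ofReal_iff (by positivity), intervalIntegral.integral_of_le hat,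
      ← Real.norm_eq_abs, ofReal_norm]
    refine (enorm_integral_le_lintegral_enorm _).trans ?_
    have hpt : ∀ r ∈ Ioc a t, ‖g r θ - (P (r + h) - P r)‖ₑ ≤ ENNReal.ofReal (16 * (ε * h)) *
        (1 + A (r + 0) ^ 4 + A (r + h) ^ 4 + A (r + θ) ^ 4) := by
      intro r hr
      have m0 : r ∈ Icc a b := ⟨hr.1.le, by linarith [hr.2]⟩
      have m1 : r + h ∈ Icc a b := ⟨by linarith [hr.1], by linarith [hr.2]⟩
      have m2 : r + θ ∈ Icc a b := ⟨by linarith [hr.1, hθ.1], by linarith [hr.2, hθ.2]⟩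
      rw [← ofReal_norm, Real.norm_eq_abs, abs_sub_comm, add_zero, hg]
      refine ofReal_abs_potE_sub_le hεh (hA r m0) (hA _ m1) (hA _ m2)
        (hsmall r m0 _ m1 ?_) (hsmall _ m2 r m0 ?_) (hsmall _ m2 _ m1 ?_)
      · rw [add_sub_cancel_left, abs_of_pos hh]
      · rw [abs_sub_comm, add_sub_cancel_left, abs_of_nonneg hθ.1]; exact hθ.2
      · rw [add_sub_add_left_eq_sub, abs_of_nonneg (by linarith [hθ.2])]; linarith [hθ.1]
    have hmA : ∀ η, Measurable fun r => A (r + η) ^ 4 := fun η =>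
      (hAm.comp (measurable_id.add_const η)).pow_const 4
    calc _ ≤ ∫⁻ r in Ioc a t, ENNReal.ofReal (16 * (ε * h)) *
          (1 + A (r + 0) ^ 4 + A (r + h) ^ 4 + A (r + θ) ^ 4) :=
          setLIntegral_mono (((((hmA 0).const_add 1).add (hmA h)).add (hmA θ)).const_mul _) hpt
      _ = ENNReal.ofReal (16 * (ε * h)) * (ENNReal.ofReal (t - a) +
          (∫⁻ r in Ioc a t, A (r + 0) ^ 4) + (∫⁻ r in Ioc a t, A (r + h) ^ 4) +
            ∫⁻ r in Ioc a t, A (r + θ) ^ 4) := by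
          rw [lintegral_const_mul _ (by exact (((hmA 0).const_add 1).add (hmA h)).add (hmA θ)),
            lintegral_add_right _ (hmA θ), lintegral_add_right _ (hmA h),
            lintegral_add_right _ (hmA 0), lintegral_const, Measure.restrict_apply_univ,
            Real.volume_Ioc, one_mul]
      _ ≤ ENNReal.ofReal (16 * (ε * h)) * (ENNReal.ofReal (t - a) +
          ENNReal.ofReal K + ENNReal.ofReal K + ENNReal.ofReal K) := by
          gcongr
          · exact htr 0 le_rfl hh.le
          · exact htr h hh.le le_rfl
          · exact htr θ hθ.1 hθ.2
      _ = _ := by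
          rw [← ENNReal.ofReal_add hta hK0, ← ENNReal.ofReal_add (by positivity) hK0,
            ← ENNReal.ofReal_add (by positivity) hK0, ← ENNReal.ofReal_mul (by positivity)]
          congr 1
          ring
  -- each `θ` in the window contributes one Taylor remainder
  have hdiff : (1 / 2 * ‖∫ s in t..(t + h), (v s).grad‖ ^ 2 -
      1 / 2 * ‖∫ s in a..(a + h), (v s).grad‖ ^ 2) -
      h * ((∫ s in t..(t + h), P s) - ∫ s in a..(a + h), P s) =
      ∫ θ in (0 : ℝ)..h, ∫ r in a..t, (g r θ - (P (r + h) - P r)) := by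
    have hPh : Continuous fun r => P (r + h) - P r :=
      (hPc.comp (continuous_id.add continuous_const)).sub hPc
    have e : ∀ θ, ∫ r in a..t, (g r θ - (P (r + h) - P r)) =
        (∫ r in a..t, g r θ) - ∫ r in a..t, (P (r + h) - P r) := fun θ =>
      intervalIntegral.integral_sub ((hgr θ).intervalIntegrable _ _) (hPh.intervalIntegrable _ _)
    simp only [e]
    rw [intervalIntegral.integral_sub (hGc'.intervalIntegrable _ _)
      intervalIntegrable_const, intervalIntegral.integral_const, sub_zero, smul_eq_mul, hkin, hPd]
  have hfin : |∫ θ in (0 : ℝ)..h, ∫ r in a..t, (g r θ - (P (r + h) - P r))| ≤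
      16 * (ε * h) * ((t - a) + 3 * K) * |h - 0| := by
    rw [← Real.norm_eq_abs]
    refine intervalIntegral.norm_integral_le_of_norm_le_const fun θ hθ' => ?_
    rw [uIoc_of_le hh.le] at hθ'
    exact hθ θ ⟨hθ'.1.le, hθ'.2⟩
  rw [← hdiff, sub_zero, abs_of_pos hh] at hfin
  have e : (1 / 2 * ‖h⁻¹ • ∫ s in t..(t + h), (v s).grad‖ ^ 2 - h⁻¹ • ∫ s in t..(t + h), P s) -
      (1 / 2 * ‖h⁻¹ • ∫ s in a..(a + h), (v s).grad‖ ^ 2 - h⁻¹ • ∫ s in a..(a + h), P s) =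
      (h ^ 2)⁻¹ * ((1 / 2 * ‖∫ s in t..(t + h), (v s).grad‖ ^ 2 -
        1 / 2 * ‖∫ s in a..(a + h), (v s).grad‖ ^ 2) -
        h * ((∫ s in t..(t + h), P s) - ∫ s in a..(a + h), P s)) := by
    rw [norm_smul, norm_smul, norm_inv, Real.norm_of_nonneg hh.le, smul_eq_mul, smul_eq_mul]
    field_simp
    ring
  rw [e, abs_mul, abs_of_pos (by positivity)]
  calc _ ≤ (h ^ 2)⁻¹ * (16 * (ε * h) * ((t - a) + 3 * K) * h) := by gcongr
    _ = _ := by field_simp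

/-- Conservation of energy before the final time, from the window averages as the window length
tends to zero. -/
theorem energy_eq_of_lt (hv : IsWeakSolution a b v) {t : ℝ} (ht : t ∈ Ico a b) :
    energy (v t) = energy (v a) := by
  obtain ⟨A, hAm, hAK, hA⟩ := hv.exists_sup_bound
  set K : ℝ := (∫⁻ t in Icc a b, A t ^ 4).toReal
  have hK : ∫⁻ t in Icc a b, A t ^ 4 ≤ ENNReal.ofReal K := (ENNReal.ofReal_toReal hAK.ne).ge
  have hK0 : 0 ≤ K := ENNReal.toReal_nonneg
  set Φ : ℝ → ℝ → ℝ := fun r h =>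
    1 / 2 * ‖h⁻¹ • ∫ s in r..(r + h), (v s).grad‖ ^ 2 - h⁻¹ • ∫ s in r..(r + h), potE (v s)
  have hΦ : ∀ r, Tendsto (Φ r) (𝓝[>] 0) (𝓝 (energy (v r))) := by
    intro r
    rw [energy_eq]
    exact (((tendsto_average_integral hv.continuous_grad r).norm.pow 2).const_mul (1 / 2)).sub
      (tendsto_average_integral (continuous_potE.comp hv.continuous) r)
  have hta : 0 ≤ t - a := sub_nonneg.2 ht.1
  have hle : ∀ ε > 0, |energy (v t) - energy (v a)| ≤ ε * (16 * ((t - a) + 3 * K)) := by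
    intro ε hε
    obtain ⟨h₀, hh₀, hsm⟩ := hv.exists_norm_sub_sq_le hε
    refine le_of_tendsto ((hΦ t).sub (hΦ a)).abs ?_
    have hpos : 0 < min h₀ (b - t) := lt_min hh₀ (sub_pos.2 ht.2)
    filter_upwards [Ioo_mem_nhdsGT hpos] with h hh
    refine (hv.abs_average_energy_sub_le hAm hA hK0 hK hε hh.1 ht.1
      (by linarith [(lt_min_iff.1 hh.2).2]) (hsm h hh.1 (lt_min_iff.1 hh.2).1.le)).trans_eq ?_
    ring
  have h0 : |energy (v t) - energy (v a)| ≤ 0 := by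
    have hlim : Tendsto (fun ε : ℝ => ε * (16 * ((t - a) + 3 * K))) (𝓝[>] 0)
        (𝓝 (0 * (16 * ((t - a) + 3 * K)))) :=
      ((continuous_id.mul continuous_const).tendsto 0).mono_left nhdsWithin_le_nhds
    rw [zero_mul] at hlim
    exact ge_of_tendsto hlim (by filter_upwards [self_mem_nhdsWithin] with ε hε using hle ε hε)
  have := abs_nonpos_iff.1 h0
  linarith

theorem energy_eq_left (hv : IsWeakSolution a b v) {t : ℝ} (ht : t ∈ Icc a b) :
    energy (v t) = energy (v a) := by
  rcases ht.2.lt_or_eq with h | rfl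
  · exact hv.energy_eq_of_lt ⟨ht.1, h⟩
  rcases ht.1.eq_or_lt with h | h
  · rw [h]
  have hc : Continuous fun t => energy (v t) := continuous_energy.comp hv.continuous
  have h1 : Tendsto (fun s => energy (v s)) (𝓝[<] t) (𝓝 (energy (v t))) :=
    (hc.tendsto t).mono_left nhdsWithin_le_nhds
  refine tendsto_nhds_unique h1 (tendsto_const_nhds.congr' ?_)
  filter_upwards [Ico_mem_nhdsLT h] with s hs
  exact (hv.energy_eq_of_lt hs).symm

end IsWeakSolution

theorem IsSolution.conservation_of_le {I : Set ℝ} (hI : I.OrdConnected) {u : ℝ → H1}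
    (hu : IsSolution I u) {s t : ℝ} (hs : s ∈ I) (ht : t ∈ I) (hst : s ≤ t) :
    mass (u t) = mass (u s) ∧ energy (u t) = energy (u s) := by
  have hv := hu.isWeakSolution hst (hI.out hs ht)
  have h1 := hv.mass_eq (right_mem_Icc.2 hst)
  have h2 := hv.energy_eq_left (right_mem_Icc.2 hst)
  simp only [projIcc_left, projIcc_right] at h1 h2
  exact ⟨h1, h2⟩

/-- Solutions in `C(I; H¹)` conserve mass and energy. -/
theorem IsSolution.conservation {I : Set ℝ} (hI : I.OrdConnected) {u : ℝ → H1}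
    (hu : IsSolution I u) {s t : ℝ} (hs : s ∈ I) (ht : t ∈ I) :
    mass (u t) = mass (u s) ∧ energy (u t) = energy (u s) := by
  rcases le_total s t with h | h
  · exact hu.conservation_of_le hI hs ht h
  · exact (hu.conservation_of_le hI ht hs h).imp Eq.symm Eq.symm

/-! ### Scaling and the variational bound -/

theorem integral_eq_of_ae_eq_comp_smul {F : Type*} [NormedAddCommGroup F] [NormedSpace ℝ F]
    {f G : Plane → F} {l : ℝ} (h : f =ᵐ[volume] fun x => G (l • x)) :
    ∫ x, f x = (l ^ 2)⁻¹ • ∫ x, G x := by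
  rw [integral_congr_ae h, Measure.integral_comp_smul, finrank_plane,
    abs_of_nonneg (by positivity)]

theorem memLp_two_rescale {F : Type*} [NormedAddCommGroup F] [NormedSpace ℂ F]
    {f : Plane → F} (hf : MemLp f 2 volume) (c : ℂ) {l : ℝ} (hl : l ≠ 0) :
    MemLp (fun x => c • f (l • x)) 2 (volume : Measure Plane) := by
  have hm : AEStronglyMeasurable (fun x => f (l • x)) (volume : Measure Plane) :=
    hf.1.comp_quasiMeasurePreserving (Measure.quasiMeasurePreserving_smul _ hl)
  have : MemLp (fun x => f (l • x)) 2 (volume : Measure Plane) := by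
    rw [memLp_two_iff_integrable_sq_norm hm]
    exact ((memLp_two_iff_integrable_sq_norm hf.1).1 hf).comp_smul hl
  exact this.const_smul c

/-- The mass-preserving rescaling `l · v(l ·)` of an element of `H¹`. -/
theorem exists_rescale (v : H1) {l : ℝ} (hl : 0 < l) :
    ∃ w : H1, mass w = mass v ∧ ‖w.grad‖ ^ 2 = l ^ 2 * ‖v.grad‖ ^ 2 ∧
      ∫ x, ‖w.fn x‖ ^ 4 = l ^ 2 * ∫ x, ‖v.fn x‖ ^ 4 ∧
      ∫ x, ‖w.fn x‖ ^ 6 = l ^ 4 * ∫ x, ‖v.fn x‖ ^ 6 := by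
  have hl0 : l ≠ 0 := hl.ne'
  set f : L2 := (memLp_two_rescale (Lp.memLp v.fn) (l : ℂ) hl0).toLp with hf
  set g : L2Field := (memLp_two_rescale (Lp.memLp v.grad) ((l ^ 2 : ℝ) : ℂ) hl0).toLp with hg
  have hfx : f =ᵐ[volume] fun x => (l : ℂ) • v.fn (l • x) := MemLp.coeFn_toLp _
  have hgx : g =ᵐ[volume] fun x => ((l ^ 2 : ℝ) : ℂ) • v.grad (l • x) := MemLp.coeFn_toLp _
  have hweak : IsWeakGradient f g := by
    intro φ j
    -- the change of variables moves the dilation to the test function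
    set L : Plane ≃L[ℝ] Plane := ContinuousLinearEquiv.smulLeft (Units.mk0 l hl0)⁻¹ with hL
    have hLx : ∀ x, L x = l⁻¹ • x := fun x => rfl
    set ψ : 𝓢(Plane, ℂ) := SchwartzMap.compCLMOfContinuousLinearEquiv ℂ L φ with hψ
    have hψx : ∀ x, ψ x = φ (l⁻¹ • x) := fun x => rfl
    have hφ : ∀ x, φ x = ψ (l • x) := fun x => by rw [hψx, smul_smul, inv_mul_cancel₀ hl0, one_smul]
    have hd : ∀ x, partialDeriv j φ x = l * partialDeriv j ψ (l • x) := by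
      intro x
      have h1 : HasFDerivAt (fun x => ψ (l • x)) _ x :=
        (ψ.hasFDerivAt (l • x)).comp x ((hasFDerivAt_id x).const_smul l)
      have h2 : (⇑φ : Plane → ℂ) = fun x => ψ (l • x) := funext hφ
      rw [partialDeriv, partialDeriv, h2, h1.fderiv]
      simp
    have e1 : ∫ x, f x * partialDeriv j φ x =
        (l ^ 2)⁻¹ • ∫ y, ((l ^ 2 : ℝ) : ℂ) * (v.fn y * partialDeriv j ψ y) := by
      apply integral_eq_of_ae_eq_comp_smul
        (G := fun y => ((l ^ 2 : ℝ) : ℂ) * (v.fn y * partialDeriv j ψ y))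
      filter_upwards [hfx] with x hx
      rw [hx, hd, smul_eq_mul]
      push_cast
      ring
    have e2 : ∫ x, (g x) j * φ x =
        (l ^ 2)⁻¹ • ∫ y, ((l ^ 2 : ℝ) : ℂ) * ((v.grad y) j * ψ y) := by
      apply integral_eq_of_ae_eq_comp_smul (G := fun y => ((l ^ 2 : ℝ) : ℂ) * ((v.grad y) j * ψ y))
      filter_upwards [hgx] with x hx
      rw [hx, hφ, PiLp.smul_apply, smul_eq_mul, mul_assoc]
    have hw : IsWeakGradient v.fn v.grad := v.2
    rw [e1, e2, integral_const_mul,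
      integral_const_mul, hw ψ j, mul_neg, smul_neg]
  refine ⟨⟨WithLp.toLp 2 (f, g), hweak⟩, ?_, ?_, ?_, ?_⟩
  · change ‖f‖ = ‖v.fn‖
    have h : ‖f‖ ^ 2 = ‖v.fn‖ ^ 2 := by
      rw [← integral_norm_sq_eq, ← integral_norm_sq_eq]
      have : ∫ x, ‖f x‖ ^ 2 =
          (l ^ 2)⁻¹ • ∫ y, l ^ 2 * ‖v.fn y‖ ^ 2 := by
        apply integral_eq_of_ae_eq_comp_smul (G := fun y => l ^ 2 * ‖v.fn y‖ ^ 2)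
        filter_upwards [hfx] with x hx
        rw [hx, norm_smul, Complex.norm_real, Real.norm_of_nonneg hl.le]
        ring
      rw [this, integral_const_mul, smul_eq_mul]
      field_simp
    exact (pow_left_inj₀ (norm_nonneg _) (norm_nonneg _) two_ne_zero).1 h
  · change ‖g‖ ^ 2 = l ^ 2 * ‖v.grad‖ ^ 2
    rw [← integral_norm_sq_eq, ← integral_norm_sq_eq]
    have : ∫ x, ‖g x‖ ^ 2 =
        (l ^ 2)⁻¹ • ∫ y, l ^ 4 * ‖v.grad y‖ ^ 2 := by
      apply integral_eq_of_ae_eq_comp_smul (G := fun y => l ^ 4 * ‖v.grad y‖ ^ 2)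
      filter_upwards [hgx] with x hx
      rw [hx, norm_smul, Complex.norm_real, Real.norm_of_nonneg (by positivity)]
      ring
    rw [this, integral_const_mul, smul_eq_mul]
    field_simp
  · change ∫ x, ‖f x‖ ^ 4 = l ^ 2 * ∫ x, ‖v.fn x‖ ^ 4
    have : ∫ x, ‖f x‖ ^ 4 =
        (l ^ 2)⁻¹ • ∫ y, l ^ 4 * ‖v.fn y‖ ^ 4 := by
      apply integral_eq_of_ae_eq_comp_smul (G := fun y => l ^ 4 * ‖v.fn y‖ ^ 4)
      filter_upwards [hfx] with x hx
      rw [hx, norm_smul, Complex.norm_real, Real.norm_of_nonneg hl.le]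
      ring
    rw [this, integral_const_mul, smul_eq_mul]
    field_simp
  · change ∫ x, ‖f x‖ ^ 6 = l ^ 4 * ∫ x, ‖v.fn x‖ ^ 6
    have : ∫ x, ‖f x‖ ^ 6 =
        (l ^ 2)⁻¹ • ∫ y, l ^ 6 * ‖v.fn y‖ ^ 6 := by
      apply integral_eq_of_ae_eq_comp_smul (G := fun y => l ^ 6 * ‖v.fn y‖ ^ 6)
      filter_upwards [hfx] with x hx
      rw [hx, norm_smul, Complex.norm_real, Real.norm_of_nonneg hl.le]
      ring
    rw [this, integral_const_mul, smul_eq_mul]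
    field_simp

/-- The infimum defining `minEnergy` is over a set bounded below, since the energy equals
`⅙‖v‖₆⁶` where the virial vanishes. -/
theorem minEnergy_le {v : H1} (hv : virial v = 0) : minEnergy (mass v) ≤ energy v := by
  refine csInf_le ⟨0, ?_⟩ ⟨v, ⟨rfl, hv⟩, rfl⟩
  rintro _ ⟨w, ⟨-, hw⟩, rfl⟩
  have h6 : 0 ≤ ∫ x, ‖w.fn x‖ ^ 6 := integral_nonneg fun x => by positivity
  have : energy w = 1 / 2 * virial w + 1 / 6 * ∫ x, ‖w.fn x‖ ^ 6 := by
    rw [energy, virial]; ring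
  rw [this, hw]
  linarith

/-- The zero function is excluded, as it would satisfy
`½‖∇v‖₂² = 𝓗(v) < m_{𝓜(v)} ≤ 0 < 𝓚(v) = ‖∇v‖₂²`. -/
theorem integral_pow_six_pos {v : H1} (hE : energy v < minEnergy (mass v)) (hK : 0 < virial v) :
    0 < ∫ x, ‖v.fn x‖ ^ 6 := by
  have h6 : 0 ≤ ∫ x, ‖v.fn x‖ ^ 6 := integral_nonneg fun x => by positivity
  refine h6.lt_of_ne fun h0 => ?_
  have hi : Integrable fun x => ‖v.fn x‖ ^ 6 := integrable_norm_pow v 2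
  have hz : v.fn = 0 := by
    have h1 := (integral_eq_zero_iff_of_nonneg (fun x => by positivity) hi).1 h0.symm
    rw [Lp.eq_zero_iff_ae_eq_zero]
    filter_upwards [h1] with x hx
    simpa using hx
  have h4 : ∫ x, ‖v.fn x‖ ^ 4 = 0 := by
    rw [← integral_zero Plane ℝ (μ := volume)]
    apply integral_congr_ae
    filter_upwards [(Lp.eq_zero_iff_ae_eq_zero).1 hz] with x hx
    simp [hx]
  have hm : minEnergy (mass v) ≤ 0 := by
    have e0 : (0 : H1).fn = 0 := map_zero fnL
    have eg : (0 : H1).grad = 0 := map_zero gradL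
    have e4 : ∀ k : ℕ, k ≠ 0 → ∫ x, ‖(0 : H1).fn x‖ ^ k = 0 := by
      intro k hk
      rw [e0, ← integral_zero Plane ℝ (μ := volume)]
      apply integral_congr_ae
      filter_upwards [Lp.coeFn_zero ℂ 2 (volume : Measure Plane)] with x hx
      simp [hk]
    have hv0 : virial 0 = 0 := by rw [virial, eg, e4 4 (by norm_num), e4 6 (by norm_num)]; simp
    have hE0 : energy 0 = 0 := by rw [energy, eg, e4 4 (by norm_num), e4 6 (by norm_num)]; simp
    have hm0 : mass (0 : H1) = mass v := by rw [mass, mass, e0, hz]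
    have := minEnergy_le hv0
    rwa [hm0, hE0] at this
  rw [energy, h4, ← h0] at hE
  rw [virial, h4, ← h0] at hK
  linarith

/-- Rescaling `v` so that its virial vanishes shows `m_{𝓜(v)} - 𝓗(v) ≤ 𝓚(v)² / (4x)` with
`x = ⅔‖v‖₆⁶`. -/
theorem minEnergy_sub_energy_le {v : H1} (hE : energy v < minEnergy (mass v))
    (hK : 0 < virial v) :
    minEnergy (mass v) - energy v ≤ virial v ^ 2 / (4 * (2 / 3 * ∫ x, ‖v.fn x‖ ^ 6)) := by
  have h6 := integral_pow_six_pos hE hK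
  set x := 2 / 3 * ∫ x, ‖v.fn x‖ ^ 6 with hx
  set a := ‖v.grad‖ ^ 2 - 1 / 2 * ∫ x, ‖v.fn x‖ ^ 4 with ha
  have hx0 : 0 < x := by positivity
  have hKa : virial v = a - x := by rw [virial]
  have hEa : energy v = a / 2 - x / 4 := by rw [energy, hx, ha]; ring
  have ha0 : 0 < a := by linarith
  -- the rescaled virial is `l ^ 2 * a - l ^ 4 * x`, which vanishes for `l ^ 2 = a / x`
  obtain ⟨w, hm, hg, h4, h6w⟩ := exists_rescale v (l := √(a / x)) (Real.sqrt_pos.2 (by positivity))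
  have hl2 : √(a / x) ^ 2 = a / x := Real.sq_sqrt (by positivity)
  have hl4 : √(a / x) ^ 4 = (a / x) ^ 2 := by
    calc √(a / x) ^ 4 = (√(a / x) ^ 2) ^ 2 := by ring
      _ = (a / x) ^ 2 := by rw [hl2]
  rw [hl2] at hg h4
  rw [hl4] at h6w
  have hKw : virial w = 0 := by
    have : virial w = a / x * a - (a / x) ^ 2 * x := by
      rw [virial, hg, h4, h6w, ha, hx]; ring
    rw [this]
    field_simp
    ring
  have hEw : energy w = a ^ 2 / (4 * x) := by
    have : energy w = 1 / 2 * virial w + 1 / 4 * ((a / x) ^ 2 * x) := by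
      rw [energy, virial, h6w, hx]; ring
    rw [this, hKw]
    field_simp
    ring
  have hle := minEnergy_le hKw
  rw [hm, hEw] at hle
  have : virial v ^ 2 / (4 * x) = a ^ 2 / (4 * x) - energy v := by
    rw [hKa, hEa]
    field_simp
    ring
  linarith

/-- With `x = ⅔‖v‖₆⁶` one has `𝓗(v) = ½𝓚(v) + ¼x`. If the first bound fails, then `𝓚(v)` is small
compared with `x`, and the quadratic bound `𝓚(v)² / (4x)` for `m_{𝓜(v)} - 𝓗(v)` gives the second. -/
theorem min_le_virial {v : H1} (hE : energy v < minEnergy (mass v)) (hK : 0 < virial v) {δ : ℝ}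
    (hδ : δ ∈ Ioo (0 : ℝ) 1) :
    min (δ * energy v) ((√(2 / δ) - 1)⁻¹ * (minEnergy (mass v) - energy v)) ≤ virial v := by
  rcases le_or_gt (δ * energy v) (virial v) with h | h
  · exact (min_le_left _ _).trans h
  refine (min_le_right _ _).trans ?_
  have hm := minEnergy_sub_energy_le hE hK
  have h6 := integral_pow_six_pos hE hK
  set x := 2 / 3 * ∫ x, ‖v.fn x‖ ^ 6 with hx
  have hx0 : 0 < x := by positivity
  have hEK : energy v = virial v / 2 + x / 4 := by rw [energy, virial, hx]; ring
  set k := virial v with hk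
  set s := √(2 / δ) with hs
  have hδ0 := hδ.1
  have hs2 : s ^ 2 = 2 / δ := Real.sq_sqrt (by positivity)
  have hs2' : 2 ≤ s ^ 2 := by
    rw [hs2, le_div_iff₀ hδ0]; linarith [hδ.2]
  have hs0 : 0 ≤ s := Real.sqrt_nonneg _
  have hs1 : 9 / 8 ≤ s := by nlinarith
  have hδs : δ * s ^ 2 = 2 := by rw [hs2]; field_simp
  -- the failure of the first bound makes `k` small compared with `x`
  have h1 : 2 * (k * (s ^ 2 - 1)) ≤ x := by
    rw [hEK] at h
    have : s ^ 2 * k ≤ s ^ 2 * (δ * (k / 2 + x / 4)) := by gcongr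
    have e : s ^ 2 * (δ * (k / 2 + x / 4)) = (δ * s ^ 2) * (k / 2 + x / 4) := by ring
    rw [e, hδs] at this
    linarith
  have h2 : k ≤ 4 * x * (s - 1) := by
    have h3 : 1 ≤ 8 * ((s - 1) * (s ^ 2 - 1)) := by nlinarith
    have h4 : 8 * ((s - 1) * (k * (s ^ 2 - 1))) ≤ 4 * x * (s - 1) := by nlinarith
    nlinarith
  rw [inv_mul_le_iff₀ (by linarith)]
  refine hm.trans ?_
  rw [div_le_iff₀ (by positivity)]
  nlinarith

end CQNLS

end

/-- The interval `I` is arbitrary, so in particular it may be the maximal lifespan of `u`. -/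
theorem mainTheorem6 (Q : CQNLS.H1) (hQ : CQNLS.IsPositiveRadialGroundState Q)
    (I : Set ℝ) (hI : I.OrdConnected) (h0 : (0 : ℝ) ∈ I)
    (u : ℝ → CQNLS.H1) (hu : CQNLS.IsSolution I u) (hA : u 0 ∈ CQNLS.setA Q) :
    (∀ t ∈ I, u t ∈ CQNLS.setA Q) ∧
      ∀ δ ∈ Set.Ioo (0 : ℝ) 1, CQNLS.mass (u 0) = Real.sqrt (1 - δ) * CQNLS.mass Q →
        ∀ t ∈ I,
          min (δ * CQNLS.energy (u 0))
              ((Real.sqrt (2 / δ) - 1)⁻¹ *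
                (CQNLS.minEnergy (CQNLS.mass (u 0)) - CQNLS.energy (u 0)))
            ≤ CQNLS.virial (u t) := by
  obtain ⟨hM0, hE0, hK0⟩ := hA
  have hcons := fun t (ht : t ∈ I) => hu.conservation hI h0 ht
  have hE : ∀ t ∈ I, CQNLS.energy (u t) < CQNLS.minEnergy (CQNLS.mass (u t)) := fun t ht => by
    rw [(hcons t ht).1, (hcons t ht).2]; exact hE0
  have hK : ∀ t ∈ I, 0 < CQNLS.virial (u t) := by
    intro t ht
    by_contra hneg
    -- by continuity the virial would vanish at some time, where the energy is at least `m_c`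
    obtain ⟨s, hs, hs0⟩ := hI.isPreconnected.intermediate_value ht h0
      (CQNLS.continuous_virial.comp_continuousOn hu.continuousOn) ⟨not_lt.1 hneg, hK0.le⟩
    exact absurd (CQNLS.minEnergy_le hs0) (not_le.2 (hE s hs))
  refine ⟨fun t ht => ⟨?_, hE t ht, hK t ht⟩, fun δ hδ _ t ht => ?_⟩
  · rw [(hcons t ht).1]; exact hM0
  · have h := CQNLS.min_le_virial (hE t ht) (hK t ht) hδ
    rwa [(hcons t ht).1, (hcons t ht).2] at h
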